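/- Let $G$ be a group, $\{H_\lambda\}_{\lambda\in\Lambda}$ a collection of subgroups of $G$, $X\subseteq G$ a symmetric subset, and $\mathcal H=\bigsqcup_{\lambda\in\Lambda}H_\lambda$. For $\lambda\in\Lambda$ and $a,b\in H_\lambda$ let $\widehat d_\lambda(a,b)\in[0,\infty]$ be the length of a shortest path from $a$ to $b$ in the Cayley graph $\Gamma(G,X\sqcup\mathcal H)$ that has no edges in the complete subgraph $\Gamma(H_\lambda,H_\lambda)$ ($\infty$ if there is no such path). Suppose that $\{H_\lambda\}$ is hyperbolically embedded in $G$ with respect to $X$: $G$ is generated by $X\cup\bigcup_\lambda H_\lambda$, the graph $\Gamma(G,X\sqcup\mathcal H)$ is hyperbolic, and all balls of finite radius in $(H_\lambda,\widehat d_\lambda)$ are finite, for every $\lambda$. (i) Every exponential equation $a_1g_1^{x_1}a_2g_2^{x_2}\cdots a_ng_n^{x_n}=1$ with integer variables $x_1,\dots,x_n$, with $a_1,\dots,a_n\in G$ and with $g_i\in H_{\lambda_i}$, $\lambda_i\in\Lambda$, is equivalent (has the same solutions in $\mathbb Z^n$) to a finite disjunction $\bigvee_{i=1}^k\bigwedge_{j=1}^{\ell_i}E_{ij}$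 of finite systems of equations such that (1) each $E_{ij}$ is either an exponential equation over some $H_\lambda$ or a trivial equation $g_{ij}=1$ with $g_{ij}\in G$, and (2) for every $i$, the sets of variables of $E_{i,j_1}$ and $E_{i,j_2}$ are disjoint if $j_1\ne j_2$ (and the variables of each single exponential equation are distinct). (ii) There is a constant $C(1,1)>0$ such that for every $m\ge 2$, every closed path $p_1\cdots p_m$ in $\Gamma(G,X\sqcup\mathcal H)$ and every set $I$ of its sides such that each side $p_i\in I$ is an isolated $H_{\mu_i}$-component of the closed path for some $\mu_i\in\Lambda$ (a maximal nontrivial subpath labelled by letters of $H_{\mu_i}$, no vertex of which is joined to a vertex of another such subpath for the same $\mu_i$ by a path labelled by letters of $H_{\mu_i}$) and each side $p_i\notin I$ is a $(1,1)$-quasi-geodesic, one has $\sum_{p_i\in I}\widehat d_{\mu_i}(1,h_i)\le C(1,1)\,m$, where $h_i\in H_{\mu_i}$ is the element represented by the label of $p_i$. Let $C(1,1)$ be any such constant. (iii) Let the elements $a_i$ be given by words $A_i$ in the alphabet $X\sqcup\mathcal H$, and let $L=n+\sum_{i=1}^n|A_i|$; thus $L=n+\sum_{i=1}^n|a_i|_{X\cup\mathcal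 H}$ if the $A_i$ are shortest words. A disjunction as in (i) can be written algorithmically if there is an algorithm computing, for $\lambda\in\{\lambda_1,\dots,\lambda_n\}$, the finite set $\{h\in H_\lambda\mid \widehat d_\lambda(1,h)\le C(1,1)\cdot L\}$. More precisely, there is one algorithm which, for all equations with $g_i\in\mathcal H$ (letters being given by names such that different names of subgroups stand for different members of $\Lambda$) and for every algorithm computing these finite sets, takes the words $A_i$, the letters $g_i$ and the latter algorithm as input and outputs such a disjunction, the coefficients of which are written as words in letters and formal inverses of letters. -/

import Mathlib

open scoped ENNReal

namespace ExpEqs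

/-! ### Exponential equations -/

/-- A factor `coef * base ^ var` of the left-hand side of an exponential equation over `K` with
variables in `V`. -/
structure ExpTerm (K V : Type*) where
  coef : K
  base : K
  var : V

/-- The exponential equation `a₁ g₁^{x₁} ⋯ aₘ gₘ^{xₘ} = 1`, given by the list of its factors. -/
abbrev ExpEquation (K V : Type*) := List (ExpTerm K V)

/-- The integer assignment `k` solves the exponential equation `e` in the group `K`. -/
def ExpEquation.IsSolution {K V : Type*} [Group K] (e : ExpEquation K V) (k : V → ℤ) : Prop :=
  (e.map fun t => t.coef * t.base ^ k t.var).prod = 1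

/-- The equation `a₁ g₁^{x₁} ⋯ aₙ gₙ^{xₙ} = 1` in the variables `x₁, …, xₙ`. -/
def expEquation {K : Type*} {n : ℕ} (a g : Fin n → K) : ExpEquation K (Fin n) :=
  List.ofFn fun i => ⟨a i, g i, i⟩

section Group

variable {G : Type*} [Group G] {Λ : Type*} (H : Λ → Subgroup G) (X : Set G)

/-- Either an exponential equation over some `H lam` or a trivial equation `g = 1` with `g ∈ G`.
The variables are taken from `x₁, …, xₙ`. -/
inductive PeriphEq (n : ℕ)
  | exp (lam : Λ) (e : ExpEquation (H lam) (Fin n)) : PeriphEq n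
  | triv (g : G) : PeriphEq n

variable {H}

def PeriphEq.IsSolution {n : ℕ} (k : Fin n → ℤ) : PeriphEq H n → Prop
  | .exp _ e => e.IsSolution k
  | .triv g => g = 1

/-- The list of occurrences of variables in an equation. -/
def PeriphEq.vars {n : ℕ} : PeriphEq H n → List (Fin n)
  | .exp _ e => e.map ExpTerm.var
  | .triv _ => []

variable (H)

/-- A finite disjunction of finite systems of equations. -/
abbrev Disjunction (n : ℕ) := List (List (PeriphEq H n))

variable {H}

/-- `k` satisfies all equations of at least one of the systems. -/
def Disjunction.IsSolution {n : ℕ} (Φ : Disjunction H n) (k : Fin n → ℤ) : Prop :=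
  ∃ S ∈ Φ, ∀ E ∈ S, E.IsSolution k

/-- Within each equation the variables are distinct, and any two equations at different places of
the same system have disjoint sets of variables. -/
def Disjunction.DisjointVars {n : ℕ} (Φ : Disjunction H n) : Prop :=
  ∀ S ∈ Φ, (∀ E ∈ S, E.vars.Nodup) ∧ S.Pairwise fun E E' => E.vars.Disjoint E'.vars

/-! ### The Cayley graph `Γ(G, X ⊔ ℋ)`, where `ℋ` is the disjoint union of the subgroups -/

variable (H)

/-- The alphabet `X ⊔ ℋ`. -/
abbrev Letter := X ⊕ (Σ lam, H lam)

variable {H X}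

/-- The element of `G` that a letter represents. -/
def Letter.val : Letter H X → G
  | .inl x => x
  | .inr h => h.2

/-- The element of `G` that a word represents. A path in `Γ(G, X ⊔ ℋ)` is given by its initial
vertex `a` and its label `w`; its vertices are the elements `a * wordVal (w.take i)`,
`i ≤ w.length`. -/
def wordVal (w : List (Letter H X)) : G := (w.map Letter.val).prod

variable (H X)

/-- The distance between the vertices `a` and `b` of `Γ(G, X ⊔ ℋ)`, that is, the length of a
shortest path (it is only used for vertices that are joined by a path). -/
noncomputable def cayleyDist (a b : G) : ℕ :=
  sInf {m | ∃ w : List (Letter H X), a * wordVal w = b ∧ w.length = m}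

variable {H X}

/-- Paths with label `w` are geodesics. -/
def IsGeodesic (w : List (Letter H X)) : Prop := w.length = cayleyDist H X 1 (wordVal w)

/-- Paths with label `w` are `(κ, ε)`-quasi-geodesics. -/
def IsQuasiGeodesic (κ ε : ℝ) (w : List (Letter H X)) : Prop :=
  ∀ q, q <:+: w → (q.length : ℝ) / κ - ε ≤ cayleyDist H X 1 (wordVal q)

variable (H X)

/-- The Cayley graph `Γ(G, X ⊔ ℋ)` is hyperbolic: for some `δ`, in every geodesic triangle with
consecutive sides starting at `o` and labelled by `u`, `v`, `w`, each vertex on the first side is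
at distance at most `δ` from a vertex on one of the other two sides. (Since `o`, `u`, `v`, `w` are
arbitrary, this covers all three sides. To consider triangles with corners at vertices of the
graph, and only the vertices on their sides, changes no more than the value of `δ`.) -/
def IsHyperbolicCayley : Prop :=
  ∃ δ : ℕ, ∀ (o : G) (u v w : List (Letter H X)),
    IsGeodesic u → IsGeodesic v → IsGeodesic w → wordVal (u ++ v ++ w) = 1 →
    ∀ i ≤ u.length,
      (∃ j ≤ v.length,
        cayleyDist H X (o * wordVal (u.take i)) (o * wordVal u * wordVal (v.take j)) ≤ δ) ∨
      (∃ j ≤ w.length,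
        cayleyDist H X (o * wordVal (u.take i))
          (o * wordVal u * wordVal v * wordVal (w.take j)) ≤ δ)

variable {H X}

/-- The path with initial vertex `a` and label `w` is `H lam`-admissible: it has no edge in the
complete subgraph `Γ(H lam, H lam)`, i.e. no edge that starts in `H lam` and is labelled by a
letter from `H lam`. -/
def IsAdmissible (lam : Λ) (a : G) (w : List (Letter H X)) : Prop :=
  ∀ (u v : List (Letter H X)) (h : H lam), w = u ++ .inr ⟨lam, h⟩ :: v → a * wordVal u ∉ H lam

variable (H X)

/-- The relative metric on `H lam`: the length of a shortest `H lam`-admissible path from `a` to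
`b`, and `∞` if there is none. (It is used for `a, b ∈ H lam` only.) -/
noncomputable def relDist (lam : Λ) (a b : G) : ℝ≥0∞ :=
  ⨅ w ∈ {w : List (Letter H X) | IsAdmissible lam a w ∧ a * wordVal w = b}, (w.length : ℝ≥0∞)

/-- The ball of radius `r` in `H lam` around `a` with respect to the relative metric. -/
def relBall (lam : Λ) (a : H lam) (r : ℝ) : Set (H lam) :=
  {b | relDist H X lam a b ≤ ENNReal.ofReal r}

/-- The collection `H` is hyperbolically embedded in `G` with respect to the symmetric set `X`. -/
structure IsHyperbolicallyEmbedded : Prop where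
  symm : ∀ x ∈ X, x⁻¹ ∈ X
  generates : Subgroup.closure (X ∪ ⋃ lam, (H lam : Set G)) = ⊤
  hyperbolic : IsHyperbolicCayley H X
  proper : ∀ (lam : Λ) (a : H lam) (r : ℝ), (relBall H X lam a r).Finite

variable {H X}

/-! ### Isolated components and the constants `C(κ, ε)` -/

/-- All letters of the word `w` are from `H lam`. -/
def IsHWord (lam : Λ) (w : List (Letter H X)) : Prop :=
  ∀ l ∈ w, ∃ h : H lam, l = .inr ⟨lam, h⟩

/-- In the path with label `u ++ p ++ v`, the subpath with label `p` is an `H lam`-component: it is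
a nontrivial `H lam`-subpath that is not contained in a longer one. -/
def IsComponent (lam : Λ) (u p v : List (Letter H X)) : Prop :=
  p ≠ [] ∧ IsHWord lam p ∧
    ∀ u' x y v', u = u' ++ x → v = y ++ v' → IsHWord lam (x ++ p ++ y) → x = [] ∧ y = []

/-- In the closed path that consists of a path labelled by `p` followed by one labelled by `r`, the
part `p` is an isolated `H lam`-component: it is a nontrivial `H lam`-subpath that is
not contained in a longer one (the path being read cyclically), and it is not connected to any
other `H lam`-component `c`, i.e. no vertex of `p` is joined to a vertex of `c` by a path labelled
by letters from `H lam`. -/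
def IsIsolatedComponent (lam : Λ) (p r : List (Letter H X)) : Prop :=
  p ≠ [] ∧ IsHWord lam p ∧
    (∀ x y r', r = y ++ r' ++ x → IsHWord lam (x ++ p ++ y) → x = [] ∧ y = []) ∧
    ∀ u c v, r = u ++ c ++ v → IsComponent lam u c v →
      ∀ i ≤ p.length, ∀ j ≤ c.length, ∀ γ : List (Letter H X), IsHWord lam γ →
        wordVal (p.take i) * wordVal γ ≠ wordVal (p ++ u ++ c.take j)

variable (H X)

/-- `C > 0` bounds the sum of the relative lengths of the sides in `I` by `C * m`, for all `m`-gons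
in `Γ(G, X ⊔ ℋ)` with `m ≥ 2` and all sets `I` of their sides such that the sides
in `I` are isolated components and the other sides are `(κ, ε)`-quasi-geodesics. -/
def IsPolygonConstant (κ ε C : ℝ) : Prop :=
  0 < C ∧ ∀ (sides : List (List (Letter H X))) (I : Finset (Fin sides.length))
    (lam : Fin sides.length → Λ),
    2 ≤ sides.length → wordVal sides.flatten = 1 →
    (∀ i ∈ I, IsIsolatedComponent (lam i) (sides.get i)
      (sides.drop (i + 1) ++ sides.take i).flatten) →
    (∀ i ∉ I, IsQuasiGeodesic κ ε (sides.get i)) →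
    ∑ i ∈ I, relDist H X (lam i) 1 (wordVal (sides.get i)) ≤ ENNReal.ofReal (C * sides.length)

end Group

/-! ### Names for the symbolic data, as inputs and outputs of algorithms -/

/-- Names of letters: `inl i` is the `i`-th name of a letter from `X`, and `inr (l, j)` is the
`j`-th name of a letter from the subgroup with name `l`. -/
abbrev LetterName := ℕ ⊕ (ℕ × ℕ)

/-- Names of expressions `A₁ g₁^{x₁} ⋯ Aₙ gₙ^{xₙ}`: the list of the pairs (word `Aᵢ` in the
letters, letter `gᵢ` of some subgroup). -/
abbrev EquationName := List (List LetterName × (ℕ × ℕ))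

/-- The length `n + |A₁| + ⋯ + |Aₙ|` of the word `A₁ g₁^{x₁} ⋯ Aₙ gₙ^{xₙ}`, in which each
`gᵢ^{xᵢ}` counts as one letter. -/
def EquationName.len (E : EquationName) : ℕ := E.length + (E.map fun t => t.1.length).sum

/-- Names of output equations. An exponential equation is given by the name `l` of a subgroup and
the list of its factors; a factor consists of a coefficient (a word in names of elements of the
subgroup, each with exponent `1` (`true`) or `-1` (`false`)), the name of the base, and the index
of the variable. A trivial equation is given by a word in names of letters with
exponents `±1`. -/
abbrev PeriphEqName := (ℕ × List (List (ℕ × Bool) × (ℕ × ℕ))) ⊕ List (LetterName × Bool)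

/-- Names of finite disjunctions of finite systems. -/
abbrev DisjunctionName := List (List PeriphEqName)

/-- A (partial) assignment of letters of the alphabet `X ⊔ ℋ` to names. Different names stand for
different members of the index set `Λ`; nothing else is assumed. -/
structure Naming {G : Type*} [Group G] {Λ : Type*} (H : Λ → Subgroup G) (X : Set G) where
  gen : ℕ → Option X
  idx : ℕ → Option Λ
  elt : (lam : Λ) → ℕ → Option (H lam)
  idx_inj : ∀ (l l' : ℕ) (lam : Λ), idx l = some lam → idx l' = some lam → l = l'

namespace Naming

variable {G : Type*} [Group G] {Λ : Type*} {H : Λ → Subgroup G} {X : Set G} (N : Naming H X)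

/-- The pair `(l, j)` is a name of the element `h` of `H lam`. -/
def NamesElt (p : ℕ × ℕ) (h : Σ lam, H lam) : Prop :=
  N.idx p.1 = some h.1 ∧ N.elt h.1 p.2 = some h.2

/-- A name of a letter stands for the given letter. -/
def NamesLetter : LetterName → Letter H X → Prop
  | .inl i, .inl x => N.gen i = some x
  | .inr p, .inr h => N.NamesElt p h
  | _, _ => False

/-- `E` names the equation whose coefficients are represented by the words `A i` and whose
bases are the letters `g i`. -/
def NamesEquation (E : EquationName) (A : Fin E.length → List (Letter H X))
    (g : Fin E.length → Σ lam, H lam) : Prop :=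
  ∀ i, List.Forall₂ N.NamesLetter (E.get i).1 (A i) ∧ N.NamesElt (E.get i).2 (g i)

/-- The word `w` with exponents `±1` in names, which stand for elements of the group `K` by means
of `R`, represents the element `k` of `K`. -/
def NamesProduct {ν K : Type*} [Group K] (R : ν → K → Prop) (w : List (ν × Bool)) (k : K) : Prop :=
  ∃ v : List K, List.Forall₂ (fun p b => ∃ c, R p.1 c ∧ b = if p.2 then c else c⁻¹) w v ∧
    v.prod = k

def NamesPeriphEq {n : ℕ} : PeriphEqName → PeriphEq H n → Prop
  | .inl (l, ts), .exp lam e =>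
    N.idx l = some lam ∧ List.Forall₂ (fun t s =>
      NamesProduct (fun j c => N.elt lam j = some c) t.1 s.coef ∧
      N.elt lam t.2.1 = some s.base ∧ t.2.2 = (s.var : ℕ)) ts e
  | .inr w, .triv g =>
    NamesProduct (fun p c => ∃ x, N.NamesLetter p x ∧ x.val = c) w g
  | _, _ => False

def NamesDisjunction {n : ℕ} (D : DisjunctionName) (Φ : Disjunction H n) : Prop :=
  List.Forall₂ (List.Forall₂ N.NamesPeriphEq) D Φ

/-- On the input `(l, m)` the program `c` halts, and it outputs a finite list of names of all
elements of the finite set `S`, and of no other elements of `H lam`. -/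
def Computes (c : Nat.Partrec.Code) (l m : ℕ) {lam : Λ} (S : Set (H lam)) : Prop :=
  ∃ s : List ℕ, Encodable.encode s ∈ c.eval (Encodable.encode (l, m)) ∧
    (∀ j ∈ s, ∃ h ∈ S, N.elt lam j = some h) ∧ ∀ h ∈ S, ∃ j ∈ s, N.elt lam j = some h

end Naming

end ExpEqs

namespace ExpEqs

variable {G : Type*} [Group G] {Λ : Type*} {H : Λ → Subgroup G} {X : Set G}

/-! ### Words and the word metric -/

/-! The polygon constant comes from projecting the Cayley graph to a coset `Y` of some `H lam`. If a
`(1, 1)`-quasi-geodesic has no edge inside `Y`, then nearest points in `Y` of its two ends are at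
relative distance at most `K = 32δ + 18` (`Generates.relDistOn_nearest_le`). Thin quadrilaterals
either link the two projections directly or show that the path itself comes close to them, and every
connecting piece used has no edge in `Y`.

Regard a polygon as a cyclic list of sides, the isolated components being distinguished and carrying
their cosets. Isolation means that no other side has an edge in such a coset. If all distinguished
sides have relative length at most `19K`, a linear bound is immediate. Otherwise take a longer one,
in `Y`, and project the rest of the polygon to `Y`. The projection moves in steps of at most `K`, so
some vertex `z` projects to a point `y` far from both ends of the long side. Cut the polygon along a
geodesic from `z` to `y`. If `z` is chosen as close as possible to its projection, this geodesic
cannot pass through the coset of a distinguished side, so both pieces are polygons of the same kind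
(`Generates.exists_cut`). They have at least 10 sides each and `m + 4` together, and the bound
`38K(m - 5)` survives such a cut (`Generates.totalCost_le`).

For the equation, fix a solution. Each power `gᵢ ^ xᵢ` is a single letter, so the left-hand side
labels a closed path of length `L`, whatever the exponents are. Suppose that two letters over a
subgroup of the equation lie in one coset, and let `Q` be a shortest subword between two such
letters. Then `h = Q⁻¹` is isolated in the cycle `h Q`; it lies in the ball of radius `C(1,1) L`,
and the equation splits into `Q h = 1` and a shorter equation in which the two letters are merged
around `h⁻¹`. If there are no such letters, a letter with variables is isolated in the whole cycle,
so its value `h` lies in the ball; it is replaced by `h`, and `u h⁻¹ = 1` is split off. This is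
`exists_branch`.

Words never get longer than `L`, so the same finite balls serve throughout, and trying all their
elements gives a finite disjunction. Each system implies the equation formally (`Branch.sound`),
each solution follows some branch (`exists_finished`), and a quadratic potential bounds the number
of steps. Cuts only distribute the occurrences of variables, hence the disjointness. The procedure
is primitive recursive in the equation and a table of the balls. The algorithm finds the table by
running the given program; for the bare existence statement, properness provides one. -/

@[simp] lemma wordVal_nil : wordVal ([] : List (Letter H X)) = 1 := rfl

@[simp] lemma wordVal_cons (l : Letter H X) (w : List (Letter H X)) :
    wordVal (l :: w) = l.val * wordVal w := by simp [wordVal]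

@[simp] lemma wordVal_append (v w : List (Letter H X)) :
    wordVal (v ++ w) = wordVal v * wordVal w := by simp [wordVal]

@[simp] lemma val_inr (lam : Λ) (h : H lam) :
    Letter.val (.inr ⟨lam, h⟩ : Letter H X) = (h : G) := rfl

/-- The inverse of a letter. -/
def Letter.inv (hs : ∀ x ∈ X, x⁻¹ ∈ X) : Letter H X → Letter H X
  | .inl x => .inl ⟨x.1⁻¹, hs _ x.2⟩
  | .inr h => .inr ⟨h.1, h.2⁻¹⟩

/-- The label of the inverse path. -/
def invWord (hs : ∀ x ∈ X, x⁻¹ ∈ X) (w : List (Letter H X)) : List (Letter H X) :=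
  (w.map (Letter.inv hs)).reverse

lemma Letter.val_inv (hs : ∀ x ∈ X, x⁻¹ ∈ X) (l : Letter H X) : (l.inv hs).val = l.val⁻¹ := by
  rcases l with x | ⟨lam, h⟩ <;> simp [Letter.inv, Letter.val]

lemma wordVal_invWord (hs : ∀ x ∈ X, x⁻¹ ∈ X) (w : List (Letter H X)) :
    wordVal (invWord hs w) = (wordVal w)⁻¹ := by
  induction w with
  | nil => simp [invWord]
  | cons l w ih =>
    have : invWord hs (l :: w) = invWord hs w ++ [l.inv hs] := by simp [invWord]
    rw [this, wordVal_append, ih]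
    simp [Letter.val_inv]

lemma length_invWord (hs : ∀ x ∈ X, x⁻¹ ∈ X) (w : List (Letter H X)) :
    (invWord hs w).length = w.length := by simp [invWord]

lemma Letter.inv_inv (hs : ∀ x ∈ X, x⁻¹ ∈ X) (l : Letter H X) : (l.inv hs).inv hs = l := by
  rcases l with x | ⟨lam, h⟩ <;> simp [Letter.inv]

lemma invWord_invWord (hs : ∀ x ∈ X, x⁻¹ ∈ X) (w : List (Letter H X)) :
    invWord hs (invWord hs w) = w := by
  simp [invWord, Function.comp_def, Letter.inv_inv]

lemma exists_word_of_closure (hs : ∀ x ∈ X, x⁻¹ ∈ X)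
    (hg : Subgroup.closure (X ∪ ⋃ lam, (H lam : Set G)) = ⊤) (g : G) :
    ∃ w : List (Letter H X), wordVal w = g := by
  have hg' : g ∈ Subgroup.closure (X ∪ ⋃ lam, (H lam : Set G)) := hg ▸ Subgroup.mem_top g
  induction hg' using Subgroup.closure_induction with
  | mem x hx =>
    rcases hx with hx | hx
    · exact ⟨[.inl ⟨x, hx⟩], by simp [Letter.val]⟩
    · obtain ⟨lam, hx⟩ := Set.mem_iUnion.1 hx
      exact ⟨[.inr ⟨lam, ⟨x, hx⟩⟩], by simp⟩
  | one => exact ⟨[], rfl⟩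
  | mul x y _ _ hx hy =>
    obtain ⟨u, rfl⟩ := hx
    obtain ⟨v, rfl⟩ := hy
    exact ⟨u ++ v, by simp⟩
  | inv x _ hx =>
    obtain ⟨u, rfl⟩ := hx
    exact ⟨invWord hs u, wordVal_invWord hs u⟩

/-- The word metric with respect to a symmetric generating alphabet. -/
structure Generates (H : Λ → Subgroup G) (X : Set G) : Prop where
  symm : ∀ x ∈ X, x⁻¹ ∈ X
  exists_word : ∀ g : G, ∃ w : List (Letter H X), wordVal w = g

lemma IsHyperbolicallyEmbedded.toGenerates (h : IsHyperbolicallyEmbedded H X) : Generates H X :=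
  ⟨h.symm, exists_word_of_closure h.symm h.generates⟩

lemma cayleyDist_le {a b : G} {w : List (Letter H X)} (h : a * wordVal w = b) :
    cayleyDist H X a b ≤ w.length := Nat.sInf_le ⟨w, h, rfl⟩

lemma cayleyDist_self (a : G) : cayleyDist H X a a = 0 :=
  Nat.le_zero.1 (cayleyDist_le (w := []) (by simp))

lemma cayleyDist_mul_left (g a b : G) :
    cayleyDist H X (g * a) (g * b) = cayleyDist H X a b := by
  simp [cayleyDist, mul_assoc]

lemma cayleyDist_eq_one_left (a b : G) :
    cayleyDist H X a b = cayleyDist H X 1 (a⁻¹ * b) := by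
  rw [← cayleyDist_mul_left a⁻¹]; simp

namespace Generates

variable (hG : Generates H X)
include hG

lemma exists_geodesic (a b : G) :
    ∃ w : List (Letter H X), a * wordVal w = b ∧ w.length = cayleyDist H X a b := by
  have : {m | ∃ w : List (Letter H X), a * wordVal w = b ∧ w.length = m}.Nonempty := by
    obtain ⟨w, hw⟩ := hG.exists_word (a⁻¹ * b)
    exact ⟨_, w, by simp [hw], rfl⟩
  exact Nat.sInf_mem this

lemma dist_triangle (a b c : G) :
    cayleyDist H X a c ≤ cayleyDist H X a b + cayleyDist H X b c := by
  obtain ⟨u, hu, hu'⟩ := hG.exists_geodesic a b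
  obtain ⟨v, hv, hv'⟩ := hG.exists_geodesic b c
  rw [← hu', ← hv', ← List.length_append]
  exact cayleyDist_le (by rw [wordVal_append, ← mul_assoc, hu, hv])

lemma dist_comm_le (a b : G) : cayleyDist H X a b ≤ cayleyDist H X b a := by
  obtain ⟨u, hu, hu'⟩ := hG.exists_geodesic b a
  rw [← hu', ← length_invWord hG.symm]
  exact cayleyDist_le (by rw [wordVal_invWord, ← hu]; simp)

lemma dist_comm (a b : G) : cayleyDist H X a b = cayleyDist H X b a :=
  (hG.dist_comm_le a b).antisymm (hG.dist_comm_le b a)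

lemma eq_of_dist_eq_zero {a b : G} (h : cayleyDist H X a b = 0) : a = b := by
  obtain ⟨u, hu, hu'⟩ := hG.exists_geodesic a b
  rw [h, List.length_eq_zero_iff] at hu'
  simpa [hu'] using hu

end Generates

/-! ### Betweenness and thin triangles. -/

/-- `p` lies on a geodesic from `a` to `b`. -/
def Btw (H : Λ → Subgroup G) (X : Set G) (a p b : G) : Prop :=
  cayleyDist H X a p + cayleyDist H X p b = cayleyDist H X a b

lemma isGeodesic_iff {w : List (Letter H X)} (a : G) :
    IsGeodesic w ↔ cayleyDist H X a (a * wordVal w) = w.length := by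
  rw [cayleyDist_eq_one_left, inv_mul_cancel_left, IsGeodesic, eq_comm]

lemma Generates.btw_comm (hG : Generates H X) {a p b : G} (h : Btw H X a p b) :
    Btw H X b p a := by
  unfold Btw at *
  have := hG.dist_comm b p
  have := hG.dist_comm p a
  have := hG.dist_comm b a
  omega

lemma Generates.btw_of_geodesic (hG : Generates H X) {a : G} {u v : List (Letter H X)}
    (h : cayleyDist H X a (a * wordVal (u ++ v)) = (u ++ v).length) :
    Btw H X a (a * wordVal u) (a * wordVal (u ++ v)) := by
  have h1 : cayleyDist H X a (a * wordVal u) ≤ u.length := cayleyDist_le rfl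
  have h2 : cayleyDist H X (a * wordVal u) (a * wordVal (u ++ v)) ≤ v.length :=
    cayleyDist_le (by simp [mul_assoc])
  have h3 := hG.dist_triangle a (a * wordVal u) (a * wordVal (u ++ v))
  rw [List.length_append] at h
  unfold Btw
  omega

lemma Generates.exists_btw (hG : Generates H X) (a b : G) {n : ℕ}
    (hn : n ≤ cayleyDist H X a b) : ∃ p, Btw H X a p b ∧ cayleyDist H X a p = n := by
  obtain ⟨w, rfl, hw⟩ := hG.exists_geodesic a b
  have h1 : cayleyDist H X a (a * wordVal (w.take n)) ≤ (w.take n).length := cayleyDist_le rfl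
  have h2 : cayleyDist H X (a * wordVal (w.take n)) (a * wordVal w) ≤ (w.drop n).length := by
    refine cayleyDist_le ?_
    rw [mul_assoc, ← wordVal_append, List.take_append_drop]
  have h3 := hG.dist_triangle a (a * wordVal (w.take n)) (a * wordVal w)
  rw [List.length_take] at h1
  rw [List.length_drop] at h2
  exact ⟨a * wordVal (w.take n), by unfold Btw; omega, by omega⟩

/-- Geodesic triangles are `δ`-thin. -/
def Thin (H : Λ → Subgroup G) (X : Set G) (δ : ℕ) : Prop :=
  ∀ a b c p : G, Btw H X a p b →
    ∃ q, cayleyDist H X p q ≤ δ ∧ (Btw H X b q c ∨ Btw H X c q a)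

lemma Generates.exists_thin (hG : Generates H X) (h : IsHyperbolicCayley H X) :
    ∃ δ, Thin H X δ := by
  obtain ⟨δ, hδ⟩ := h
  refine ⟨δ, fun a b c p hp => ?_⟩
  obtain ⟨u₁, hu₁, hu₁'⟩ := hG.exists_geodesic a p
  obtain ⟨u₂, hu₂, hu₂'⟩ := hG.exists_geodesic p b
  obtain ⟨v, hv, hv'⟩ := hG.exists_geodesic b c
  obtain ⟨w, hw, hw'⟩ := hG.exists_geodesic c a
  have hu : a * wordVal (u₁ ++ u₂) = b := by rw [wordVal_append, ← mul_assoc, hu₁, hu₂]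
  have key := hδ a (u₁ ++ u₂) v w ((isGeodesic_iff a).2 ?_) ((isGeodesic_iff b).2 ?_)
    ((isGeodesic_iff c).2 ?_) ?_ u₁.length (by simp)
  · have e : a * wordVal ((u₁ ++ u₂).take u₁.length) = p := by simp [hu₁]
    rw [e, hu, hv] at key
    rcases key with ⟨j, _, hj⟩ | ⟨j, _, hj⟩
    · refine ⟨_, hj, Or.inl ?_⟩
      have := hG.btw_of_geodesic (a := b) (u := v.take j) (v := v.drop j)
        (by rw [List.take_append_drop, hv, hv'])
      rwa [List.take_append_drop, hv] at this
    · refine ⟨_, hj, Or.inr ?_⟩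
      have := hG.btw_of_geodesic (a := c) (u := w.take j) (v := w.drop j)
        (by rw [List.take_append_drop, hw, hw'])
      rwa [List.take_append_drop, hw] at this
  · rw [hu, List.length_append, hu₁', hu₂', hp]
  · rw [hv, hv']
  · rw [hw, hw']
  · have : a * wordVal (u₁ ++ u₂ ++ v ++ w) = a := by
      rw [wordVal_append, wordVal_append, ← mul_assoc, ← mul_assoc, hu, hv, hw]
    exact mul_eq_left.1 this

/-- The diagonal from `c` to `a` divides the quadrilateral into two thin triangles. -/
lemma Generates.thin_quadrilateral (hG : Generates H X) {δ : ℕ} (hδ : Thin H X δ)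
    {a b : G} (c e : G) {p : G} (hp : Btw H X a p b) :
    ∃ q, cayleyDist H X p q ≤ 2 * δ ∧ (Btw H X b q c ∨ Btw H X c q e ∨ Btw H X e q a) := by
  obtain ⟨q, hq, hb | hb⟩ := hδ a b c p hp
  · exact ⟨q, by omega, .inl hb⟩
  · obtain ⟨r, hr, h | h⟩ := hδ c a e q hb
    · have := hG.dist_triangle p q r
      exact ⟨r, by omega, .inr (.inr (hG.btw_comm h))⟩
    · have := hG.dist_triangle p q r
      exact ⟨r, by omega, .inr (.inl (hG.btw_comm h))⟩

/-! ### `(1, 1)`-quasi-geodesics -/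

lemma isQuasiGeodesic_one_one_iff {w : List (Letter H X)} :
    IsQuasiGeodesic 1 1 w ↔ ∀ q, q <:+: w → q.length ≤ cayleyDist H X 1 (wordVal q) + 1 := by
  refine forall_congr' fun q => imp_congr_right fun _ => ?_
  rw [div_one, sub_le_iff_le_add]
  norm_cast

lemma IsQuasiGeodesic.length_le {w u q v : List (Letter H X)} (hw : IsQuasiGeodesic 1 1 w)
    (h : w = u ++ q ++ v) (a : G) : q.length ≤ cayleyDist H X a (a * wordVal q) + 1 := by
  rw [cayleyDist_eq_one_left, inv_mul_cancel_left]
  exact isQuasiGeodesic_one_one_iff.1 hw q ⟨u, v, h.symm⟩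

/-- The additive constant 1 absorbs a letter that represents the identity. Thus any path becomes a
polygon with admissible sides once it is cut into single edges. -/
lemma isQuasiGeodesic_of_length_le_one {w : List (Letter H X)} (hw : w.length ≤ 1) :
    IsQuasiGeodesic 1 1 w :=
  isQuasiGeodesic_one_one_iff.2 fun q hq => by have := hq.length_le; omega

lemma Generates.isQuasiGeodesic_of_geodesic (hG : Generates H X) {a : G}
    {w : List (Letter H X)} (h : cayleyDist H X a (a * wordVal w) = w.length) :
    IsQuasiGeodesic 1 1 w := by
  refine isQuasiGeodesic_one_one_iff.2 ?_
  rintro q ⟨u, v, rfl⟩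
  have h1 : cayleyDist H X a (a * wordVal u) ≤ u.length := cayleyDist_le rfl
  have h2 : cayleyDist H X (a * wordVal u) (a * wordVal u * wordVal q)
    = cayleyDist H X 1 (wordVal q) := by rw [cayleyDist_eq_one_left, inv_mul_cancel_left]
  have h3 : cayleyDist H X (a * wordVal u * wordVal q) (a * wordVal (u ++ q ++ v)) ≤ v.length :=
    cayleyDist_le (by simp [mul_assoc])
  have h4 := hG.dist_triangle a (a * wordVal u) (a * wordVal (u ++ q ++ v))
  have h5 := hG.dist_triangle (a * wordVal u) (a * wordVal u * wordVal q)
    (a * wordVal (u ++ q ++ v))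
  simp only [List.length_append] at h
  omega

/-- Geodesics stay close to `(1, 1)`-quasi-geodesics with the same end points. -/
lemma Generates.exists_close_vertex (hG : Generates H X) {δ : ℕ} (hδ : Thin H X δ) {x p : G}
    {w : List (Letter H X)} (hw : IsQuasiGeodesic 1 1 w) (hp : Btw H X x p (x * wordVal w)) :
    ∃ u v, w = u ++ v ∧ cayleyDist H X p (x * wordVal u) ≤ 2 * δ + 1 := by
  set x' := x * wordVal w with hx'
  set t := cayleyDist H X x p with ht
  have hlen : cayleyDist H X x x' ≤ w.length := cayleyDist_le rfl
  have hlen' := hw.length_le (u := []) (q := w) (v := []) (by simp) x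
  rw [← hx'] at hlen'
  -- The candidate is the vertex of `w` after as many edges as `p` is away from `x`. Its distances
  -- to `x` and `x'` exceed those of `p` by at most 0 and 1, so a point `q` near `p` on a side of
  -- the triangle `x`, `x'`, `s` is within `δ + 1` of `s`.
  set s := x * wordVal (w.take t) with hs
  have h1 : cayleyDist H X x s ≤ (w.take t).length := cayleyDist_le rfl
  have h2 : cayleyDist H X s x' ≤ (w.drop t).length := by
    refine cayleyDist_le ?_
    rw [hs, hx', mul_assoc, ← wordVal_append, List.take_append_drop]
  rw [List.length_take] at h1
  rw [List.length_drop] at h2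
  unfold Btw at hp
  refine ⟨w.take t, w.drop t, (List.take_append_drop _ _).symm, ?_⟩
  rw [← hs]
  obtain ⟨q, hq, h | h⟩ := hδ x x' s p hp
  · unfold Btw at h
    have a1 := hG.dist_triangle p q x'
    have a2 := hG.dist_triangle p q s
    have c1 := hG.dist_comm x' q
    have c2 := hG.dist_comm s q
    have c3 := hG.dist_comm x' s
    omega
  · unfold Btw at h
    have a1 := hG.dist_triangle x q p
    have a2 := hG.dist_triangle p q s
    have c1 := hG.dist_comm x q
    have c2 := hG.dist_comm s q
    have c3 := hG.dist_comm x s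
    have c4 := hG.dist_comm p q
    omega

end ExpEqs

namespace ExpEqs

variable {G : Type*} [Group G] {Λ : Type*} {H : Λ → Subgroup G} {X : Set G}

/-! ### Cosets of the peripheral subgroups and their relative metrics -/

/-- Left cosets of the subgroups `H lam`. -/
abbrev PCoset (H : Λ → Subgroup G) := Σ lam, G ⧸ H lam

def PCoset.of (H : Λ → Subgroup G) (lam : Λ) (x : G) : PCoset H := ⟨lam, (x : G ⧸ H lam)⟩

def PCoset.Has (Y : PCoset H) (x : G) : Prop := (x : G ⧸ H Y.1) = Y.2

lemma PCoset.has_of (lam : Λ) (x y : G) : (PCoset.of H lam x).Has y ↔ x⁻¹ * y ∈ H lam := by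
  rw [PCoset.Has, PCoset.of, eq_comm]; exact QuotientGroup.eq

lemma PCoset.has_of_self (lam : Λ) (x : G) : (PCoset.of H lam x).Has x := rfl

lemma PCoset.exists_has (Y : PCoset H) : ∃ x, Y.Has x := QuotientGroup.mk_surjective Y.2

lemma PCoset.Has.inv_mul_mem {Y : PCoset H} {x y : G} (hx : Y.Has x) (hy : Y.Has y) :
    x⁻¹ * y ∈ H Y.1 := QuotientGroup.eq.1 (hx.trans hy.symm)

lemma PCoset.Has.mul {Y : PCoset H} {x h : G} (hx : Y.Has x) (hh : h ∈ H Y.1) : Y.Has (x * h) :=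
  (QuotientGroup.mk_mul_of_mem x hh).trans hx

lemma PCoset.Has.eq_of {Y : PCoset H} {x : G} (hx : Y.Has x) : Y = PCoset.of H Y.1 x := by
  obtain ⟨lam, Y⟩ := Y
  change (x : G ⧸ H lam) = Y at hx
  subst hx
  rfl

/-- The path with initial vertex `a` and label `w` has no edge that starts in the coset `Y` and is
labelled by a letter from the corresponding subgroup. -/
def Avoids (X : Set G) (Y : PCoset H) (a : G) (w : List (Letter H X)) : Prop :=
  ∀ (u v : List (Letter H X)) (h : H Y.1), w = u ++ .inr ⟨Y.1, h⟩ :: v → ¬ Y.Has (a * wordVal u)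

lemma avoids_nil (Y : PCoset H) (a : G) : Avoids X Y a [] := by
  intro u v h e; simp at e

lemma Avoids.append {Y : PCoset H} {a : G} {w₁ w₂ : List (Letter H X)} (h₁ : Avoids X Y a w₁)
    (h₂ : Avoids X Y (a * wordVal w₁) w₂) : Avoids X Y a (w₁ ++ w₂) := by
  intro u v h e
  rcases List.append_eq_append_iff.1 e with ⟨c, rfl, hc⟩ | ⟨c, rfl, hc⟩
  · rw [wordVal_append, ← mul_assoc]
    exact h₂ c v h hc
  · rcases c with _ | ⟨l, c⟩
    · simp only [List.nil_append] at hc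
      simpa using h₂ [] v h hc.symm
    · simp only [List.cons_append, List.cons.injEq] at hc
      obtain ⟨rfl, rfl⟩ := hc
      exact h₁ u c h rfl

lemma Avoids.left {Y : PCoset H} {a : G} {w₁ w₂ : List (Letter H X)}
    (h : Avoids X Y a (w₁ ++ w₂)) : Avoids X Y a w₁ := by
  rintro u v l rfl
  exact h u (v ++ w₂) l (by simp)

lemma Avoids.right {Y : PCoset H} {a : G} {w₁ w₂ : List (Letter H X)}
    (h : Avoids X Y a (w₁ ++ w₂)) : Avoids X Y (a * wordVal w₁) w₂ := by
  rintro u v l rfl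
  rw [mul_assoc, ← wordVal_append]
  exact h (w₁ ++ u) v l (by simp)

/-- An edge labelled by a letter of the subgroup starts in the coset exactly when it ends there, so
reversing a path creates no forbidden edge. -/
lemma Avoids.inv (hs : ∀ x ∈ X, x⁻¹ ∈ X) {Y : PCoset H} {a : G} {w : List (Letter H X)}
    (hw : Avoids X Y a w) : Avoids X Y (a * wordVal w) (invWord hs w) := by
  intro u v h e hY
  have e' : w = invWord hs v ++ .inr ⟨Y.1, h⁻¹⟩ :: invWord hs u := by
    rw [← invWord_invWord hs w, e]
    simp [invWord, Letter.inv]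
  refine hw _ _ _ e' ?_
  have : a * wordVal (invWord hs v) = a * wordVal w * wordVal u * h := by
    rw [e']; simp [wordVal_invWord, mul_assoc]
  rw [this]
  exact hY.mul h.2

/-- A path all of whose vertices but the last one are outside `Y` avoids `Y`. -/
lemma avoids_of_far {Y : PCoset H} {a : G} {w : List (Letter H X)}
    (h : ∀ y, Y.Has y → w.length ≤ cayleyDist H X a y) : Avoids X Y a w := by
  rintro u v l rfl hY
  have := (h _ hY).trans (cayleyDist_le rfl)
  simp at this

/-- The length of a shortest path from `a` to `b` that avoids `Y`. -/
noncomputable def relDistOn (X : Set G) (Y : PCoset H) (a b : G) : ℝ≥0∞ :=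
  ⨅ w ∈ {w : List (Letter H X) | Avoids X Y a w ∧ a * wordVal w = b}, (w.length : ℝ≥0∞)

lemma relDistOn_le {Y : PCoset H} {a b : G} {w : List (Letter H X)} (hw : Avoids X Y a w)
    (hb : a * wordVal w = b) : relDistOn X Y a b ≤ w.length :=
  biInf_le (fun w : List (Letter H X) => (w.length : ℝ≥0∞)) (i := w) ⟨hw, hb⟩

lemma relDistOn_self (Y : PCoset H) (a : G) : relDistOn X Y a a = 0 := by
  simpa using relDistOn_le (X := X) (avoids_nil Y a) (b := a) (by simp)

lemma relDistOn_triangle (Y : PCoset H) (a b c : G) :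
    relDistOn X Y a c ≤ relDistOn X Y a b + relDistOn X Y b c := by
  conv_rhs => rw [relDistOn, relDistOn]
  simp only [ENNReal.iInf_add, ENNReal.add_iInf]
  refine le_iInf₂ fun v hv => le_iInf₂ fun u hu => ?_
  obtain ⟨hv, rfl⟩ := hv
  obtain ⟨hu, rfl⟩ := hu
  refine (relDistOn_le (hu.append hv) (by simp [mul_assoc])).trans ?_
  simp

lemma relDistOn_comm_le (hs : ∀ x ∈ X, x⁻¹ ∈ X) (Y : PCoset H) (a b : G) :
    relDistOn X Y a b ≤ relDistOn X Y b a := by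
  refine le_iInf₂ fun w hw => ?_
  obtain ⟨hw, rfl⟩ := hw
  refine (relDistOn_le (hw.inv hs) (by simp [wordVal_invWord])).trans ?_
  rw [length_invWord]

lemma relDistOn_comm (hs : ∀ x ∈ X, x⁻¹ ∈ X) (Y : PCoset H) (a b : G) :
    relDistOn X Y a b = relDistOn X Y b a :=
  (relDistOn_comm_le hs Y a b).antisymm (relDistOn_comm_le hs Y b a)

/-- Left translation by `a` carries the subgroup to its coset through `a` and admissible paths to
avoiding paths. -/
lemma relDist_eq_relDistOn (lam : Λ) (a b : G) :
    relDist H X lam 1 (a⁻¹ * b) = relDistOn X (PCoset.of H lam a) a b := by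
  have : {w : List (Letter H X) | IsAdmissible lam 1 w ∧ 1 * wordVal w = a⁻¹ * b} =
      {w | Avoids X (PCoset.of H lam a) a w ∧ a * wordVal w = b} := by
    ext w
    refine and_congr (forall₄_congr fun u v h _ => not_congr ?_) ?_
    · rw [PCoset.has_of, one_mul, inv_mul_cancel_left]
    · rw [one_mul, eq_inv_mul_iff_mul_eq]
  rw [relDist, relDistOn, this]

/-! ### Nearest-point projections to cosets. -/

/-- `y` is a point of `Y` at minimal distance from `x`. -/
def Nearest (X : Set G) (Y : PCoset H) (x y : G) : Prop :=
  Y.Has y ∧ ∀ z, Y.Has z → cayleyDist H X x y ≤ cayleyDist H X x z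

lemma exists_nearest (X : Set G) (Y : PCoset H) (x : G) : ∃ y, Nearest X Y x y := by
  obtain ⟨y, hy, h⟩ := WellFounded.has_min (measure (cayleyDist H X x)).wf {y | Y.Has y}
    Y.exists_has
  exact ⟨y, hy, fun z hz => not_lt.1 (h z hz)⟩

lemma Generates.eq_of_nearest (hG : Generates H X) {Y : PCoset H} {x y : G} (hx : Y.Has x)
    (h : Nearest X Y x y) : y = x := by
  have := h.2 x hx
  rw [cayleyDist_self] at this
  exact (hG.eq_of_dist_eq_zero (Nat.le_zero.1 this)).symm

lemma nearest_self {Y : PCoset H} {x : G} (hx : Y.Has x) : Nearest X Y x x :=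
  ⟨hx, fun z _ => by simp [cayleyDist_self]⟩

lemma Generates.relDistOn_le_dist (hG : Generates H X) {Y : PCoset H} {a b : G}
    (h : ∀ y, Y.Has y → cayleyDist H X a b ≤ cayleyDist H X a y) :
    relDistOn X Y a b ≤ cayleyDist H X a b := by
  obtain ⟨w, hw, hw'⟩ := hG.exists_geodesic a b
  rw [← hw']
  exact relDistOn_le (avoids_of_far fun y hy => hw' ▸ h y hy) hw

lemma dist_le_one_of_has {Y : PCoset H} {x y : G} (hx : Y.Has x) (hy : Y.Has y) :
    cayleyDist H X x y ≤ 1 :=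
  cayleyDist_le (w := [.inr ⟨Y.1, ⟨x⁻¹ * y, hx.inv_mul_mem hy⟩⟩]) (by simp)

/-- A point on a geodesic from `x` to its nearest point `y`. -/
lemma Generates.nearest_of_btw (hG : Generates H X) {Y : PCoset H} {x y p : G}
    (h : Nearest X Y x y) (hp : Btw H X x p y) : Nearest X Y p y := by
  refine ⟨h.1, fun z hz => ?_⟩
  have := h.2 z hz
  have := hG.dist_triangle x p z
  unfold Btw at hp
  omega

/-- Either the nearest points of the end points of a geodesic that stays close to `V` are
close, or the first one is close to `V`. -/
lemma Generates.foot (hG : Generates H X) {δ : ℕ} (hδ : Thin H X δ) {Y : PCoset H}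
    {x x' y y' : G} (hy : Nearest X Y x y) (hy' : Nearest X Y x' y') {V : Set G} (hx : x ∈ V)
    (hV : ∀ p, Btw H X x p x' → ∃ s ∈ V, cayleyDist H X p s ≤ 2 * δ + 1) :
    relDistOn X Y y y' ≤ (16 * δ + 8 : ℕ) ∨
      ∃ s ∈ V, relDistOn X Y y s ≤ (8 * δ + 4 : ℕ) ∧ cayleyDist H X y s ≤ 8 * δ + 4 := by
  rcases Nat.lt_or_ge (cayleyDist H X x y) (4 * δ + 2) with hlt | hge
  · refine .inr ⟨x, hx, ?_, ?_⟩
    · rw [relDistOn_comm hG.symm]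
      refine (hG.relDistOn_le_dist hy.2).trans ?_
      exact_mod_cast (by omega)
    · rw [hG.dist_comm]; omega
  · rw [hG.dist_comm] at hge
    -- The point `u` on the way from `y` to `x` has distance exactly `4δ + 2` from `Y`. Geodesics of
    -- at most this length that start at `u` avoid `Y`, which covers the `2δ` of the quadrilateral
    -- plus the `2δ + 1` that lead to `V`.
    obtain ⟨u, hu, hut⟩ := hG.exists_btw y x hge
    have hu' := hG.nearest_of_btw hy (hG.btw_comm hu)
    have huy : cayleyDist H X u y = 4 * δ + 2 := by rw [hG.dist_comm, hut]
    have hyu : relDistOn X Y y u ≤ (4 * δ + 2 : ℕ) := by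
      rw [relDistOn_comm hG.symm, ← huy]
      exact hG.relDistOn_le_dist hu'.2
    have hfar : ∀ q, cayleyDist H X u q ≤ 4 * δ + 2 →
        relDistOn X Y u q ≤ (cayleyDist H X u q : ℕ) := fun q hq =>
      hG.relDistOn_le_dist fun z hz => by have := hu'.2 z hz; omega
    obtain ⟨q, hq, h | h | h⟩ := hG.thin_quadrilateral hδ x' y' hu
    · obtain ⟨s, hs, hqs⟩ := hV q h
      have h1 := hG.dist_triangle u q s
      refine .inr ⟨s, hs, ?_, ?_⟩
      · refine (relDistOn_triangle Y y u s).trans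
          ((add_le_add hyu (hfar s (by omega))).trans ?_)
        exact_mod_cast (by omega)
      · have := hG.dist_triangle y u s
        omega
    · have hq' := hG.nearest_of_btw hy' h
      have h1 : relDistOn X Y q y' ≤ (6 * δ + 2 : ℕ) := by
        refine (hG.relDistOn_le_dist hq'.2).trans ?_
        have h2 := hq'.2 y hy.1
        have h3 := hG.dist_triangle q u y
        have h4 := hG.dist_comm q u
        exact_mod_cast (by omega)
      refine .inl ((relDistOn_triangle Y y u y').trans ((add_le_add hyu
        ((relDistOn_triangle Y u q y').trans (add_le_add (hfar q (by omega)) h1))).trans ?_))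
      exact_mod_cast (by omega)
    -- Here `q` is between `y'` and `y`, which are at distance at most 1, so `u` would be within `2δ
    -- + 1` of `y`.
    · exfalso
      have h1 := dist_le_one_of_has (X := X) hy'.1 hy.1
      unfold Btw at h
      have := hG.dist_triangle u q y
      omega

/-- If `x` and `x'` are joined by a `(1, 1)`-quasi-geodesic that avoids `Y`, then their nearest
points in `Y` are close with respect to the relative metric. -/
theorem Generates.relDistOn_nearest_le (hG : Generates H X) {δ : ℕ} (hδ : Thin H X δ)
    {Y : PCoset H} {x y y' : G} {w : List (Letter H X)} (hw : IsQuasiGeodesic 1 1 w)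
    (ha : Avoids X Y x w) (hy : Nearest X Y x y) (hy' : Nearest X Y (x * wordVal w) y') :
    relDistOn X Y y y' ≤ (32 * δ + 18 : ℕ) := by
  set V : Set G := {s | ∃ u v, w = u ++ v ∧ s = x * wordVal u} with hVdef
  have hV : ∀ p, Btw H X x p (x * wordVal w) → ∃ s ∈ V, cayleyDist H X p s ≤ 2 * δ + 1 := by
    intro p hp
    obtain ⟨u, v, h, h'⟩ := hG.exists_close_vertex hδ hw hp
    exact ⟨_, ⟨u, v, h, rfl⟩, h'⟩
  have hsub : ∀ u q v, w = u ++ q ++ v →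
      relDistOn X Y (x * wordVal u) (x * wordVal (u ++ q)) ≤
        (cayleyDist H X (x * wordVal u) (x * wordVal (u ++ q)) + 1 : ℕ) := by
    intro u q v h
    have e : x * wordVal (u ++ q) = x * wordVal u * wordVal q := by simp [mul_assoc]
    refine (relDistOn_le (w := q) (h ▸ ha).left.right e.symm).trans ?_
    have := hw.length_le h (x * wordVal u)
    rw [e]
    exact_mod_cast this
  have hVV : ∀ s ∈ V, ∀ s' ∈ V, relDistOn X Y s s' ≤ (cayleyDist H X s s' + 1 : ℕ) := by
    rintro s ⟨u, v, h, rfl⟩ s' ⟨u', v', h', rfl⟩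
    rcases List.append_eq_append_iff.1 (h.symm.trans h') with ⟨c, rfl, rfl⟩ | ⟨c, rfl, rfl⟩
    · exact hsub u c v' h'
    · rw [relDistOn_comm hG.symm, hG.dist_comm]
      exact hsub u' c v h
  rcases hG.foot hδ hy hy' (V := V) ⟨[], w, by simp, by simp⟩ hV with h | ⟨s, hs, h1, h2⟩
  · exact h.trans (by exact_mod_cast (by omega))
  rcases hG.foot hδ hy' hy (V := V) ⟨w, [], by simp, by simp⟩
    (fun p hp => hV p (hG.btw_comm hp)) with h | ⟨s', hs', h1', h2'⟩
  · rw [relDistOn_comm hG.symm]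
    exact h.trans (by exact_mod_cast (by omega))
  -- The points `s` and `s'` of the path are at distance at most `2(8δ + 4) + 1`. The part of the
  -- path between them is at most one edge longer and avoids `Y`; with the two links of length `8δ +
  -- 4` this gives `32δ + 18`.
  have h3 := dist_le_one_of_has (X := X) hy.1 hy'.1
  have h4 := hG.dist_triangle s y s'
  have h5 := hG.dist_triangle y y' s'
  rw [hG.dist_comm s y] at h4
  rw [relDistOn_comm hG.symm] at h1'
  refine (relDistOn_triangle Y y s y').trans ((add_le_add h1
    ((relDistOn_triangle Y s s' y').trans (add_le_add (hVV s hs s' hs') h1'))).trans ?_)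
  exact_mod_cast (by omega)

end ExpEqs

namespace ExpEqs

variable {G : Type*} [Group G] {Λ : Type*} {H : Λ → Subgroup G} {X : Set G}

/-! ### Polygons with distinguished sides -/

/-- A side of a polygon. It is distinguished if its end points lie in the coset `kind`. -/
structure Side (H : Λ → Subgroup G) where
  start : G
  finish : G
  kind : Option (PCoset H)

/-- Nearest points of `x` and `x'` in `Y` are at relative distance at most `K`. -/
def Tame (X : Set G) (K : ℕ) (Y : PCoset H) (x x' : G) : Prop :=
  ∀ y y', Nearest X Y x y → Nearest X Y x' y' → relDistOn X Y y y' ≤ K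

lemma Tame.symm (hs : ∀ x ∈ X, x⁻¹ ∈ X) {K : ℕ} {Y : PCoset H} {x x' : G}
    (h : Tame X K Y x x') : Tame X K Y x' x := fun y y' hy hy' => by
  rw [relDistOn_comm hs]; exact h y' y hy' hy

/-- End points of `(1, 1)`-quasi-geodesics avoiding `Y` are `K`-tame with respect to `Y`. -/
def TameConst (H : Λ → Subgroup G) (X : Set G) (K : ℕ) : Prop :=
  ∀ (Y : PCoset H) (x : G) (w : List (Letter H X)), IsQuasiGeodesic 1 1 w → Avoids X Y x w →
    Tame X K Y x (x * wordVal w)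

namespace Side

/-- The side `s` does not penetrate `Y`. -/
def Free (X : Set G) (K : ℕ) (Y : PCoset H) (s : Side H) : Prop :=
  (s.kind = none → Tame X K Y s.start s.finish) ∧ ∀ Z, s.kind = some Z → Z ≠ Y

/-- Nothing is required of two sides that are not distinguished. -/
def Compat (X : Set G) (K : ℕ) (s t : Side H) : Prop :=
  (∀ Y, s.kind = some Y → t.Free X K Y) ∧ ∀ Y, t.kind = some Y → s.Free X K Y

lemma Compat.symm {K : ℕ} {s t : Side H} (h : Compat X K s t) : Compat X K t s := ⟨h.2, h.1⟩

def Valid (s : Side H) : Prop := ∀ Y, s.kind = some Y → Y.Has s.start ∧ Y.Has s.finish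

/-- The relative length of a distinguished side. -/
noncomputable def cost (X : Set G) (s : Side H) : ℝ≥0∞ :=
  s.kind.elim 0 fun Y => relDistOn X Y s.start s.finish

/-- The points at which a side may be cut. -/
def Allowed (s : Side H) (z : G) : Prop :=
  (s.kind = none → z = s.start) ∧ ∀ Z, s.kind = some Z → Z.Has z

lemma Valid.allowed_start {s : Side H} (h : s.Valid) : s.Allowed s.start :=
  ⟨fun _ => rfl, fun Z hZ => (h Z hZ).1⟩

end Side

open Side

lemma TameConst.self {K : ℕ} (hK : TameConst H X K) (Y : PCoset H) (x : G) : Tame X K Y x x := by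
  simpa using hK Y x [] (isQuasiGeodesic_of_length_le_one (by simp)) (avoids_nil Y x)

/-- Two points of `Z` are joined by one edge, and an edge lies in only one coset of its subgroup.
Hence distinguished sides in other cosets are as harmless as avoiding quasi-geodesics. -/
lemma TameConst.of_coset {K : ℕ} (hK : TameConst H X K) {Y Z : PCoset H} (hZ : Z ≠ Y) {x x' : G}
    (hx : Z.Has x) (hx' : Z.Has x') : Tame X K Y x x' := by
  have := hK Y x [.inr ⟨Z.1, ⟨x⁻¹ * x', hx.inv_mul_mem hx'⟩⟩]
    (isQuasiGeodesic_of_length_le_one (by simp)) ?_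
  · simpa using this
  · intro u v h e hY
    rcases u with _ | ⟨l, u⟩
    · simp only [List.nil_append, List.cons.injEq] at e
      have h1 : Z.1 = Y.1 := (Sigma.mk.inj (Sum.inr.inj e.1)).1
      rw [wordVal_nil, mul_one] at hY
      apply hZ
      rw [hx.eq_of, hY.eq_of, h1]
    · simp at e

lemma Side.Free.tame {K : ℕ} (hK : TameConst H X K) {Y : PCoset H} {s : Side H}
    (h : s.Free X K Y) (hs : s.Valid) : Tame X K Y s.start s.finish := by
  cases hk : s.kind with
  | none => exact h.1 hk
  | some Z => exact hK.of_coset (h.2 Z hk) (hs Z hk).1 (hs Z hk).2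

/-- The list of sides is a path from `a` to `b`. -/
def IsPath (a : G) : List (Side H) → G → Prop
  | [], b => a = b
  | s :: L, b => s.start = a ∧ IsPath s.finish L b

lemma isPath_append {L₁ L₂ : List (Side H)} {a b : G} :
    IsPath a (L₁ ++ L₂) b ↔ ∃ c, IsPath a L₁ c ∧ IsPath c L₂ b := by
  induction L₁ generalizing a with
  | nil => simp [IsPath]
  | cons s L ih => simp [IsPath, ih, and_assoc]

noncomputable def totalCost (X : Set G) (L : List (Side H)) : ℝ≥0∞ := (L.map (cost X)).sum

/-- Projections of consecutive vertices differ by at most `K`. The additional `K` pays for the last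
vertex, whose nearest point need not be unique. -/
lemma relDistOn_le_of_isPath {K : ℕ} {Y : PCoset H} {L : List (Side H)} {a b : G}
    (hK : TameConst H X K) (hL : IsPath a L b) (ht : ∀ s ∈ L, Tame X K Y s.start s.finish)
    {y y' : G} (hy : Nearest X Y a y) (hy' : Nearest X Y b y') :
    relDistOn X Y y y' ≤ (K * (L.length + 1) : ℕ) := by
  induction L generalizing a y with
  | nil =>
    obtain rfl : a = b := hL
    simpa using hK.self Y a y y' hy hy'
  | cons s L ih =>
    obtain ⟨rfl, hL⟩ := hL
    obtain ⟨z, hz⟩ := exists_nearest X Y s.finish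
    refine (relDistOn_triangle Y y z y').trans ((add_le_add (ht s (by simp) y z hy hz)
      (ih hL (fun t h => ht t (by simp [h])) hz)).trans ?_)
    rw [List.length_cons]
    exact_mod_cast (by ring_nf; omega)

/-- On the way from `b` to a far point `a` of `Y`, the nearest point in `Y` passes through an
intermediate zone. -/
lemma Generates.exists_intermediate (hG : Generates H X) {K : ℕ} {Y : PCoset H}
    {L : List (Side H)} {p a b : G} (ha : Y.Has a) (hL : IsPath p L a)
    (ht : ∀ s ∈ L, Tame X K Y s.start s.finish) {y : G} (hy : Nearest X Y p y) {A : ℕ}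
    (hA : relDistOn X Y b y < A) (hfar : (A + K : ℕ) < relDistOn X Y b a) :
    ∃ s ∈ L, ∃ z, Nearest X Y s.start z ∧ (A : ℝ≥0∞) ≤ relDistOn X Y b z ∧
      relDistOn X Y b z ≤ (A + K : ℕ) := by
  induction L generalizing p y with
  | nil =>
    obtain rfl : p = a := hL
    rw [hG.eq_of_nearest ha hy] at hA
    exact absurd (hA.trans_le (by push_cast; exact le_self_add)) hfar.not_gt
  | cons s L ih =>
    obtain ⟨rfl, hL⟩ := hL
    obtain ⟨z, hz⟩ := exists_nearest X Y s.finish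
    -- Steps of length at most `K` cannot jump over the zone from `A` to `A + K`, so the first
    -- projection that is not below `A` is in it.
    by_cases hlt : relDistOn X Y b z < A
    · obtain ⟨t, htL, h⟩ := ih hL (fun t h => ht t (by simp [h])) hz hlt
      exact ⟨t, by simp [htL], h⟩
    · have hle : relDistOn X Y b z ≤ (A + K : ℕ) := by
        refine (relDistOn_triangle Y b y z).trans ?_
        push_cast
        exact add_le_add hA.le (ht s (by simp) y z hy hz)
      rcases L with _ | ⟨t, L⟩
      · have : s.finish = a := hL
        rw [this] at hz
        rw [hG.eq_of_nearest ha hz] at hle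
        exact absurd hle hfar.not_ge
      · refine ⟨t, by simp, z, ?_, not_lt.1 hlt, hle⟩
        rw [hL.1]
        exact hz

/-- A closed polygon in which no side penetrates the coset of another distinguished side. -/
structure IsPolygon (X : Set G) (K : ℕ) (L : List (Side H)) : Prop where
  closed : ∃ a, IsPath a L a
  valid : ∀ s ∈ L, s.Valid
  compat : L.Pairwise (Compat X K)

lemma IsPolygon.rotate {K : ℕ} {L₁ L₂ : List (Side H)} (h : IsPolygon X K (L₁ ++ L₂)) :
    IsPolygon X K (L₂ ++ L₁) := by
  obtain ⟨a, ha⟩ := h.closed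
  obtain ⟨c, h1, h2⟩ := isPath_append.1 ha
  exact ⟨⟨c, isPath_append.2 ⟨a, h2, h1⟩⟩,
    fun s hs => h.valid s (by simpa [or_comm] using hs), (List.pairwise_append_comm Compat.symm).1 h.compat⟩

/-- A geodesic from `z` to its nearest point `y` in `Y` is tame with respect to `W`, unless some
point of `W` has the same nearest point and is closer to it. -/
lemma Generates.tame_or_closer (hG : Generates H X) {K : ℕ} (hK : TameConst H X K)
    {Y W : PCoset H} {z y : G} (hy : Nearest X Y z y) :
    Tame X K W z y ∨ ∃ z', W.Has z' ∧ Nearest X Y z' y ∧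
      cayleyDist H X z' y < cayleyDist H X z y := by
  obtain ⟨w, hw, hw'⟩ := hG.exists_geodesic z y
  by_cases ha : Avoids X W z w
  · refine .inl ?_
    rw [← hw]
    exact hK W z w (hG.isQuasiGeodesic_of_geodesic (a := z) (by rw [hw, hw'])) ha
  · right
    unfold Avoids at ha
    push Not at ha
    -- The end point of the edge inside `W` is in `W` and is later on the geodesic to `y`; it has
    -- the same nearest point and is strictly closer to it.
    obtain ⟨u, v, h, rfl, hW⟩ := ha
    have h1 : cayleyDist H X (z * wordVal u * h) y ≤ v.length := by
      refine cayleyDist_le (w := v) ?_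
      rw [← hw]; simp [mul_assoc]
    have h2 : cayleyDist H X z (z * wordVal u * h) ≤ u.length + 1 := by
      refine (cayleyDist_le (w := u ++ [.inr ⟨W.1, h⟩]) ?_).trans (by simp)
      simp [mul_assoc]
    simp only [List.length_append, List.length_cons] at hw'
    refine ⟨z * wordVal u * h, hW.mul h.2, ⟨hy.1, fun y' hy' => ?_⟩, by omega⟩
    have := hy.2 y' hy'
    have := hG.dist_triangle z (z * wordVal u * h) y'
    omega

/-- The parts of a distinguished side keep its coset. Another side may be cut only at its start, so
that one part is a point and the other is the whole side. -/
lemma Side.Compat.of_part {K : ℕ} (hK : TameConst H X K) {s t : Side H} (h : Compat X K t s)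
    {z : G} (hz : s.Allowed z) :
    Compat X K t ⟨s.start, z, s.kind⟩ ∧ Compat X K t ⟨z, s.finish, s.kind⟩ := by
  refine ⟨⟨fun Y hY => ⟨fun hs => ?_, (h.1 Y hY).2⟩, h.2⟩,
    ⟨fun Y hY => ⟨fun hs => ?_, (h.1 Y hY).2⟩, h.2⟩⟩
  · obtain rfl := hz.1 hs
    exact hK.self Y _
  · obtain rfl := hz.1 hs
    exact (h.1 Y hY).1 hs

/-- A polygon with a long distinguished side can be cut into two smaller ones. -/
lemma Generates.exists_cut (hG : Generates H X) {K : ℕ} (hK : TameConst H X K)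
    {e : Side H} {L : List (Side H)} (hL : IsPolygon X K (e :: L))
    (hfar : ((19 * K : ℕ) : ℝ≥0∞) < e.cost X) :
    ∃ P₁ P₂ : List (Side H), IsPolygon X K P₁ ∧ IsPolygon X K P₂ ∧ 10 ≤ P₁.length ∧
      10 ≤ P₂.length ∧ P₁.length + P₂.length = (e :: L).length + 4 ∧
      totalCost X (e :: L) ≤ totalCost X P₁ + totalCost X P₂ := by
  obtain ⟨⟨c, hc⟩, hval, hcomp⟩ := hL
  obtain ⟨rfl, hpath⟩ := hc
  obtain ⟨Y, hY⟩ : ∃ Y, e.kind = some Y := by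
    cases h : e.kind with
    | none => simp [cost, h] at hfar
    | some Y => exact ⟨Y, rfl⟩
  obtain ⟨ha, hb⟩ := hval e (by simp) Y hY
  rw [List.pairwise_cons] at hcomp
  obtain ⟨hce, hcL⟩ := hcomp
  have hvL : ∀ s ∈ L, s.Valid := fun s hs => hval s (by simp [hs])
  have htame : ∀ s ∈ L, Tame X K Y s.start s.finish := fun s hs =>
    ((hce s hs).1 Y hY).tame hK (hvL s hs)
  simp only [cost, hY, Option.elim_some] at hfar
  rw [relDistOn_comm hG.symm] at hfar
  -- Positivity is needed below to cancel `K` when sides are counted.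
  have hKpos : 0 < K := by
    rcases Nat.eq_zero_or_pos K with rfl | h
    · have := relDistOn_le_of_isPath hK hpath htame (nearest_self hb) (nearest_self ha)
      simp only [mul_zero, zero_mul, Nat.cast_zero, nonpos_iff_eq_zero] at this hfar
      simp [this] at hfar
    · exact h
  -- a candidate for the cut
  let P : Side H × G × G → Prop := fun q => q.1 ∈ L ∧ q.1.Allowed q.2.1 ∧
    Nearest X Y q.2.1 q.2.2 ∧ ((9 * K : ℕ) : ℝ≥0∞) ≤ relDistOn X Y q.2.2 e.finish ∧
      ((9 * K : ℕ) : ℝ≥0∞) ≤ relDistOn X Y e.start q.2.2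
  -- Some vertex projects to a point at relative distance between `9K` and `10K` from the end of
  -- `e`. Since `e` is longer than `19K`, that point is also at least `9K` away from the start of
  -- `e`.
  have hP : {q | P q}.Nonempty := by
    obtain ⟨s, hs, y, h1, h2, h3⟩ := hG.exists_intermediate (A := 9 * K) (b := e.finish) ha hpath
      htame (nearest_self hb) (by rw [relDistOn_self]; exact_mod_cast (by omega))
      (lt_of_le_of_lt (by exact_mod_cast (by omega)) hfar)
    refine ⟨⟨s, s.start, y⟩, hs, (hvL s hs).allowed_start, h1, ?_, ?_⟩
    · rw [relDistOn_comm hG.symm]; exact h2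
    · rw [relDistOn_comm hG.symm]
      by_contra hlt
      rw [not_le] at hlt
      refine hfar.not_ge ((relDistOn_triangle Y e.finish y e.start).trans
        ((add_le_add h3 hlt.le).trans ?_))
      exact_mod_cast (by omega)
  obtain ⟨⟨s, z, y⟩, ⟨hsL, hsz, hzy, hyb, hay⟩, hmin⟩ :=
    WellFounded.has_min (measure fun q : Side H × G × G => cayleyDist H X q.2.1 q.2.2).wf
      {q | P q} hP
  simp only at hsL hsz hzy hyb hay
  -- If the geodesic from `z` to `y` met a distinguished coset `W`, a point of `W` would be a
  -- candidate with the same projection `y`, closer to it than `z`.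
  have hgeo : ∀ t ∈ L, ∀ W, t.kind = some W → Tame X K W z y := by
    intro t ht W hW
    rcases hG.tame_or_closer hK (W := W) hzy with h | ⟨z', h1, h2, h3⟩
    · exact h
    · refine absurd h3 (hmin ⟨t, z', y⟩ ⟨ht, ⟨fun h => ?_, fun Z hZ => ?_⟩, h2, hyb, hay⟩)
      · rw [hW] at h; cases h
      · rw [hW] at hZ; cases hZ; exact h1
  -- For `Y` itself, `y` is its own only nearest point and is also a nearest point of `z`, so the
  -- claim only compares two nearest points of `z`.
  have hgeoY : Tame X K Y z y := by
    intro y₁ y₂ h₁ h₂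
    rw [hG.eq_of_nearest hzy.1 h₂]
    simpa using hK.self Y z y₁ y h₁ hzy
  obtain ⟨L₁, L₂, rfl⟩ := List.append_of_mem hsL
  obtain ⟨c, hp₁, hcs, hp₂⟩ := isPath_append.1 hpath
  subst hcs
  rw [List.pairwise_append, List.pairwise_cons] at hcL
  obtain ⟨hc₁, ⟨hcs₂, hc₂⟩, hc₁₂⟩ := hcL
  have hs1 := fun t (h : Compat X K t s) => (h.of_part hK hsz).1
  have hs2 := fun t (h : Compat X K t s) => (h.of_part hK hsz).2
  have hbase : ∀ p q : G, ∀ t, Compat X K e t → Compat X K ⟨p, q, some Y⟩ t := by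
    intro p q t h
    refine ⟨fun W hW => h.1 W (hY.trans hW), fun W hW => ⟨fun h' => by simp at h',
      fun Z hZ => (h.2 W hW).2 Z (hY.trans hZ)⟩⟩
  have hsv : ∀ p q : G, s.Allowed p → s.Allowed q → ∀ Z, s.kind = some Z → Z.Has p ∧ Z.Has q :=
    fun p q hp hq Z hZ => ⟨hp.2 Z hZ, hq.2 Z hZ⟩
  have hcut : ∀ t : Side H, (∀ W, t.kind = some W → Tame X K W z y) →
      Compat X K t ⟨z, y, none⟩ ∧ Compat X K t ⟨y, z, none⟩ := by
    intro t ht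
    refine ⟨⟨fun W hW => ⟨fun _ => ht W hW, fun Z hZ => by simp at hZ⟩, fun W hW => by
      simp at hW⟩, ⟨fun W hW => ⟨fun _ => (ht W hW).symm hG.symm, fun Z hZ => by simp at hZ⟩,
      fun W hW => by simp at hW⟩⟩
  have hYs : ∀ t : Side H, t.kind = some Y → ∀ W, t.kind = some W → Tame X K W z y := by
    intro t h W hW
    rw [h] at hW; cases hW; exact hgeoY
  have hsfin : ∀ W, s.kind = some W → Tame X K W z y := hgeo s hsL
  refine ⟨⟨y, e.finish, some Y⟩ :: (L₁ ++ [⟨s.start, z, s.kind⟩, ⟨z, y, none⟩]),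
    ⟨e.start, y, some Y⟩ :: ⟨y, z, none⟩ :: ⟨z, s.finish, s.kind⟩ :: L₂,
    ⟨⟨y, rfl, isPath_append.2 ⟨s.start, hp₁, by simp [IsPath]⟩⟩, ?_, ?_⟩,
    ⟨⟨e.start, rfl, rfl, rfl, hp₂⟩, ?_, ?_⟩, ?_, ?_, ?_, ?_⟩
  · simp only [List.mem_cons, List.mem_append, List.not_mem_nil, or_false]
    rintro t (rfl | h | rfl | rfl)
    · intro W hW; cases hW; exact ⟨hzy.1, hb⟩
    · exact hvL t (by simp [h])
    · exact hsv _ _ (hvL s hsL).allowed_start hsz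
    · intro W hW; cases hW
  · simp only [List.pairwise_cons, List.pairwise_append, List.mem_cons, List.mem_append,
      List.not_mem_nil, or_false, List.Pairwise.nil, and_true, forall_eq]
    refine ⟨?_, hc₁, ⟨?_, fun t ht => by simp at ht⟩, ?_⟩
    · rintro t (h | rfl | rfl)
      · exact hbase _ _ t (hce t (by simp [h]))
      · exact hs1 _ (hbase _ _ s (hce s (by simp)))
      · exact (hcut _ (hYs _ rfl)).1
    · exact (hcut ⟨s.start, z, s.kind⟩ hsfin).1
    · rintro t ht t' (rfl | rfl)
      · exact hs1 t (hc₁₂ t ht s (by simp))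
      · exact (hcut _ (hgeo t (by simp [ht]))).1
  · simp only [List.mem_cons]
    rintro t (rfl | rfl | rfl | h)
    · intro W hW; cases hW; exact ⟨ha, hzy.1⟩
    · intro W hW; cases hW
    · intro W hW
      exact ⟨hsz.2 W hW, (hvL s hsL W hW).2⟩
    · exact hvL t (by simp [h])
  · simp only [List.pairwise_cons, List.mem_cons]
    refine ⟨?_, ?_, ?_, hc₂⟩
    · rintro t (rfl | rfl | h)
      · exact (hcut _ (hYs _ rfl)).2
      · exact hs2 _ (hbase _ _ s (hce s (by simp)))
      · exact hbase _ _ t (hce t (by simp [h]))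
    · rintro t (rfl | h)
      · exact (hcut ⟨z, s.finish, s.kind⟩ hsfin).2.symm
      · exact (hcut _ (hgeo t (by simp [h]))).2.symm
    · intro t h
      exact (hs2 t (hcs₂ t h).symm).symm
  -- The projection travels at least `9K` along `L₁` and the first part of `s`, which forces `9 ≤
  -- L₁.length + 2`. With the cut and the part of `e`, the first polygon has at least 10 sides.
  · have := relDistOn_le_of_isPath (Y := Y) (L := L₁ ++ [⟨s.start, z, s.kind⟩]) hK
      (b := z) (isPath_append.2 ⟨s.start, hp₁, by simp [IsPath]⟩) ?_ (nearest_self hb) hzy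
    · rw [relDistOn_comm hG.symm] at this
      have := hyb.trans this
      have : 9 * K ≤ K * ((L₁ ++ [(⟨s.start, z, s.kind⟩ : Side H)]).length + 1) := by exact_mod_cast this
      rw [mul_comm] at this
      have := Nat.le_of_mul_le_mul_left this hKpos
      simp at this ⊢
      omega
    · simp only [List.mem_append, List.mem_singleton]
      rintro t (h | rfl)
      · exact htame t (by simp [h])
      · exact Free.tame hK ((hs1 e (hce s hsL)).1 Y hY)
          (hsv _ _ (hvL s hsL).allowed_start hsz)
  · have := relDistOn_le_of_isPath (Y := Y) (L := ⟨z, s.finish, s.kind⟩ :: L₂) hK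
      (a := z) ⟨rfl, hp₂⟩ ?_ hzy (nearest_self ha)
    · rw [relDistOn_comm hG.symm] at this
      have := hay.trans this
      have : 9 * K ≤ K * ((⟨z, s.finish, s.kind⟩ :: L₂ : List (Side H)).length + 1) := by
        exact_mod_cast this
      rw [mul_comm] at this
      have := Nat.le_of_mul_le_mul_left this hKpos
      simp at this ⊢
      omega
    · simp only [List.mem_cons]
      rintro t (rfl | h)
      · exact Free.tame hK ((hs2 e (hce s hsL)).1 Y hY)
          fun W hW => ⟨hsz.2 W hW, (hvL s hsL W hW).2⟩
      · exact htame t (by simp [h])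
  · simp; omega
  · have hcs : cost X s ≤ cost X ⟨s.start, z, s.kind⟩ + cost X ⟨z, s.finish, s.kind⟩ := by
      unfold cost
      cases s.kind with
      | none => simp
      | some Z => exact relDistOn_triangle Z _ _ _
    have hcost_e : cost X e ≤ cost X ⟨e.start, y, some Y⟩ + cost X ⟨y, e.finish, some Y⟩ := by
      unfold cost
      rw [hY]
      exact relDistOn_triangle Y _ _ _
    have h0 : ∀ p q : G, cost X (⟨p, q, none⟩ : Side H) = 0 := fun _ _ => rfl
    simp only [totalCost, List.map_cons, List.map_append, List.sum_cons, List.sum_append,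
      List.map_nil, List.sum_nil, h0, add_zero, zero_add]
    refine (add_le_add hcost_e (add_le_add le_rfl (add_le_add hcs le_rfl))).trans (le_of_eq ?_)
    ring

/-! ### The linear bound for polygons. -/

lemma totalCost_le_of_forall {L : List (Side H)} {c : ℝ≥0∞} (h : ∀ s ∈ L, s.cost X ≤ c) :
    totalCost X L ≤ L.length * c := by
  have := List.sum_le_card_nsmul (L.map (cost X)) c (by simpa using h)
  simpa [totalCost] using this

/-- The shift by 5 is what makes the induction close: cutting gives `(m₁ - 5) + (m₂ - 5) = m - 6`,
although the total number of sides grows by 4. If no side is longer than `19K`, the shifted bound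
follows from `m ≤ 2(m - 5)` for `m ≥ 10`, whence the factor `38`. -/
theorem Generates.totalCost_le (hG : Generates H X) {K : ℕ} (hK : TameConst H X K)
    {L : List (Side H)} (hL : IsPolygon X K L) :
    totalCost X L ≤ (38 * K * L.length : ℕ) ∧
      (10 ≤ L.length → totalCost X L ≤ (38 * K * (L.length - 5) : ℕ)) := by
  induction hm : L.length using Nat.strong_induction_on generalizing L with
  | _ m ih =>
  by_cases hs : ∀ s ∈ L, s.cost X ≤ (19 * K : ℕ)
  · have := totalCost_le_of_forall hs
    rw [hm] at this
    refine ⟨this.trans ?_, fun h => this.trans ?_⟩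
    · norm_cast
      nlinarith
    · norm_cast
      have : m ≤ 2 * (m - 5) := by omega
      calc m * (19 * K) ≤ 2 * (m - 5) * (19 * K) := Nat.mul_le_mul_right _ this
        _ = _ := by ring
  · push Not at hs
    obtain ⟨e, he, hlt⟩ := hs
    obtain ⟨L₁, L₂, rfl⟩ := List.append_of_mem he
    have hperm : totalCost X (L₁ ++ e :: L₂) = totalCost X (e :: (L₂ ++ L₁)) := by
      simp only [totalCost, List.map_cons, List.map_append, List.sum_cons, List.sum_append]
      ring
    obtain ⟨P₁, P₂, h1, h2, hl1, hl2, hl, hle⟩ := hG.exists_cut hK hL.rotate hlt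
    rw [hperm]
    have hlen : P₁.length + P₂.length = m + 4 := by
      rw [hl, ← hm]
      simp
      omega
    have key : totalCost X (e :: (L₂ ++ L₁)) ≤ (38 * K * (m - 5) : ℕ) := by
      refine hle.trans ((add_le_add ((ih _ (by omega) h1 rfl).2 hl1)
        ((ih _ (by omega) h2 rfl).2 hl2)).trans ?_)
      norm_cast
      rw [← mul_add]
      exact Nat.mul_le_mul_left _ (by omega)
    exact ⟨key.trans (by exact_mod_cast Nat.mul_le_mul_left _ (by omega)), fun _ => key⟩

end ExpEqs

namespace ExpEqs

variable {G : Type*} [Group G] {Λ : Type*} {H : Λ → Subgroup G} {X : Set G}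

/-! ### Isolated components -/

lemma IsHWord.append {lam : Λ} {u v : List (Letter H X)} (hu : IsHWord lam u)
    (hv : IsHWord lam v) : IsHWord lam (u ++ v) := fun l hl =>
  (List.mem_append.1 hl).elim (hu l) (hv l)

lemma IsHWord.of_subset {lam : Λ} {u v : List (Letter H X)} (hv : IsHWord lam v) (h : u ⊆ v) :
    IsHWord lam u := fun l hl => hv l (h hl)

lemma IsHWord.wordVal_mem {lam : Λ} {w : List (Letter H X)} (hw : IsHWord lam w) :
    wordVal w ∈ H lam := by
  refine Subgroup.list_prod_mem _ fun g hg => ?_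
  obtain ⟨l, hl, rfl⟩ := List.mem_map.1 hg
  obtain ⟨h, rfl⟩ := hw l hl
  exact h.2

/-- The maximal `H lam`-subword at the beginning of a word. -/
lemma exists_hPrefix (lam : Λ) (w : List (Letter H X)) :
    ∃ y v, w = y ++ v ∧ IsHWord lam y ∧
      ∀ y' v', v = y' ++ v' → IsHWord lam y' → y' = [] := by
  induction w with
  | nil => exact ⟨[], [], rfl, by simp [IsHWord], by simp⟩
  | cons l w ih =>
    by_cases hl : ∃ h : H lam, l = .inr ⟨lam, h⟩
    · obtain ⟨y, v, rfl, hy, hv⟩ := ih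
      refine ⟨l :: y, v, rfl, fun m hm => ?_, hv⟩
      rcases List.mem_cons.1 hm with rfl | hm
      · exact hl
      · exact hy m hm
    · refine ⟨[], l :: w, rfl, by simp [IsHWord], fun y' v' e hy' => ?_⟩
      rcases y' with _ | ⟨m, y'⟩
      · rfl
      · simp only [List.cons_append, List.cons.injEq] at e
        exact absurd (hy' l (by simp [e.1])) hl

/-- The maximal `H lam`-subword at the end of a word. -/
lemma exists_hSuffix (lam : Λ) (w : List (Letter H X)) :
    ∃ u x, w = u ++ x ∧ IsHWord lam x ∧
      ∀ u' x', u = u' ++ x' → IsHWord lam x' → x' = [] := by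
  obtain ⟨y, v, h, hy, hv⟩ := exists_hPrefix lam w.reverse
  refine ⟨v.reverse, y.reverse, by rw [← List.reverse_append, ← h, List.reverse_reverse],
    hy.of_subset (by simp), fun u' x' e hx' => ?_⟩
  have := hv x'.reverse u'.reverse
    (by rw [← List.reverse_append, ← e, List.reverse_reverse]) (hx'.of_subset (by simp))
  simpa using this

/-- Another letter in the coset of an isolated component contradicts isolation. -/
lemma IsIsolatedComponent.notMem {lam : Λ} {p r r₁ r₂ : List (Letter H X)} {h : H lam}
    (hp : IsIsolatedComponent lam p r) (hr : r = r₁ ++ .inr ⟨lam, h⟩ :: r₂) :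
    wordVal (p ++ r₁) ∉ H lam := by
  intro hmem
  obtain ⟨u, x, rfl, hx, hu⟩ := exists_hSuffix lam r₁
  obtain ⟨y, v, rfl, hy, hv⟩ := exists_hPrefix lam r₂
  have hl : IsHWord lam [(.inr ⟨lam, h⟩ : Letter H X)] := by
    intro l hl; exact ⟨h, by simpa using hl⟩
  -- The component that contains the given letter is `x`, the letter and `y`. The vertex after `x`
  -- is joined to the initial vertex of `p` by the single letter with value `wordVal (p ++ r₁)`.
  refine hp.2.2.2 u (x ++ .inr ⟨lam, h⟩ :: y) v (by simp [hr]) ⟨by simp, ?_, ?_⟩ 0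
    (Nat.zero_le _) x.length (by simp) [.inr ⟨lam, ⟨_, hmem⟩⟩] ?_ ?_
  · simpa using hx.append (hl.append hy)
  · intro u' x' y' v' e1 e2 hw
    exact ⟨hu u' x' e1 (hw.of_subset (by simp)), hv y' v' e2 (hw.of_subset fun m hm => by simp [hm])⟩
  · intro l hl; exact ⟨_, by simpa using hl⟩
  · simp

/-! ### Existence of the constant -/

lemma isPath_ofFn {n : ℕ} (V : ℕ → G) (k : Fin n → Option (PCoset H)) :
    IsPath (V 0) (List.ofFn fun i : Fin n => (⟨V i, V (i + 1), k i⟩ : Side H)) (V n) := by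
  induction n generalizing V with
  | zero => simp [IsPath]
  | succ n ih =>
    rw [List.ofFn_succ]
    refine ⟨rfl, ?_⟩
    exact ih (fun j => V (j + 1)) fun i => k i.succ

/-- The vertices of a polygon. -/
def vertex (sides : List (List (Letter H X))) (j : ℕ) : G := wordVal (sides.take j).flatten

lemma vertex_succ (sides : List (List (Letter H X))) (i : Fin sides.length) :
    vertex sides (i + 1) = vertex sides i * wordVal (sides.get i) := by
  rw [vertex, vertex, List.take_succ_eq_append_getElem i.2, List.flatten_append, wordVal_append,
    List.flatten_singleton, List.get_eq_getElem]

lemma List.take_eq_append_cons {α : Type*} {l : List α} {j i : ℕ} (hj : j < i)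
    (hi : i ≤ l.length) : l.take i = l.take j ++ l[j] :: (l.take i).drop (j + 1) := by
  have := (List.take_append_drop j (l.take i)).symm
  rwa [List.take_take, min_eq_left hj.le, List.drop_eq_getElem_cons (by simp; omega),
    List.getElem_take] at this

lemma List.drop_eq_append_cons {α : Type*} {l : List α} {i j : ℕ} (hi : i < j)
    (hj : j < l.length) : l.drop (i + 1) = (l.take j).drop (i + 1) ++ l[j] :: l.drop (j + 1) := by
  have := congrArg (List.drop (i + 1)) (List.take_append_drop j l).symm
  rwa [List.drop_append_of_le_length (by simp; omega), List.drop_eq_getElem_cons hj] at this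

/-- A forbidden edge of side `j` is a letter of the complementary path in the coset of side `i`,
against `IsIsolatedComponent.notMem`. If `j` precedes `i`, the complementary path reaches `j` only
after passing the base vertex, and one uses that the polygon is closed. -/
lemma avoids_of_isolated {sides : List (List (Letter H X))} (h1 : wordVal sides.flatten = 1)
    {lam : Λ} {i j : Fin sides.length} (hij : j ≠ i)
    (hi : IsIsolatedComponent lam (sides.get i) (sides.drop (i + 1) ++ sides.take i).flatten) :
    Avoids X (PCoset.of H lam (vertex sides i)) (vertex sides j) (sides.get j) := by
  intro u v (h : H lam) e hY
  change sides.get j = u ++ .inr ⟨lam, h⟩ :: v at e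
  rw [PCoset.has_of] at hY
  rcases lt_or_gt_of_ne hij with hlt | hlt
  · have e1 : sides.take i = sides.take j ++ sides.get j :: (sides.take i).drop (j + 1) :=
      List.take_eq_append_cons hlt i.2.le
    refine hi.notMem (h := h) (r₁ := (sides.drop (i + 1) ++ sides.take j).flatten ++ u)
      (r₂ := v ++ ((sides.take i).drop (j + 1)).flatten) ?_ ?_
    · conv_lhs => rw [e1]
      simp only [List.flatten_append, List.flatten_cons, e]
      simp
    · convert hY using 1
      have h2 : vertex sides i * wordVal (sides.get i) *
          wordVal (sides.drop (i + 1)).flatten = 1 := by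
        rw [← vertex_succ, vertex, ← wordVal_append, ← List.flatten_append,
          List.take_append_drop, h1]
      have h3 : wordVal (sides.get i) * wordVal (sides.drop (i + 1)).flatten =
          (vertex sides i)⁻¹ := by
        rw [mul_assoc] at h2
        exact eq_inv_of_mul_eq_one_right h2
      simp only [List.flatten_append, wordVal_append, ← mul_assoc, h3]
      rfl
  · have e1 : sides.drop (i + 1) = (sides.take j).drop (i + 1) ++
        sides.get j :: sides.drop (j + 1) := List.drop_eq_append_cons hlt j.2
    refine hi.notMem (h := h) (r₁ := ((sides.take j).drop (i + 1)).flatten ++ u)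
      (r₂ := v ++ (sides.drop (j + 1) ++ sides.take i).flatten) ?_ ?_
    · conv_lhs => rw [e1]
      simp only [List.flatten_append, List.flatten_cons, e]
      simp
    · convert hY using 1
      have h2 : vertex sides j = vertex sides i * wordVal (sides.get i) *
          wordVal ((sides.take j).drop (i + 1)).flatten := by
        rw [← vertex_succ, vertex, vertex, ← wordVal_append, ← List.flatten_append]
        congr 2
        have := List.take_append_drop (i + 1 : ℕ) (sides.take j)
        rw [List.take_take, min_eq_left (by omega)] at this
        exact this.symm
      rw [h2]
      simp [mul_assoc]

theorem IsHyperbolicallyEmbedded.exists_polygonConstant (hHX : IsHyperbolicallyEmbedded H X) :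
    ∃ C : ℝ, IsPolygonConstant H X 1 1 C := by
  classical
  have hG := hHX.toGenerates
  obtain ⟨δ, hδ⟩ := hG.exists_thin hHX.hyperbolic
  obtain ⟨K, hK⟩ : ∃ K, TameConst H X K :=
    ⟨_, fun Y x w hw ha y y' hy hy' => hG.relDistOn_nearest_le hδ hw ha hy hy'⟩
  -- The summand 1 makes the constant positive also for `K = 0`.
  refine ⟨38 * K + 1, by positivity, fun sides I lam _ h1 hiso hqg => ?_⟩
  obtain ⟨V, hV⟩ : ∃ V, V = vertex sides := ⟨_, rfl⟩
  have hVs : ∀ i : Fin sides.length, V (i + 1) = V i * wordVal (sides.get i) :=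
    hV ▸ vertex_succ sides
  let k : Fin sides.length → Option (PCoset H) := fun i =>
    if i ∈ I then some (PCoset.of H (lam i) (V i)) else none
  have hk : ∀ i Y, k i = some Y → i ∈ I ∧ PCoset.of H (lam i) (V i) = Y := by
    intro i Y h
    by_cases hi : i ∈ I
    · exact ⟨hi, by simpa [k, hi] using h⟩
    · simp [k, hi] at h
  have hfree : ∀ i j, j ≠ i → ∀ Y, k i = some Y →
      (⟨V j, V (j + 1), k j⟩ : Side H).Free X K Y := by
    intro i j hij Y hY
    obtain ⟨hi, rfl⟩ := hk i Y hY
    have hav := avoids_of_isolated h1 hij (hiso i hi)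
    rw [← hV] at hav
    refine ⟨fun hj => ?_, fun Z hZ hZY => ?_⟩
    · have hj' : j ∉ I := fun h => by simp [k, h] at hj
      change Tame X K _ (V j) (V (j + 1))
      rw [hVs]
      exact hK _ _ _ (hqg j hj') hav
    -- Two distinguished sides cannot share a coset, since the first edge of side `j` would be an
    -- edge in the coset of side `i`.
    · obtain ⟨hj, rfl⟩ := hk j Z hZ
      obtain ⟨hne, hH, -⟩ := hiso j hj
      rw [← hZY] at hav
      obtain ⟨l, w, hw⟩ := List.exists_cons_of_ne_nil hne
      obtain ⟨h, rfl⟩ := hH l (hw ▸ List.mem_cons_self)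
      exact hav [] w h hw (by rw [wordVal_nil, mul_one]; exact PCoset.has_of_self _ _)
  have hpoly : IsPolygon X K (List.ofFn fun i : Fin sides.length =>
      (⟨V i, V (i + 1), k i⟩ : Side H)) := by
    refine ⟨⟨V 0, ?_⟩, ?_, ?_⟩
    · have := isPath_ofFn V k
      have h0 : V sides.length = V 0 := by simp [hV, vertex, h1]
      rwa [h0] at this
    · intro s hs Y hY
      obtain ⟨i, rfl⟩ := (List.mem_ofFn' _ _).1 hs
      obtain ⟨hi, rfl⟩ := hk i Y hY
      refine ⟨PCoset.has_of_self _ _, ?_⟩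
      change (PCoset.of H (lam i) (V i)).Has (V (i + 1))
      rw [PCoset.has_of, hVs, inv_mul_cancel_left]
      exact (hiso i hi).2.1.wordVal_mem
    · rw [List.pairwise_ofFn]
      exact fun i j hij => ⟨hfree i j hij.ne', hfree j i hij.ne⟩
  have key := (hG.totalCost_le hK hpoly).1
  rw [totalCost, List.map_ofFn, List.sum_ofFn, List.length_ofFn] at key
  have hsum : ∑ i ∈ I, relDist H X (lam i) 1 (wordVal (sides.get i)) ≤
      (38 * K * sides.length : ℕ) := by
    refine le_trans (le_of_eq ?_) key
    rw [← Finset.sum_filter_add_sum_filter_not Finset.univ (· ∈ I)]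
    rw [Finset.sum_eq_zero (s := Finset.univ.filter (¬ · ∈ I)), add_zero]
    · refine Finset.sum_congr (by ext; simp) fun i hi => ?_
      simp only [Function.comp, Side.cost, k, if_pos (Finset.mem_filter.1 hi).2,
        Option.elim_some]
      rw [← relDist_eq_relDistOn, hVs, inv_mul_cancel_left]
    · intro i hi
      simp [Side.cost, k, (Finset.mem_filter.1 hi).2]
  refine hsum.trans ?_
  rw [← ENNReal.ofReal_natCast]
  refine ENNReal.ofReal_le_ofReal ?_
  push_cast
  nlinarith [(Nat.cast_nonneg sides.length : (0 : ℝ) ≤ sides.length)]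

/-! ### Elements of balls -/

lemma relDist_le {lam : Λ} {a b : G} {w : List (Letter H X)} (hw : IsAdmissible lam a w)
    (hb : a * wordVal w = b) : relDist H X lam a b ≤ w.length :=
  biInf_le (fun w : List (Letter H X) => (w.length : ℝ≥0∞)) (i := w) ⟨hw, hb⟩

/-- If the closed path with label `h w`, `h ∈ H lam`, has no letter from `H lam` in the coset of
the letter `h`, then `h` is short. -/
lemma IsPolygonConstant.mem_relBall {C : ℝ} (hC : IsPolygonConstant H X 1 1 C) {lam : Λ}
    {w : List (Letter H X)} {h : H lam} (hw : h * wordVal w = 1)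
    (ha : IsAdmissible lam 1 w) {L : ℝ} (hL : (w.length : ℝ) + 1 ≤ L) :
    h ∈ relBall H X lam 1 (C * L) := by
  have hmem : wordVal w ∈ H lam := by
    rw [eq_inv_of_mul_eq_one_right hw]; exact inv_mem h.2
  have hL' : C * (w.length + 1) ≤ C * L := mul_le_mul_of_nonneg_left hL hC.1.le
  refine le_trans ?_ (ENNReal.ofReal_le_ofReal hL')
  -- For empty `w` the polygon would have only one side, which the constant does not cover; but then
  -- `h = 1`.
  rcases eq_or_ne w [] with rfl | hne
  · have : h = 1 := by ext; simpa using hw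
    rw [this, Subgroup.coe_one]
    have he : IsAdmissible lam 1 ([] : List (Letter H X)) := fun u v h e => by simp at e
    exact (relDist_le he (by simp)).trans (by simp)
  let l : Letter H X := .inr ⟨lam, h⟩
  have hflat : (w.map fun a => [a]).flatten = w := by
    rw [← List.flatMap_def, List.flatMap_singleton']
  have ha' : ∀ (u v : List (Letter H X)) (h : H lam), w = u ++ .inr ⟨lam, h⟩ :: v →
      wordVal u ∉ H lam := by simpa [IsAdmissible] using ha
  have hiso : IsIsolatedComponent lam [l] w := by
    refine ⟨by simp, ?_, ?_, ?_⟩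
    · intro m hm; exact ⟨h, by simpa using hm⟩
    · intro x y r' e hxy
      constructor
      · rcases x with _ | ⟨m, x⟩
        · rfl
        · obtain ⟨h', rfl⟩ := hxy m (by simp)
          refine absurd ?_ (ha' (y ++ r') x h' e)
          have hx : wordVal ((.inr ⟨lam, h'⟩ : Letter H X) :: x) ∈ H lam :=
            (hxy.of_subset (by intro; simp; tauto)).wordVal_mem
          rw [e, wordVal_append] at hmem
          exact (Subgroup.mul_mem_cancel_right _ hx).1 hmem
      · rcases y with _ | ⟨m, y⟩
        · rfl
        · obtain ⟨h', rfl⟩ := hxy m (by simp)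
          exact absurd (one_mem _) (ha' [] (y ++ (r' ++ x)) h' (by simpa using e))
    -- A connection to a component `c` puts the initial vertex of `c` into `H lam`, so the first
    -- letter of `c` would violate admissibility.
    · rintro u c v rfl ⟨hc, hcH, -⟩ i - j - γ hγ e
      obtain ⟨m, c', rfl⟩ := List.exists_cons_of_ne_nil hc
      obtain ⟨h', rfl⟩ := hcH m (by simp)
      refine ha' u (c' ++ v) h' (by simp) ?_
      have h1 : wordVal ([l].take i) ∈ H lam :=
        IsHWord.wordVal_mem fun m hm => ⟨h, by simpa using List.mem_of_mem_take hm⟩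
      have h2 := mul_mem h1 hγ.wordVal_mem
      rw [e, wordVal_append, wordVal_append] at h2
      have h3 : wordVal (((.inr ⟨lam, h'⟩ : Letter H X) :: c').take j) ∈ H lam :=
        (hcH.of_subset (List.take_subset _ _)).wordVal_mem
      have h4 := (Subgroup.mul_mem_cancel_right _ h3).1 h2
      exact (Subgroup.mul_mem_cancel_left _ (by simp [l])).1 h4
  -- Every letter of `w` is a side of its own, hence a `(1, 1)`-quasi-geodesic, and only the side
  -- `h` is put into `I`. The polygon has `w.length + 1` sides.
  have key := hC.2 ([l] :: w.map fun a => [a]) {⟨0, by simp⟩} (fun _ => lam)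
    (by
      have := List.length_pos_iff.2 hne
      simp; omega)
    (by simp [hflat, l, hw])
    (by
      intro i hi
      rw [Finset.mem_singleton] at hi
      subst hi
      simpa [hflat] using hiso)
    (by
      intro i hi
      refine isQuasiGeodesic_of_length_le_one ?_
      have : ∀ s ∈ ([l] :: w.map fun a => [a]), s.length ≤ 1 := by
        intro s hs
        rcases List.mem_cons.1 hs with rfl | hs
        · simp
        · obtain ⟨a, -, rfl⟩ := List.mem_map.1 hs
          simp
      exact this _ (List.get_mem _ _))
  simpa [l] using key

end ExpEqs

namespace ExpEqs

/-! ### Symbolic words -/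

/-- A symbol of an expression over a subgroup: the name of an element with an exponent `±1`, or
the name of an element and the index of a variable, which is its exponent. -/
abbrev Sym := (ℕ × Bool) ⊕ (ℕ × ℕ)

/-- The name of a letter from `X`, or the name of a subgroup with an expression over it. -/
abbrev GLetter := ℕ ⊕ (ℕ × List Sym)

abbrev GWord := List GLetter

/-- The symbolic operations are composed of eliminators and list operations so that they can be
proved primitive recursive by combinators. -/
def symVars (s : Sym) : List ℕ := Sum.elim (fun _ => []) (fun q => [q.2]) s

def exprVars (e : List Sym) : List ℕ := e.flatMap symVars

def letterVars (g : GLetter) : List ℕ := Sum.elim (fun _ => []) (fun q => exprVars q.2) g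

def wordVars (W : GWord) : List ℕ := W.flatMap letterVars

/-- The expression at the place `i` of `W`, if it is an expression over the subgroup `l`. -/
def exprAt (W : GWord) (i l : ℕ) : Option (List Sym) :=
  W[i]?.bind fun g => Sum.elim (fun _ => none) (fun q => if q.1 = l then some q.2 else none) g

/-- Cut `P u Q v R = 1` into `Q h = 1` and `P u h⁻¹ v R = 1`. The result consists of a list of
words to be processed and a list of words that need no more processing. -/
def splitAt (W : GWord) (p : ℕ × ℕ) (i j : ℕ) : Option (List GWord × List GWord) :=
  if i < j then (exprAt W i p.1).bind fun u => (exprAt W j p.1).map fun v =>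
    ([(W.take j).drop (i + 1) ++ [.inr (p.1, [.inl (p.2, true)])],
      W.take i ++ .inr (p.1, u ++ .inl (p.2, false) :: v) :: W.drop (j + 1)], [])
  else none

/-- Cut `P u R = 1` into `P h R = 1` and `u h⁻¹ = 1`. -/
def substAt (W : GWord) (p : ℕ × ℕ) (i : ℕ) : Option (List GWord × List GWord) :=
  (exprAt W i p.1).map fun u =>
    ([W.take i ++ .inr (p.1, [.inl (p.2, true)]) :: W.drop (i + 1)],
      [[.inr (p.1, u ++ [.inl (p.2, false)])]])

/-- No test is made whether the element of the table fits: it would depend on the values of the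
variables. -/
def branches (T : List (ℕ × ℕ)) (W : GWord) : List (List GWord × List GWord) :=
  T.flatMap fun p => (List.range W.length).flatMap fun i =>
    (substAt W p i).toList ++ (List.range W.length).filterMap fun j => splitAt W p i j

/-- Words to be processed, and words that need no more processing. -/
abbrev SysState := List GWord × List GWord

/-- A word without variables yields a trivial equation, and a single letter yields an equation over
one subgroup. -/
def GWord.Done (W : GWord) : Prop := wordVars W = [] ∨ W.length ≤ 1

instance (W : GWord) : Decidable W.Done := inferInstanceAs (Decidable (_ ∨ _))

/-- States with nothing left to process are fixed points, so running longer than needed does no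
harm. -/
def sysStep (T : List (ℕ × ℕ)) (s : SysState) : List SysState :=
  s.1.casesOn [s] fun W Ws => if GWord.Done W then [(Ws, W :: s.2)] else
    (branches T W).map fun d => (d.1 ++ Ws, d.2 ++ s.2)

def sysRun (T : List (ℕ × ℕ)) (n : ℕ) (S : List SysState) : List SysState :=
  (fun S => S.flatMap (sysStep T))^[n] S

/-- The relational form of `branches`, with the places given by decompositions of the word instead
of indices. -/
inductive Branch (T : List (ℕ × ℕ)) : GWord → List GWord × List GWord → Prop
  | split {P Q R : GWord} {u v : List Sym} {l h : ℕ} (hT : (l, h) ∈ T) :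
    Branch T (P ++ .inr (l, u) :: (Q ++ .inr (l, v) :: R))
      ([Q ++ [.inr (l, [.inl (h, true)])], P ++ .inr (l, u ++ .inl (h, false) :: v) :: R], [])
  | subst {P R : GWord} {u : List Sym} {l h : ℕ} (hT : (l, h) ∈ T) :
    Branch T (P ++ .inr (l, u) :: R)
      ([P ++ .inr (l, [.inl (h, true)]) :: R], [[.inr (l, u ++ [.inl (h, false)])]])

/-! ### Equivalence of the two forms of branching. -/

lemma exprAt_eq_some {W : GWord} {i l : ℕ} {e : List Sym} :
    exprAt W i l = some e ↔ W[i]? = some (.inr (l, e)) := by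
  unfold exprAt
  rcases W[i]? with _ | x | ⟨l', e'⟩
  · simp
  · simp
  · simp

lemma List.eq_take_append_cons_drop {α : Type*} {l : List α} {i : ℕ} {x : α} (h : l[i]? = some x) :
    l = l.take i ++ x :: l.drop (i + 1) := by
  obtain ⟨hi, rfl⟩ := List.getElem?_eq_some_iff.1 h
  simp

lemma List.drop_succ_append {α : Type*} {l P R : List α} {x : α} {i : ℕ} (h : l = P ++ x :: R)
    (hi : i = P.length) : l.drop (i + 1) = R := by
  subst h hi
  simp [List.drop_append]

lemma List.take_length_append {α : Type*} {l P R : List α} {i : ℕ} (h : l = P ++ R)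
    (hi : i = P.length) : l.take i = P := by
  subst h hi
  simp

lemma mem_branches {T : List (ℕ × ℕ)} {W : GWord} {d : List GWord × List GWord} :
    d ∈ branches T W ↔ Branch T W d := by
  simp only [branches, List.mem_flatMap, List.mem_append, List.mem_filterMap, List.mem_range,
    Option.mem_toList]
  constructor
  · rintro ⟨⟨l, h⟩, hT, i, hi, hd | ⟨j, hj, hd⟩⟩
    · simp only [substAt, Option.map_eq_some_iff, exprAt_eq_some] at hd
      obtain ⟨u, hu, rfl⟩ := hd
      have := Branch.subst (P := W.take i) (R := W.drop (i + 1)) (u := u) hT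
      rwa [← List.eq_take_append_cons_drop hu] at this
    · unfold splitAt at hd
      split_ifs at hd with hij
      simp only [Option.bind_eq_some_iff, Option.map_eq_some_iff, exprAt_eq_some] at hd
      obtain ⟨u, hu, v, hv, rfl⟩ := hd
      have := Branch.split (P := W.take i) (Q := (W.take j).drop (i + 1))
        (R := W.drop (j + 1)) (u := u) (v := v) hT
      obtain ⟨hi', hu'⟩ := List.getElem?_eq_some_iff.1 hu
      have h1 := List.take_eq_append_cons hij hj.le
      rw [hu'] at h1
      have h2 : W = W.take i ++ .inr (l, u) :: ((W.take j).drop (i + 1) ++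
          .inr (l, v) :: W.drop (j + 1)) := by
        have := List.eq_take_append_cons_drop hv
        rw [h1] at this
        simpa using this
      rwa [← h2] at this
  · rintro (@⟨P, Q, R, u, v, l, h, hT⟩ | @⟨P, R, u, l, h, hT⟩)
    · refine ⟨(l, h), hT, P.length, by simp, .inr ⟨P.length + 1 + Q.length, by simp; omega, ?_⟩⟩
      have h1 : exprAt (P ++ .inr (l, u) :: (Q ++ .inr (l, v) :: R)) P.length l = some u := by
        simp [exprAt_eq_some]
      have h2 : exprAt (P ++ .inr (l, u) :: (Q ++ .inr (l, v) :: R)) (P.length + 1 + Q.length) l =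
          some v := by
        rw [exprAt_eq_some, List.getElem?_append_right (by omega),
          show P.length + 1 + Q.length - P.length = Q.length + 1 by omega]
        simp
      have h3 : (P ++ .inr (l, u) :: (Q ++ .inr (l, v) :: R)).take (P.length + 1 + Q.length) =
          P ++ .inr (l, u) :: Q :=
        List.take_length_append (R := .inr (l, v) :: R) (by simp) (by simp; omega)
      have h4 : (P ++ .inr (l, u) :: (Q ++ .inr (l, v) :: R)).drop
          (P.length + 1 + Q.length + 1) = R :=
        List.drop_succ_append (x := .inr (l, v)) (P := P ++ .inr (l, u) :: Q) (by simp)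
          (by simp; omega)
      have h5 : (P ++ .inr (l, u) :: Q).drop (P.length + 1) = Q :=
        List.drop_succ_append rfl rfl
      rw [splitAt, if_pos (by omega), h1, h2, h3, h4, h5]
      simp
    · refine ⟨(l, h), hT, P.length, by simp, .inl ?_⟩
      have h1 : exprAt (P ++ .inr (l, u) :: R) P.length l = some u := by
        simp [exprAt_eq_some]
      have h2 : (P ++ .inr (l, u) :: R).drop (P.length + 1) = R := List.drop_succ_append rfl rfl
      simp [substAt, h1, h2]

/-! ### Values of symbolic words -/

namespace Naming

variable {G : Type*} [Group G] {Λ : Type*} {H : Λ → Subgroup G} {X : Set G} (N : Naming H X)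

/-- The value 1 of a meaningless name only keeps evaluation total; validity of words and tables
excludes such names. -/
noncomputable def constVal (lam : Λ) (j : ℕ) : H lam := (N.elt lam j).getD 1

noncomputable def symVal (lam : Λ) (k : ℕ → ℤ) : Sym → H lam
  | .inl p => if p.2 then N.constVal lam p.1 else (N.constVal lam p.1)⁻¹
  | .inr q => N.constVal lam q.1 ^ k q.2

noncomputable def exprVal (lam : Λ) (k : ℕ → ℤ) (e : List Sym) : H lam :=
  (e.map (N.symVal lam k)).prod

noncomputable def letterVal (k : ℕ → ℤ) : GLetter → G
  | .inl i => ((N.gen i).map Subtype.val).getD 1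
  | .inr q => (N.idx q.1).elim 1 fun lam => (N.exprVal lam k q.2 : G)

noncomputable def gVal (k : ℕ → ℤ) (W : GWord) : G := (W.map (N.letterVal k)).prod

/-- All names in a symbol stand for elements, and its variables are among the first `n` ones. -/
def SymValid (n : ℕ) (lam : Λ) : Sym → Prop
  | .inl p => (N.elt lam p.1).isSome
  | .inr q => (N.elt lam q.1).isSome ∧ q.2 < n

/-- All names in a letter stand for elements, and variables occur over subgroups with names
in `Act` only. -/
def LetterValid (n : ℕ) (Act : Set ℕ) : GLetter → Prop
  | .inl i => (N.gen i).isSome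
  | .inr q => ∃ lam, N.idx q.1 = some lam ∧ (∀ s ∈ q.2, N.SymValid n lam s) ∧
      (exprVars q.2 ≠ [] → q.1 ∈ Act)

def WordValid (n : ℕ) (Act : Set ℕ) (W : GWord) : Prop := ∀ g ∈ W, N.LetterValid n Act g

def TableValid (T : List (ℕ × ℕ)) : Prop :=
  ∀ p ∈ T, ∃ lam, N.idx p.1 = some lam ∧ (N.elt lam p.2).isSome

variable {N} {n : ℕ} {Act : Set ℕ} {T : List (ℕ × ℕ)} {k : ℕ → ℤ}

@[simp] lemma gVal_nil : N.gVal k [] = 1 := rfl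

@[simp] lemma gVal_cons (g : GLetter) (W : GWord) :
    N.gVal k (g :: W) = N.letterVal k g * N.gVal k W := by simp [gVal]

@[simp] lemma gVal_append (V W : GWord) : N.gVal k (V ++ W) = N.gVal k V * N.gVal k W := by
  simp [gVal]

lemma letterVal_inr {l : ℕ} {lam : Λ} (hl : N.idx l = some lam) (e : List Sym) :
    N.letterVal k (.inr (l, e)) = N.exprVal lam k e := by simp [letterVal, hl]

@[simp] lemma exprVal_nil (lam : Λ) : N.exprVal lam k [] = 1 := rfl

@[simp] lemma exprVal_cons (lam : Λ) (s : Sym) (e : List Sym) :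
    N.exprVal lam k (s :: e) = N.symVal lam k s * N.exprVal lam k e := by simp [exprVal]

@[simp] lemma exprVal_append (lam : Λ) (e e' : List Sym) :
    N.exprVal lam k (e ++ e') = N.exprVal lam k e * N.exprVal lam k e' := by simp [exprVal]

lemma wordValid_append {V W : GWord} :
    N.WordValid n Act (V ++ W) ↔ N.WordValid n Act V ∧ N.WordValid n Act W := by
  simp [WordValid, or_imp, forall_and]

lemma wordValid_cons {g : GLetter} {W : GWord} :
    N.WordValid n Act (g :: W) ↔ N.LetterValid n Act g ∧ N.WordValid n Act W := by
  simp [WordValid]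

lemma wordValid_nil : N.WordValid n Act [] := by simp [WordValid]

end Naming

/-! ### Invariants of a single cut. -/

lemma exprVars_append (e e' : List Sym) : exprVars (e ++ e') = exprVars e ++ exprVars e' := by
  simp [exprVars]

lemma wordVars_append (V W : GWord) : wordVars (V ++ W) = wordVars V ++ wordVars W := by
  simp [wordVars]

lemma wordVars_cons (g : GLetter) (W : GWord) :
    wordVars (g :: W) = letterVars g ++ wordVars W := by simp [wordVars]

@[simp] lemma exprVars_inl_cons (p : ℕ × Bool) (e : List Sym) :
    exprVars (.inl p :: e) = exprVars e := by simp [exprVars, symVars]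

@[simp] lemma exprVars_nil : exprVars [] = [] := rfl

@[simp] lemma wordVars_nil : wordVars [] = [] := rfl

@[simp] lemma letterVars_inr (q : ℕ × List Sym) : letterVars (.inr q) = exprVars q.2 := rfl

lemma Branch.valid {G : Type*} [Group G] {Λ : Type*} {H : Λ → Subgroup G} {X : Set G}
    {N : Naming H X} {n : ℕ} {Act : Set ℕ} {T : List (ℕ × ℕ)} (hT : N.TableValid T) {W : GWord}
    {d : List GWord × List GWord} (h : Branch T W d) (hW : N.WordValid n Act W) :
    ∀ V ∈ d.1 ++ d.2, N.WordValid n Act V := by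
  have hc : ∀ {l h : ℕ} (b : Bool), (l, h) ∈ T →
      N.LetterValid n Act (.inr (l, [.inl (h, b)])) := by
    intro l h b hlh
    obtain ⟨lam, h1, h2⟩ := hT _ hlh
    exact ⟨lam, h1, by simpa [Naming.SymValid] using h2, by simp⟩
  rcases h with ⟨hT'⟩ | ⟨hT'⟩
  · rename_i P Q R u v l h
    simp only [Naming.wordValid_append, Naming.wordValid_cons] at hW
    obtain ⟨hP, ⟨lam, h1, h2, h3⟩, hQ, ⟨mu, h1', h2', h3'⟩, hR⟩ := hW
    obtain ⟨_, h1'', h4, _⟩ := hc false hT'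
    simp only at h1 h1' h1''
    obtain rfl := Option.some.inj (h1.symm.trans h1')
    obtain rfl := Option.some.inj (h1.symm.trans h1'')
    intro V hV
    simp only [List.append_nil, List.mem_cons, List.not_mem_nil, or_false] at hV
    rcases hV with rfl | rfl
    · simp only [Naming.wordValid_append, Naming.wordValid_cons]
      exact ⟨hQ, hc true hT', Naming.wordValid_nil⟩
    · simp only [Naming.wordValid_append, Naming.wordValid_cons]
      refine ⟨hP, ⟨lam, h1, ?_, ?_⟩, hR⟩
      · intro s hs
        simp only [List.mem_append, List.mem_cons] at hs
        rcases hs with hs | rfl | hs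
        · exact h2 s hs
        · exact h4 _ (by simp)
        · exact h2' s hs
      · intro hne
        simp only [exprVars_append, exprVars_inl_cons] at hne
        by_cases hu : exprVars u = []
        · exact h3' (by simpa [hu] using hne)
        · exact h3 hu
  · rename_i P R u l h
    simp only [Naming.wordValid_append, Naming.wordValid_cons] at hW
    obtain ⟨hP, ⟨lam, h1, h2, h3⟩, hR⟩ := hW
    obtain ⟨_, h1'', h4, _⟩ := hc false hT'
    simp only at h1 h1''
    obtain rfl := Option.some.inj (h1.symm.trans h1'')
    intro V hV
    simp only [List.cons_append, List.nil_append, List.mem_cons, List.not_mem_nil,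
      or_false] at hV
    rcases hV with rfl | rfl
    · simp only [Naming.wordValid_append, Naming.wordValid_cons]
      exact ⟨hP, hc true hT', hR⟩
    · rw [Naming.wordValid_cons]
      refine ⟨⟨lam, h1, ?_, ?_⟩, Naming.wordValid_nil⟩
      · intro s hs
        rcases List.mem_append.1 hs with hs | hs
        · exact h2 s hs
        · exact h4 s hs
      · intro hne
        exact h3 (by simpa [exprVars_append] using hne)

lemma Branch.done {T : List (ℕ × ℕ)} {W : GWord} {d : List GWord × List GWord}
    (h : Branch T W d) : ∀ V ∈ d.2, GWord.Done V := by
  rcases h with _ | _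
  · simp
  · simp [GWord.Done]

/-- Each occurrence of a variable passes to exactly one of the new words. This is where the
disjointness of the variables in a system comes from. -/
lemma Branch.vars_perm {T : List (ℕ × ℕ)} {W : GWord} {d : List GWord × List GWord}
    (h : Branch T W d) : ((d.1 ++ d.2).flatMap wordVars).Perm (wordVars W) := by
  rcases h with ⟨hT'⟩ | ⟨hT'⟩
  · simp only [List.append_nil, List.flatMap_cons, List.flatMap_nil, wordVars_append,
      wordVars_cons, letterVars_inr, exprVars_append, exprVars_inl_cons, exprVars_nil,
      wordVars_nil, ← Multiset.coe_eq_coe, ← Multiset.coe_add]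
    abel
  · simp only [List.cons_append, List.nil_append, List.append_nil, List.flatMap_cons,
      List.flatMap_nil, wordVars_append,
      wordVars_cons, letterVars_inr, exprVars_append, exprVars_inl_cons, exprVars_nil,
      wordVars_nil, ← Multiset.coe_eq_coe, ← Multiset.coe_add]
    abel

/-- This is true for any element `h` of the table: the split-off equation itself forces `h⁻¹` to be
the value of `Q`, or `h` to be that of `u`. Balls and hyperbolicity matter only for completeness. -/
lemma Branch.sound {G : Type*} [Group G] {Λ : Type*} {H : Λ → Subgroup G} {X : Set G}
    {N : Naming H X} {T : List (ℕ × ℕ)} (hT : N.TableValid T) {k : ℕ → ℤ} {W : GWord}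
    {d : List GWord × List GWord} (h : Branch T W d) (hd : ∀ V ∈ d.1 ++ d.2, N.gVal k V = 1) :
    N.gVal k W = 1 := by
  rcases h with ⟨hT'⟩ | ⟨hT'⟩
  · rename_i P Q R u v l h
    obtain ⟨lam, hl, -⟩ := hT _ hT'
    simp only [List.append_nil, List.mem_cons, List.not_mem_nil, or_false, forall_eq_or_imp,
      forall_eq, Naming.gVal_append, Naming.gVal_cons, Naming.letterVal_inr hl,
      Naming.gVal_nil, mul_one, Naming.exprVal_append, Naming.exprVal_cons, Naming.exprVal_nil,
      Naming.symVal, Bool.false_eq_true, if_true, if_false] at hd ⊢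
    rw [← hd.2, eq_inv_of_mul_eq_one_left hd.1]
    simp [mul_assoc]
  · rename_i P R u l h
    obtain ⟨lam, hl, -⟩ := hT _ hT'
    simp only [List.cons_append, List.nil_append, List.mem_cons, List.not_mem_nil, or_false,
      forall_eq_or_imp,
      forall_eq, Naming.gVal_append, Naming.gVal_cons, Naming.letterVal_inr hl,
      Naming.gVal_nil, mul_one, Naming.exprVal_append, Naming.exprVal_cons, Naming.exprVal_nil,
      Naming.symVal, Bool.false_eq_true, if_true, if_false] at hd ⊢
    have h2 := hd.2
    rw [Subgroup.coe_mul, Subgroup.coe_inv, mul_inv_eq_one] at h2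
    rw [h2]
    exact hd.1

end ExpEqs

namespace ExpEqs

variable {G : Type*} [Group G] {Λ : Type*} {H : Λ → Subgroup G} {X : Set G} {N : Naming H X}
  {n : ℕ} {Act : Set ℕ} {T : List (ℕ × ℕ)} {k : ℕ → ℤ}

namespace Naming

/-- The letter that is the value of a symbolic letter. -/
def Interp (N : Naming H X) (k : ℕ → ℤ) : GLetter → Letter H X → Prop
  | .inl i, .inl x => N.gen i = some x
  | .inr q, .inr h => N.idx q.1 = some h.1 ∧ h.2 = N.exprVal h.1 k q.2
  | _, _ => False

/-- An expression over a subgroup becomes one letter, so the length of the path does not depend on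
the exponents. -/
lemma exists_interp (k : ℕ → ℤ) {W : GWord} (hW : N.WordValid n Act W) :
    ∃ w, List.Forall₂ (N.Interp k) W w := by
  induction W with
  | nil => exact ⟨[], .nil⟩
  | cons g W ih =>
    rw [wordValid_cons] at hW
    obtain ⟨w, hw⟩ := ih hW.2
    rcases g with i | ⟨l, e⟩
    · obtain ⟨x, hx⟩ := Option.isSome_iff_exists.1 hW.1
      exact ⟨.inl x :: w, .cons hx hw⟩
    · obtain ⟨lam, hl, -⟩ := hW.1
      exact ⟨.inr ⟨lam, N.exprVal lam k e⟩ :: w, .cons ⟨hl, rfl⟩ hw⟩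

lemma Interp.val_eq {g : GLetter} {x : Letter H X} (h : N.Interp k g x) :
    N.letterVal k g = x.val := by
  rcases g with i | ⟨l, e⟩ <;> rcases x with x | ⟨lam, y⟩
  · simp only [Interp] at h
    simp [letterVal, h, Letter.val]
  · exact h.elim
  · exact h.elim
  · obtain ⟨h1, h2⟩ := h
    simp only at h1 h2
    rw [letterVal_inr h1, ← h2, val_inr]

lemma gVal_eq_wordVal {W : GWord} {w : List (Letter H X)} (h : List.Forall₂ (N.Interp k) W w) :
    N.gVal k W = wordVal w := by
  induction h with
  | nil => rfl
  | cons h _ ih => rw [gVal_cons, wordVal_cons, ih, h.val_eq]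

lemma exists_split_of_interp {W : GWord} {u v : List (Letter H X)} {x : Letter H X}
    (h : List.Forall₂ (N.Interp k) W (u ++ x :: v)) :
    ∃ U g V, W = U ++ g :: V ∧ List.Forall₂ (N.Interp k) U u ∧ N.Interp k g x := by
  induction u generalizing W with
  | nil =>
    rcases h with _ | ⟨hg, hV⟩
    exact ⟨[], _, _, rfl, .nil, hg⟩
  | cons y u ih =>
    rcases h with _ | ⟨hg, hV⟩
    obtain ⟨U, g, V, rfl, hU, hg'⟩ := ih hV
    exact ⟨_ :: U, g, V, rfl, .cons hg hU, hg'⟩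

/-- The elements of the balls needed for words of length at most `L` are in the table. -/
def TableComplete (N : Naming H X) (T : List (ℕ × ℕ)) (Act : Set ℕ) (r : ℝ) : Prop :=
  ∀ l ∈ Act, ∀ lam, N.idx l = some lam → ∀ h ∈ relBall H X lam 1 r,
    ∃ j, (l, j) ∈ T ∧ N.elt lam j = some h

/-- Since different names of subgroups stand for different members of `Λ`, only letters with the
same name `l` can be edges in the coset. -/
lemma mem_relBall_of_word {C : ℝ} (hC : IsPolygonConstant H X 1 1 C) {l : ℕ} {lam : Λ}
    (hl : N.idx l = some lam) {Q : GWord} (hQ : N.WordValid n Act Q) {h : H lam}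
    (hh : h * N.gVal k Q = 1)
    (ha : ∀ Q₁ Q₂ e, Q = Q₁ ++ .inr (l, e) :: Q₂ → N.gVal k Q₁ ∉ H lam) {L : ℕ}
    (hL : Q.length + 1 ≤ L) : h ∈ relBall H X lam 1 (C * L) := by
  obtain ⟨w, hw⟩ := exists_interp k hQ
  refine hC.mem_relBall (w := w) (by rw [← gVal_eq_wordVal hw, hh]) ?_ ?_
  · rintro u v h' rfl
    obtain ⟨U, g, V, rfl, hU, hg⟩ := exists_split_of_interp hw
    rw [one_mul, ← gVal_eq_wordVal hU]
    rcases g with i | ⟨l', e⟩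
    · exact hg.elim
    · obtain rfl := N.idx_inj l l' lam hl hg.1
      exact ha U V e rfl
  · rw [← hw.length_eq]
    exact_mod_cast hL

lemma exists_elt {C : ℝ} (hC : IsPolygonConstant H X 1 1 C) {L : ℕ}
    (hT : N.TableComplete T Act (C * L)) {l : ℕ} (hlA : l ∈ Act) {lam : Λ}
    (hl : N.idx l = some lam) {Q : GWord} (hQ : N.WordValid n Act Q) {h : H lam}
    (hh : h * N.gVal k Q = 1)
    (ha : ∀ Q₁ Q₂ e, Q = Q₁ ++ .inr (l, e) :: Q₂ → N.gVal k Q₁ ∉ H lam)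
    (hL : Q.length + 1 ≤ L) : ∃ j, (l, j) ∈ T ∧ N.constVal lam j = h := by
  obtain ⟨j, hj, hj'⟩ := hT l hlA lam hl h (mem_relBall_of_word hC hl hQ hh ha hL)
  exact ⟨j, hj, by simp [constVal, hj']⟩

end Naming

/-! ### Potential and the existence of a suitable cut. -/

/-- The number of letters with variables. -/
def varLetters (W : GWord) : ℕ := W.countP fun g => letterVars g ≠ []

/-- A bound for the number of steps that are needed to process a word. -/
def potential (W : GWord) : ℕ := 2 * W.length ^ 2 + varLetters W + 1

def totalPotential (l : List GWord) : ℕ := (l.map potential).sum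

/-- The length is distributed over two nonempty words, so the doubled square drops by at least 4,
which pays for the second summand 1. Merging letters does not increase the number of letters with
variables. -/
lemma potential_split {P Q R : GWord} {u v : List Sym} {l h : ℕ} :
    potential (Q ++ [.inr (l, [.inl (h, true)])]) +
      potential (P ++ .inr (l, u ++ .inl (h, false) :: v) :: R) <
        potential (P ++ .inr (l, u) :: (Q ++ .inr (l, v) :: R)) := by
  have : varLetters (Q ++ [.inr (l, [.inl (h, true)])]) +
      varLetters (P ++ .inr (l, u ++ .inl (h, false) :: v) :: R) ≤
        varLetters (P ++ .inr (l, u) :: (Q ++ .inr (l, v) :: R)) := by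
    simp only [varLetters, List.countP_append, List.countP_cons, List.countP_nil, letterVars_inr,
      exprVars_append, exprVars_inl_cons, exprVars_nil]
    by_cases hu : exprVars u = [] <;> by_cases hv : exprVars v = [] <;> simp [hu, hv] <;> omega
  simp only [potential, List.length_append, List.length_cons, List.length_nil]
  nlinarith [Nat.zero_le (Q.length * P.length), Nat.zero_le (Q.length * R.length)]

lemma potential_subst {P R : GWord} {u : List Sym} {l h : ℕ} (hu : exprVars u ≠ []) :
    potential (P ++ .inr (l, [.inl (h, true)]) :: R) < potential (P ++ .inr (l, u) :: R) := by
  simp only [potential, varLetters, List.countP_append, List.countP_cons, letterVars_inr,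
    exprVars_inl_cons, exprVars_nil, List.length_append, List.length_cons]
  simp [hu]

/-- The completeness step: given a solution, either two letters lie in a common coset, and cutting
between a closest such pair is possible, or every letter with variables is isolated and can be
replaced by its value. -/
lemma exists_branch {C : ℝ} (hC : IsPolygonConstant H X 1 1 C) {L : ℕ}
    (hT : N.TableComplete T Act (C * L)) {W : GWord} (hW : N.WordValid n Act W)
    (hL : W.length ≤ L) (h1 : N.gVal k W = 1) (hv : wordVars W ≠ []) :
    ∃ d, Branch T W d ∧ (∀ V ∈ d.1 ++ d.2, N.gVal k V = 1) ∧
      totalPotential d.1 < potential W ∧ ∀ V ∈ d.1, V.length ≤ L := by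
  let Conn : ℕ → Prop := fun m => ∃ l ∈ Act, ∃ lam, N.idx l = some lam ∧
    ∃ (P Q R : GWord) (u v : List Sym),
      W = P ++ .inr (l, u) :: (Q ++ .inr (l, v) :: R) ∧ N.gVal k Q ∈ H lam ∧ Q.length = m
  by_cases hconn : ∃ m, Conn m
  · classical
    -- Minimality of the length of `Q` excludes a letter inside `Q` in the same coset, so `Q⁻¹` is
    -- an isolated letter of the cycle.
    have hmin := fun m => Nat.find_min hconn (m := m)
    obtain ⟨l, hlA, lam, hl, P, Q, R, u, v, rfl, hQ, hQm⟩ := Nat.find_spec hconn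
    simp only [Naming.wordValid_append, Naming.wordValid_cons] at hW
    have hinv : (⟨N.gVal k Q, hQ⟩⁻¹ : H lam) * N.gVal k Q = 1 := by simp
    have hadm : ∀ Q₁ Q₂ e, Q = Q₁ ++ .inr (l, e) :: Q₂ → N.gVal k Q₁ ∉ H lam := by
      intro Q₁ Q₂ e he hmem
      refine hmin Q₁.length (by rw [← hQm, he]; simp) ⟨l, hlA, lam, hl, P, Q₁,
        Q₂ ++ .inr (l, v) :: R, u, e, by simp [he], hmem, rfl⟩
    have hlen : Q.length + 1 ≤ L := by
      simp only [List.length_append, List.length_cons] at hL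
      omega
    obtain ⟨j, hj, hj'⟩ := Naming.exists_elt hC hT hlA hl hW.2.2.1 hinv hadm hlen
    · refine ⟨_, .split hj, ?_, ?_, ?_⟩
      · have hj'' : (N.constVal lam j : G) = (N.gVal k Q)⁻¹ := by rw [hj']; rfl
        simp only [List.append_nil, List.mem_cons, List.not_mem_nil, or_false, forall_eq_or_imp,
          forall_eq, Naming.gVal_append, Naming.gVal_cons, Naming.letterVal_inr hl,
          Naming.gVal_nil, mul_one, Naming.exprVal_append, Naming.exprVal_cons,
          Naming.exprVal_nil, Naming.symVal, Bool.false_eq_true, if_true, if_false,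
          Subgroup.coe_mul, Subgroup.coe_inv, hj'', inv_inv, mul_inv_cancel, true_and] at h1 ⊢
        rw [← h1]
        group
      · simpa [totalPotential] using potential_split
      · simp only [List.length_append, List.length_cons] at hL
        simp
        omega
  · obtain ⟨P, l, u, R, rfl, hu⟩ : ∃ P l u R, W = P ++ .inr (l, u) :: R ∧ exprVars u ≠ [] := by
      obtain ⟨x, hx⟩ := List.exists_mem_of_ne_nil _ hv
      obtain ⟨g, hg, hxg⟩ := List.mem_flatMap.1 hx
      obtain ⟨P, R, rfl⟩ := List.append_of_mem hg
      rcases g with i | ⟨l, u⟩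
      · simp [letterVars] at hxg
      · exact ⟨P, l, u, R, rfl, List.ne_nil_of_mem hxg⟩
    simp only [Naming.wordValid_append, Naming.wordValid_cons] at hW
    obtain ⟨hP, ⟨lam, hl, hlu, hlA⟩, hR⟩ := hW
    simp only at hl hlA hlu
    have hlA := hlA hu
    simp only [Naming.gVal_append, Naming.gVal_cons, Naming.letterVal_inr hl] at h1
    have hrot : (N.exprVal lam k u : G) * N.gVal k (R ++ P) = 1 := by
      rw [Naming.gVal_append, ← mul_assoc]
      exact mul_eq_one_comm.1 h1
    -- The word is read cyclically, from behind `u`. If the letter `e` is found in `P`, the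
    -- complementary subword from `e` forward to `u` also has its value in `H lam`, because the
    -- whole word has value 1; so `e` and `u` are connected without wrapping around.
    have hadm : ∀ Q₁ Q₂ e, R ++ P = Q₁ ++ .inr (l, e) :: Q₂ → N.gVal k Q₁ ∉ H lam := by
      intro Q₁ Q₂ e he hmem
      rcases List.append_eq_append_iff.1 he with ⟨c, rfl, hc⟩ | ⟨c, rfl, hc⟩
      · refine hconn ⟨_, l, hlA, lam, hl, c, Q₂, R, e, u, by simp [hc], ?_, rfl⟩
        rw [hc] at h1
        simp only [Naming.gVal_append, Naming.gVal_cons, Naming.letterVal_inr hl] at h1 hmem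
        have h2 : N.gVal k Q₂ = (N.exprVal lam k e : G)⁻¹ *
            (N.gVal k R * N.gVal k c)⁻¹ * (N.exprVal lam k u : G)⁻¹ := by
          have h3 : N.gVal k Q₂ = (N.exprVal lam k e : G)⁻¹ * (N.gVal k c)⁻¹ *
            (N.gVal k c * (N.exprVal lam k e * N.gVal k Q₂) *
              (N.exprVal lam k u * N.gVal k R)) * (N.gVal k R)⁻¹ *
                (N.exprVal lam k u : G)⁻¹ := by group
          rw [h3, h1]
          group
        rw [h2]
        exact mul_mem (mul_mem (inv_mem (Subtype.mem _)) (inv_mem hmem))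
          (inv_mem (Subtype.mem _))
      · rcases c with _ | ⟨g, c⟩
        · rw [List.nil_append] at hc
          subst hc
          refine hconn ⟨_, l, hlA, lam, hl, [], Q₂, Q₁ ++ [], e, u, by simp, ?_, rfl⟩
          simp only [Naming.gVal_cons, Naming.letterVal_inr hl, List.append_nil] at h1 hmem
          have h2 : N.gVal k Q₂ = (N.exprVal lam k e : G)⁻¹ *
              (N.gVal k Q₁)⁻¹ * (N.exprVal lam k u : G)⁻¹ := by
            have h3 : N.gVal k Q₂ = (N.exprVal lam k e : G)⁻¹ *
              ((N.exprVal lam k e * N.gVal k Q₂) *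
                (N.exprVal lam k u * N.gVal k Q₁)) * (N.gVal k Q₁)⁻¹ *
                  (N.exprVal lam k u : G)⁻¹ := by group
            rw [h3, h1]
            group
          rw [h2]
          exact mul_mem (mul_mem (inv_mem (Subtype.mem _)) (inv_mem hmem))
            (inv_mem (Subtype.mem _))
        · simp only [List.cons_append, List.cons.injEq] at hc
          obtain ⟨rfl, -⟩ := hc
          exact hconn ⟨_, l, hlA, lam, hl, P, Q₁, c, u, e, rfl, hmem, rfl⟩
    have hlen : (R ++ P).length + 1 ≤ L := by
      simp only [List.length_append, List.length_cons] at hL ⊢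
      omega
    obtain ⟨j, hj, hj'⟩ := Naming.exists_elt hC hT hlA hl (Naming.wordValid_append.2 ⟨hR, hP⟩)
      hrot hadm hlen
    · refine ⟨_, .subst hj, ?_, ?_, ?_⟩
      · simp only [List.cons_append, List.nil_append, List.mem_cons, List.not_mem_nil, or_false,
          forall_eq_or_imp,
          forall_eq, Naming.gVal_append, Naming.gVal_cons, Naming.letterVal_inr hl,
          Naming.gVal_nil, mul_one, Naming.exprVal_append, Naming.exprVal_cons,
          Naming.exprVal_nil, Naming.symVal, Bool.false_eq_true, if_true, if_false, hj']
        exact ⟨h1, by simp⟩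
      · simpa [totalPotential] using potential_subst hu
      · simpa using hL

/-! ### Runs -/

lemma sysStep_nil (F : List GWord) : sysStep T ([], F) = [([], F)] := rfl

lemma sysStep_cons (W : GWord) (Ws F : List GWord) :
    sysStep T (W :: Ws, F) = if GWord.Done W then [(Ws, W :: F)] else
      (branches T W).map fun d => (d.1 ++ Ws, d.2 ++ F) := rfl

lemma sysRun_zero (S : List SysState) : sysRun T 0 S = S := rfl

lemma sysRun_succ (m : ℕ) (S : List SysState) :
    sysRun T (m + 1) S = (sysRun T m S).flatMap (sysStep T) := by
  rw [sysRun, Function.iterate_succ_apply']; rfl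

lemma sysRun_succ' (m : ℕ) (S : List SysState) :
    sysRun T (m + 1) S = sysRun T m (S.flatMap (sysStep T)) := by
  rw [sysRun, Function.iterate_succ_apply]; rfl

/-- The invariants of the states of a run that starts with the word `W₀`. -/
structure SysInv (N : Naming H X) (n : ℕ) (Act : Set ℕ) (W₀ : GWord) (s : SysState) : Prop where
  valid : ∀ W ∈ s.1 ++ s.2, N.WordValid n Act W
  done : ∀ W ∈ s.2, GWord.Done W
  vars : ((s.1 ++ s.2).flatMap wordVars).Perm (wordVars W₀)
  sound : ∀ k, (∀ W ∈ s.1 ++ s.2, N.gVal k W = 1) → N.gVal k W₀ = 1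

lemma SysInv.init {W₀ : GWord} (h : N.WordValid n Act W₀) : SysInv N n Act W₀ ([W₀], []) :=
  ⟨by simpa using h, by simp, by simp, by simp⟩

lemma SysInv.step (hT : N.TableValid T) {W₀ : GWord} {s s' : SysState}
    (h : SysInv N n Act W₀ s) (hs : s' ∈ sysStep T s) : SysInv N n Act W₀ s' := by
  obtain ⟨_ | ⟨W, Ws⟩, F⟩ := s
  · rw [sysStep_nil, List.mem_singleton] at hs
    rwa [hs]
  · obtain ⟨hv, hd, hp, hsd⟩ := h
    simp only at hv hd hp hsd
    rw [sysStep_cons] at hs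
    split_ifs at hs with hW
    · rw [List.mem_singleton] at hs
      subst hs
      refine ⟨fun V hV => hv V ?_, fun V hV => ?_, ?_, fun k hk => hsd k fun V hV => hk V ?_⟩
      · simp at hV ⊢; tauto
      · rcases List.mem_cons.1 hV with rfl | hV
        · exact hW
        · exact hd V hV
      · exact (List.Perm.flatMap_right _ List.perm_middle).trans hp
      · simp at hV ⊢; tauto
    · obtain ⟨d, hb, rfl⟩ := List.mem_map.1 hs
      rw [mem_branches] at hb
      refine ⟨fun V hV => ?_, fun V hV => ?_, ?_, fun k hk => hsd k fun V hV => ?_⟩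
      · simp only [List.mem_append] at hV
        have := hb.valid hT (hv W (by simp)) V
        have := hv V
        simp at *
        tauto
      · rcases List.mem_append.1 hV with hV | hV
        · exact hb.done V hV
        · exact hd V hV
      · refine List.Perm.trans ?_ hp
        have h1 := hb.vars_perm
        simp only [List.flatMap_append, List.cons_append, List.flatMap_cons,
          ← Multiset.coe_eq_coe, ← Multiset.coe_add] at h1 ⊢
        rw [← h1]
        abel
      · have h1 : N.gVal k W = 1 := hb.sound hT fun V hV => hk V (by simp at hV ⊢; tauto)
        have := hk V
        simp at *
        rcases hV with rfl | hV
        · exact h1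
        · tauto

lemma SysInv.run (hT : N.TableValid T) {W₀ : GWord} (h : N.WordValid n Act W₀) (m : ℕ)
    {s : SysState} (hs : s ∈ sysRun T m [([W₀], [])]) : SysInv N n Act W₀ s := by
  induction m generalizing s with
  | zero =>
    rw [sysRun_zero, List.mem_singleton] at hs
    rw [hs]
    exact SysInv.init h
  | succ m ih =>
    rw [sysRun_succ, List.mem_flatMap] at hs
    obtain ⟨s', hs', hss⟩ := hs
    exact (ih hs').step hT hss

lemma mem_sysRun_mono {m : ℕ} {S : List SysState} {s : SysState} (hs : s ∈ S) (h : s.1 = []) :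
    s ∈ sysRun T m S := by
  induction m with
  | zero => exact hs
  | succ m ih =>
    rw [sysRun_succ, List.mem_flatMap]
    refine ⟨s, ih, ?_⟩
    obtain ⟨_, F⟩ := s
    simp only at h
    subst h
    simp [sysStep_nil]

lemma sysRun_subset {m : ℕ} {S S' : List SysState} (h : S ⊆ S') :
    sysRun T m S ⊆ sysRun T m S' := by
  induction m generalizing S S' with
  | zero => exact h
  | succ m ih =>
    rw [sysRun_succ', sysRun_succ']
    refine ih fun s hs => ?_
    obtain ⟨t, ht, hst⟩ := List.mem_flatMap.1 hs
    exact List.mem_flatMap.2 ⟨t, h ht, hst⟩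

/-- A solution selects a branch at every step. Removing a finished word and branching both decrease
the total potential, so nothing is left to process after that many steps. -/
lemma exists_finished {C : ℝ} (hC : IsPolygonConstant H X 1 1 C) {L : ℕ}
    (hTV : N.TableValid T) (hT : N.TableComplete T Act (C * L)) {W₀ : GWord} {s : SysState}
    (hs : SysInv N n Act W₀ s) (hL : ∀ W ∈ s.1, W.length ≤ L)
    (h1 : ∀ W ∈ s.1 ++ s.2, N.gVal k W = 1) {m : ℕ} (hm : totalPotential s.1 ≤ m) :
    ∃ s' ∈ sysRun T m [s], s'.1 = [] ∧ ∀ W ∈ s'.2, N.gVal k W = 1 := by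
  induction m generalizing s with
  | zero =>
    obtain ⟨_ | ⟨W, Ws⟩, F⟩ := s
    · exact ⟨_, mem_sysRun_mono (List.mem_singleton_self _) rfl, rfl, by simpa using h1⟩
    · simp [totalPotential, potential] at hm
  | succ m ih =>
    obtain ⟨_ | ⟨W, Ws⟩, F⟩ := s
    · exact ⟨_, mem_sysRun_mono (List.mem_singleton_self _) rfl, rfl, by simpa using h1⟩
    · have key : ∃ s' ∈ sysStep T (W :: Ws, F), (∀ V ∈ s'.1, V.length ≤ L) ∧
          (∀ V ∈ s'.1 ++ s'.2, N.gVal k V = 1) ∧ totalPotential s'.1 ≤ m := by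
        simp only at hL h1 hm
        have hm' : potential W + totalPotential Ws ≤ m + 1 := by
          simpa [totalPotential] using hm
        rw [sysStep_cons]
        split_ifs with hW
        · refine ⟨_, List.mem_singleton_self _, fun V hV => hL V (by simp at hV ⊢; tauto),
            fun V hV => h1 V (by simp at hV ⊢; tauto), ?_⟩
          have : 0 < potential W := Nat.succ_pos _
          simp only
          omega
        · obtain ⟨d, hd, hd1, hdp, hdL⟩ := exists_branch hC hT (hs.valid W (by simp))
            (hL W (by simp)) (h1 W (by simp)) fun h => hW (.inl h)
          refine ⟨_, List.mem_map_of_mem (mem_branches.2 hd), fun V hV => ?_, fun V hV => ?_, ?_⟩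
          · rcases List.mem_append.1 hV with hV | hV
            · exact hdL V hV
            · exact hL V (by simp [hV])
          · have := hd1 V
            have := h1 V
            simp at *
            tauto
          · have : totalPotential (d.1 ++ Ws) = totalPotential d.1 + totalPotential Ws := by
              simp [totalPotential]
            simp only
            omega
      obtain ⟨s', hs', hL', h1', hm'⟩ := key
      obtain ⟨s'', hs'', h⟩ := ih (hs.step hTV hs') hL' h1' hm'
      refine ⟨s'', ?_, h⟩
      rw [sysRun_succ']
      exact sysRun_subset (by simpa using hs') hs''

end ExpEqs

namespace ExpEqs

/-! ### Output of the finished words -/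

def constLetters (g : GLetter) : List (LetterName × Bool) :=
  Sum.elim (fun i => [(.inl i, true)])
    (fun q => q.2.flatMap fun s => Sum.elim (fun p => [(.inr (q.1, p.1), p.2)]) (fun _ => []) s) g

/-- Names of factors of exponential equations. -/
abbrev TermName := List (ℕ × Bool) × (ℕ × ℕ)

/-- Collect the constants in front of each power, and those after the last one. -/
def collect (e : List Sym) : List TermName × List (ℕ × Bool) :=
  e.foldl (fun a s => Sum.elim (fun p => (a.1, a.2 ++ [p])) (fun q => (a.1 ++ [(a.2, q)], [])) s)
    ([], [])

/-- Move the constants after the last power to the front. -/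
def rotateTerms (a : List TermName × List (ℕ × Bool)) : List TermName :=
  a.1.casesOn [] fun t ts => (a.2 ++ t.1, t.2) :: ts

/-- The values `.inr []` are placeholders: a finished word with variables is a single letter over a
subgroup. -/
def emit (W : GWord) : PeriphEqName :=
  if wordVars W = [] then .inr (W.flatMap constLetters)
  else W.casesOn (.inr []) fun g _ =>
    Sum.elim (fun _ => .inr []) (fun q => .inl (q.1, rotateTerms (collect q.2))) g

def toGLetter (p : LetterName) : GLetter :=
  Sum.elim (fun i => .inl i) (fun q => .inr (q.1, [.inl (q.2, true)])) p

def initBlock (v : ℕ) (t : List LetterName × (ℕ × ℕ)) : GWord :=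
  t.1.map toGLetter ++ [.inr (t.2.1, [.inr (t.2.2, v)])]

/-- The left-hand side of the equation with the name `E`. -/
def initWord (E : EquationName) : GWord :=
  (List.range E.length).flatMap fun v => initBlock v (E.getD v ([], (0, 0)))

/-- The systems of words found from `E` by means of the table `T`. -/
def finishedSystems (T : List (ℕ × ℕ)) (E : EquationName) : List (List GWord) :=
  -- The initial word has length `E.len` and at most as many letters with variables, so this number
  -- bounds its potential. States that are still unfinished are discarded.
  (sysRun T (2 * (E.len * E.len) + E.len + 1) [([initWord E], [])]).filterMap
    fun s => if s.1 = [] then some s.2 else none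

def writeDisjunction (T : List (ℕ × ℕ)) (E : EquationName) : DisjunctionName :=
  (finishedSystems T E).map fun S => S.map emit

/-- The assignment that is zero at all but the first `n` variables. -/
def extend {n : ℕ} (k : Fin n → ℤ) (v : ℕ) : ℤ := if h : v < n then k ⟨v, h⟩ else 0

lemma collect_append (e : List Sym) (s : Sym) : collect (e ++ [s]) =
    Sum.elim (fun p => ((collect e).1, (collect e).2 ++ [p]))
      (fun q => ((collect e).1 ++ [((collect e).2, q)], [])) s := by
  simp [collect, List.foldl_append]

variable {G : Type*} [Group G] {Λ : Type*} {H : Λ → Subgroup G} {X : Set G} {N : Naming H X}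
  {n : ℕ} {Act : Set ℕ} {T : List (ℕ × ℕ)}

namespace Naming

lemma namesProduct_nil {ν K : Type*} [Group K] (R : ν → K → Prop) : NamesProduct R [] 1 :=
  ⟨[], .nil, rfl⟩

lemma NamesProduct.append {ν K : Type*} [Group K] {R : ν → K → Prop} {v w : List (ν × Bool)}
    {a b : K} (hv : NamesProduct R v a) (hw : NamesProduct R w b) :
    NamesProduct R (v ++ w) (a * b) := by
  obtain ⟨v', h1, rfl⟩ := hv
  obtain ⟨w', h2, rfl⟩ := hw
  exact ⟨v' ++ w', List.rel_append h1 h2, by simp⟩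

lemma namesProduct_singleton {ν K : Type*} [Group K] {R : ν → K → Prop} {p : ν × Bool} {c : K}
    (h : R p.1 c) : NamesProduct R [p] (if p.2 then c else c⁻¹) :=
  ⟨[_], .cons ⟨c, h, rfl⟩ .nil, by simp⟩

def NamesTerm (N : Naming H X) (n : ℕ) (lam : Λ) (t : TermName)
    (s : ExpTerm (H lam) (Fin n)) : Prop :=
  NamesProduct (fun j c => N.elt lam j = some c) t.1 s.coef ∧
    N.elt lam t.2.1 = some s.base ∧ t.2.2 = (s.var : ℕ)

lemma elt_eq_constVal {lam : Λ} {j : ℕ} (h : (N.elt lam j).isSome) :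
    N.elt lam j = some (N.constVal lam j) := by
  obtain ⟨c, hc⟩ := Option.isSome_iff_exists.1 h
  simp [constVal, hc]

/-- The fold appends on the right, hence the induction from the right; `c` is the constant that
waits for the next power. -/
lemma collect_spec {lam : Λ} {e : List Sym} (he : ∀ s ∈ e, N.SymValid n lam s) :
    ∃ (es : List (ExpTerm (H lam) (Fin n))) (c : H lam),
      List.Forall₂ (N.NamesTerm n lam) (collect e).1 es ∧
      NamesProduct (fun j c => N.elt lam j = some c) (collect e).2 c ∧
      es.map (fun t => (t.var : ℕ)) = exprVars e ∧
      ∀ k : Fin n → ℤ, N.exprVal lam (extend k) e =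
        (es.map fun t => t.coef * t.base ^ k t.var).prod * c := by
  induction e using List.reverseRecOn with
  | nil => exact ⟨[], 1, .nil, namesProduct_nil _, rfl, by simp⟩
  | append_singleton e s ih =>
    obtain ⟨es, c, h1, h2, h3, h4⟩ := ih fun t ht => he t (by simp [ht])
    have hs := he s (by simp)
    rw [collect_append]
    rcases s with p | q
    · refine ⟨es, c * (if p.2 then N.constVal lam p.1 else (N.constVal lam p.1)⁻¹), h1,
        h2.append (namesProduct_singleton (elt_eq_constVal hs)), ?_, fun k => ?_⟩
      · simp [exprVars_append, h3]
      · rw [exprVal_append, h4]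
        simp [symVal, mul_assoc]
    · refine ⟨es ++ [⟨c, N.constVal lam q.1, ⟨q.2, hs.2⟩⟩], 1,
        List.rel_append h1 (.cons ⟨h2, elt_eq_constVal hs.1, rfl⟩ .nil), namesProduct_nil _,
        ?_, fun k => ?_⟩
      · simp [h3, exprVars, symVars]
      · rw [exprVal_append, h4]
        simp [symVal, extend, hs.2, mul_assoc]

/-- Description of the equation that is written for a finished word. -/
def EmitSpec (N : Naming H X) (n : ℕ) (W : GWord) (E : PeriphEq H n) : Prop :=
  N.NamesPeriphEq (emit W) E ∧ E.vars.map Fin.val = wordVars W ∧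
    ∀ k : Fin n → ℤ, E.IsSolution k ↔ N.gVal (extend k) W = 1

lemma gVal_congr_of_no_vars {W : GWord} (hW : wordVars W = []) (k k' : ℕ → ℤ) :
    N.gVal k W = N.gVal k' W := by
  refine congrArg List.prod (List.map_congr_left fun g hg => ?_)
  have hg' : letterVars g = [] := List.flatMap_eq_nil_iff.1 hW g hg
  rcases g with i | ⟨l, e⟩
  · rfl
  · simp only [letterVal]
    cases N.idx l with
    | none => rfl
    | some lam =>
      refine congrArg Subtype.val (congrArg List.prod (List.map_congr_left fun s hs => ?_))
      have : symVars s = [] := List.flatMap_eq_nil_iff.1 hg' s hs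
      rcases s with p | q
      · rfl
      · simp [symVars] at this

lemma namesProduct_constLetters {W : GWord} (hW : N.WordValid n Act W) (h : wordVars W = [])
    (k : ℕ → ℤ) :
    NamesProduct (fun p c => ∃ x, N.NamesLetter p x ∧ x.val = c) (W.flatMap constLetters)
      (N.gVal k W) := by
  induction W with
  | nil => exact namesProduct_nil _
  | cons g W ih =>
    rw [wordValid_cons] at hW
    rw [wordVars_cons, List.append_eq_nil_iff] at h
    rw [List.flatMap_cons, gVal_cons]
    refine NamesProduct.append ?_ (ih hW.2 h.2)
    rcases g with i | ⟨l, e⟩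
    · obtain ⟨x, hx⟩ := Option.isSome_iff_exists.1 hW.1
      have := namesProduct_singleton (R := fun p c => ∃ x, N.NamesLetter p x ∧ x.val = c)
        (p := (.inl i, true)) (c := (x : G)) ⟨.inl x, hx, rfl⟩
      simpa [letterVal, hx, constLetters] using this
    · obtain ⟨lam, hl, he, -⟩ := hW.1
      have h1 := h.1
      rw [letterVal_inr hl]
      simp only [letterVars_inr] at h1 he hl
      simp only [constLetters, Sum.elim_inr]
      clear hW h ih
      induction e with
      | nil => exact namesProduct_nil _
      | cons s e ih =>
        rcases s with p | q
        · rw [List.flatMap_cons, exprVal_cons, Subgroup.coe_mul]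
          refine NamesProduct.append ?_ (ih (fun t ht => he t (by simp [ht])) (by simpa using h1))
          have := namesProduct_singleton (R := fun p c => ∃ x, N.NamesLetter p x ∧ x.val = c)
            (p := (.inr (l, p.1), p.2)) (c := (N.constVal lam p.1 : G))
            ⟨.inr ⟨lam, N.constVal lam p.1⟩, ⟨hl, elt_eq_constVal (he (.inl p) (by simp))⟩, rfl⟩
          simp only [symVal, Sum.elim_inl]
          convert this using 1
          split_ifs <;> simp
        · simp [exprVars, symVars] at h1

lemma exists_emitSpec {W : GWord} (hW : N.WordValid n Act W) (hd : GWord.Done W) :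
    ∃ E, N.EmitSpec n W E := by
  by_cases h : wordVars W = []
  · refine ⟨.triv (N.gVal 0 W), ?_, by simp [PeriphEq.vars, h], fun k => ?_⟩
    · rw [emit, if_pos h]
      exact namesProduct_constLetters hW h 0
    · rw [gVal_congr_of_no_vars h (extend k) 0]
      rfl
  · obtain ⟨l, e, rfl⟩ : ∃ l e, W = [.inr (l, e)] := by
      rcases hd with hd | hd
      · exact absurd hd h
      · rcases W with _ | ⟨g, _ | ⟨g', W⟩⟩
        · simp at h
        · rcases g with i | ⟨l, e⟩
          · simp [wordVars, letterVars] at h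
          · exact ⟨l, e, rfl⟩
        · simp at hd
    obtain ⟨lam, hl, he, -⟩ := hW (.inr (l, e)) (by simp)
    simp only at hl he
    have hve : wordVars [.inr (l, e)] = exprVars e := by simp [wordVars_cons]
    obtain ⟨es, c, h1, h2, h3, h4⟩ := collect_spec he
    rcases es with _ | ⟨s, es⟩
    · rw [hve, ← h3] at h
      simp at h
    generalize hts : (collect e).1 = ts at h1
    rcases h1 with _ | ⟨ht, h1⟩
    rename_i t ts
    refine ⟨.exp lam (⟨c * s.coef, s.base, s.var⟩ :: es), ?_, ?_, fun k => ?_⟩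
    · rw [emit, if_neg h]
      simp only [Sum.elim_inr, rotateTerms, hts]
      exact ⟨hl, .cons ⟨h2.append ht.1, ht.2⟩ h1⟩
    · rw [hve, ← h3]
      simp [PeriphEq.vars]
    · simp only [gVal_cons, letterVal_inr hl, gVal_nil, mul_one, h4]
      rw [PeriphEq.IsSolution, ExpEquation.IsSolution, OneMemClass.coe_eq_one]
      simp only [List.map_cons, List.prod_cons, mul_assoc]
      -- Moving the last constant to the front conjugates the left-hand side and does not change the
      -- solutions.
      rw [← mul_eq_one_comm]
      simp only [mul_assoc]

end Naming

/-! ### The initial word and correctness of the output. -/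

lemma initWord_eq (E : EquationName) :
    initWord E = (List.finRange E.length).flatMap fun i : Fin E.length => initBlock i (E.get i) := by
  rw [initWord, ← List.map_coe_finRange_eq_range, List.flatMap_map]
  refine List.flatMap_congr fun i _ => ?_
  simp

lemma length_initWord (E : EquationName) : (initWord E).length = E.len := by
  have : (initWord E).length =
      (((List.finRange E.length).map E.get).map fun t => t.1.length + 1).sum := by
    rw [initWord_eq, List.length_flatMap, List.map_map]
    refine congrArg List.sum (List.map_congr_left fun i _ => ?_)
    simp [initBlock]
  rw [this, List.map_get_finRange, EquationName.len]
  clear this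
  induction E with
  | nil => rfl
  | cons t E ih =>
    simp only [List.map_cons, List.sum_cons, List.length_cons, ih]
    omega

lemma wordVars_initWord (E : EquationName) : wordVars (initWord E) = List.range E.length := by
  have h : ∀ l : List LetterName, wordVars (l.map toGLetter) = [] := by
    intro l
    induction l with
    | nil => rfl
    | cons p l ih =>
      rw [List.map_cons, wordVars_cons, ih]
      rcases p with i | q <;> simp [toGLetter, letterVars]
  rw [initWord_eq, wordVars, List.flatMap_assoc]
  rw [← List.map_coe_finRange_eq_range, List.map_eq_flatMap]
  refine List.flatMap_congr fun i _ => ?_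
  change wordVars (initBlock _ _) = _
  rw [initBlock, wordVars_append, h]
  simp [wordVars_cons, exprVars, symVars]

namespace Naming

lemma toGLetter_spec (k : ℕ → ℤ) {p : LetterName} {x : Letter H X} (h : N.NamesLetter p x) :
    N.LetterValid n Act (toGLetter p) ∧ N.letterVal k (toGLetter p) = x.val := by
  rcases p with i | q <;> rcases x with x | ⟨lam, y⟩
  · simp only [NamesLetter] at h
    exact ⟨by simp [toGLetter, LetterValid, h], by simp [toGLetter, letterVal, h, Letter.val]⟩
  · exact h.elim
  · exact h.elim
  · obtain ⟨h1, h2⟩ := h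
    simp only at h1 h2
    refine ⟨⟨lam, h1, by simp [SymValid, h2], by simp⟩, ?_⟩
    simp only [toGLetter, Sum.elim_inr]
    rw [letterVal_inr h1]
    simp [symVal, constVal, h2]

lemma initBlock_spec (k : ℕ → ℤ) {v : ℕ} (hv : v < n) {t : List LetterName × (ℕ × ℕ)}
    {A : List (Letter H X)} (hA : List.Forall₂ N.NamesLetter t.1 A) {g : Σ lam, H lam}
    (hg : N.NamesElt t.2 g) (ht : t.2.1 ∈ Act) :
    N.WordValid n Act (initBlock v t) ∧
      N.gVal k (initBlock v t) = wordVal A * (g.2 : G) ^ k v := by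
  have h1 : N.WordValid n Act (t.1.map toGLetter) ∧
      N.gVal k (t.1.map toGLetter) = wordVal A := by
    generalize t.1 = w at hA
    induction hA with
    | nil => exact ⟨wordValid_nil, rfl⟩
    | cons h _ ih =>
      obtain ⟨a, b⟩ := toGLetter_spec (n := n) (Act := Act) k h
      rw [List.map_cons, wordValid_cons, gVal_cons, wordVal_cons, b, ih.2]
      exact ⟨⟨a, ih.1⟩, rfl⟩
  obtain ⟨hl, he⟩ := hg
  constructor
  · rw [initBlock, wordValid_append, wordValid_cons]
    exact ⟨h1.1, ⟨g.1, hl, by simp [SymValid, he, hv], fun _ => ht⟩, wordValid_nil⟩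
  · rw [initBlock, gVal_append, h1.2, gVal_cons, letterVal_inr hl]
    simp [symVal, constVal, he]

lemma initWord_spec {E : EquationName} {A : Fin E.length → List (Letter H X)}
    {g : Fin E.length → Σ lam, H lam} (hE : N.NamesEquation E A g) :
    N.WordValid E.length {l | ∃ i, l = (E.get i).2.1} (initWord E) ∧
      ∀ k : Fin E.length → ℤ, N.gVal (extend k) (initWord E) = 1 ↔
        (expEquation (fun i => wordVal (A i)) fun i => ((g i).2 : G)).IsSolution k := by
  have hb := fun (k : ℕ → ℤ) (i : Fin E.length) =>
    initBlock_spec (Act := {l | ∃ i, l = (E.get i).2.1}) k i.2 (hE i).1 (hE i).2 ⟨i, rfl⟩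
  rw [initWord_eq]
  constructor
  · intro x hx
    obtain ⟨i, -, hi⟩ := List.mem_flatMap.1 hx
    exact (hb 0 i).1 x hi
  · intro k
    have h1 : N.gVal (extend k) ((List.finRange E.length).flatMap fun i : Fin E.length =>
        initBlock i (E.get i)) =
          ((List.finRange E.length).map fun i : Fin E.length =>
            N.gVal (extend k) (initBlock i (E.get i))).prod := by
      induction List.finRange E.length with
      | nil => rfl
      | cons i l ih => rw [List.flatMap_cons, gVal_append, ih, List.map_cons, List.prod_cons]
    rw [h1, ExpEquation.IsSolution, expEquation, List.map_ofFn, List.ofFn_eq_map]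
    refine Eq.congr_left (congrArg List.prod (List.map_congr_left fun i _ => ?_))
    rw [(hb (extend k) i).2]
    simp [extend]

/-- Correctness of the written disjunction. -/
theorem writeDisjunction_spec {C : ℝ} (hC : IsPolygonConstant H X 1 1 C) {E : EquationName}
    {A : Fin E.length → List (Letter H X)} {g : Fin E.length → Σ lam, H lam}
    (hE : N.NamesEquation E A g) (hTV : N.TableValid T)
    (hT : N.TableComplete T {l | ∃ i, l = (E.get i).2.1} (C * E.len)) :
    ∃ Φ : Disjunction H E.length, N.NamesDisjunction (writeDisjunction T E) Φ ∧
      Φ.DisjointVars ∧ ∀ k : Fin E.length → ℤ,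
        (expEquation (fun i => wordVal (A i)) fun i => ((g i).2 : G)).IsSolution k ↔
          Φ.IsSolution k := by
  obtain ⟨hval, hsol⟩ := initWord_spec hE
  set Act : Set ℕ := {l | ∃ i, l = (E.get i).2.1} with hAct
  classical
  -- The value `.triv 1` is never met, since all words of finished systems are valid and done.
  let f : GWord → PeriphEq H E.length := fun W =>
    if h : ∃ F, N.EmitSpec E.length W F then h.choose else .triv 1
  have hf : ∀ W, N.WordValid E.length Act W → GWord.Done W → N.EmitSpec E.length W (f W) := by
    intro W h1 h2
    have h := exists_emitSpec h1 h2
    simp only [f, dif_pos h]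
    exact h.choose_spec
  have hinv : ∀ S ∈ finishedSystems T E, SysInv N E.length Act (initWord E) ([], S) := by
    intro S hS
    obtain ⟨⟨P, F⟩, hs, h⟩ := List.mem_filterMap.1 hS
    simp only [Option.ite_none_right_eq_some, Option.some.injEq] at h
    obtain ⟨rfl, rfl⟩ := h
    exact SysInv.run hTV hval _ hs
  have hspec : ∀ S ∈ finishedSystems T E, ∀ W ∈ S, N.EmitSpec E.length W (f W) :=
    fun S hS W hW => hf W ((hinv S hS).valid W (by simpa using hW)) ((hinv S hS).done W hW)
  refine ⟨(finishedSystems T E).map fun S => S.map f, ?_, ?_, fun k => ?_⟩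
  · refine List.forall₂_map_left_iff.2 (List.forall₂_map_right_iff.2
      (List.forall₂_same.2 fun S hS => ?_))
    exact List.forall₂_map_left_iff.2 (List.forall₂_map_right_iff.2
      (List.forall₂_same.2 fun W hW => (hspec S hS W hW).1))
  · intro S' hS'
    obtain ⟨S, hS, rfl⟩ := List.mem_map.1 hS'
    -- The occurrences of variables in a system are a permutation of those in the initial word,
    -- where each variable occurs once.
    have hnd : (S.flatMap wordVars).Nodup := by
      have := (hinv S hS).vars
      rw [List.nil_append] at this
      rw [this.nodup_iff, wordVars_initWord]
      exact List.nodup_range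
    rw [List.nodup_flatMap] at hnd
    constructor
    · intro F hF
      obtain ⟨W, hW, rfl⟩ := List.mem_map.1 hF
      have := hnd.1 W hW
      rw [← (hspec S hS W hW).2.1] at this
      exact this.of_map _
    · rw [List.pairwise_map]
      refine hnd.2.imp_of_mem fun {W W'} hW hW' hd => ?_
      simp only [Function.onFun] at hd
      rw [← (hspec S hS W hW).2.1, ← (hspec S hS W' hW').2.1] at hd
      exact fun x hx hx' => hd (List.mem_map_of_mem hx) (List.mem_map_of_mem hx')
  · rw [← hsol]
    have hiff : ∀ S ∈ finishedSystems T E,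
        (∀ F ∈ S.map f, F.IsSolution k) ↔ ∀ W ∈ S, N.gVal (extend k) W = 1 := by
      intro S hS
      rw [List.forall_mem_map]
      exact forall₂_congr fun W hW => (hspec S hS W hW).2.2 k
    constructor
    · intro h
      obtain ⟨⟨P, F⟩, hs, hP, hF⟩ := exists_finished hC hTV hT (SysInv.init hval)
        (fun W hW => by
          rw [List.mem_singleton.1 hW, length_initWord])
        (k := extend k) (by simpa using h) (m := 2 * (E.len * E.len) + E.len + 1) (by
          simp only [totalPotential, List.map_cons, List.map_nil, List.sum_cons, List.sum_nil,
            potential, length_initWord, add_zero]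
          have : varLetters (initWord E) ≤ (initWord E).length := List.countP_le_length
          rw [length_initWord] at this
          nlinarith)
      simp only at hP
      subst hP
      have hmem : F ∈ finishedSystems T E := List.mem_filterMap.2 ⟨_, hs, by simp⟩
      exact ⟨F.map f, List.mem_map_of_mem hmem, (hiff F hmem).2 hF⟩
    · rintro ⟨S', hS', h⟩
      obtain ⟨S, hS, rfl⟩ := List.mem_map.1 hS'
      exact (hinv S hS).sound _ (by simpa using (hiff S hS).1 h)

end Naming

end ExpEqs

namespace ExpEqs

/-! ### Computability -/

section Primrec

variable {α β γ σ : Type*} [Primcodable α] [Primcodable β] [Primcodable γ] [Primcodable σ]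

lemma primrec_cons {f : α → β} {g : α → List β} (hf : Primrec f) (hg : Primrec g) :
    Primrec fun a => f a :: g a := Primrec.list_cons.comp hf hg

lemma primrec_append {f g : α → List β} (hf : Primrec f) (hg : Primrec g) :
    Primrec fun a => f a ++ g a := Primrec.list_append.comp hf hg

lemma primrec_singleton {f : α → β} (hf : Primrec f) : Primrec fun a => [f a] :=
  primrec_cons hf (.const [])

lemma primrec_sumElim {f : α → β ⊕ γ} {g : α → β → σ} {h : α → γ → σ} (hf : Primrec f)
    (hg : Primrec fun p : α × β => g p.1 p.2) (hh : Primrec fun p : α × γ => h p.1 p.2) :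
    Primrec fun a => Sum.elim (g a) (h a) (f a) :=
  (Primrec.sumCasesOn hf hg.to₂ hh.to₂).of_eq fun a => by cases f a <;> rfl

lemma primrec_inl {f : α → β} (hf : Primrec f) : Primrec fun a => (Sum.inl (f a) : β ⊕ γ) :=
  Primrec.sumInl.comp hf

lemma primrec_inr {f : α → γ} (hf : Primrec f) : Primrec fun a => (Sum.inr (f a) : β ⊕ γ) :=
  Primrec.sumInr.comp hf

lemma primrec_flatMap {f : α → List β} {g : α → β → List σ} (hf : Primrec f)
    (hg : Primrec fun p : α × β => g p.1 p.2) : Primrec fun a => (f a).flatMap (g a) :=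
  Primrec.list_flatMap hf hg.to₂

lemma primrec_map {f : α → List β} {g : α → β → σ} (hf : Primrec f)
    (hg : Primrec fun p : α × β => g p.1 p.2) : Primrec fun a => (f a).map (g a) :=
  Primrec.list_map hf hg.to₂

lemma primrec_filterMap {f : α → List β} {g : α → β → Option σ} (hf : Primrec f)
    (hg : Primrec fun p : α × β => g p.1 p.2) : Primrec fun a => (f a).filterMap (g a) :=
  Primrec.listFilterMap hf hg.to₂

lemma primrec_bind {f : α → Option β} {g : α → β → Option σ} (hf : Primrec f)
    (hg : Primrec fun p : α × β => g p.1 p.2) : Primrec fun a => (f a).bind (g a) :=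
  Primrec.option_bind hf hg.to₂

lemma primrec_optionMap {f : α → Option β} {g : α → β → σ} (hf : Primrec f)
    (hg : Primrec fun p : α × β => g p.1 p.2) : Primrec fun a => (f a).map (g a) :=
  Primrec.option_map hf hg.to₂

end Primrec

open Primrec

lemma primrec_symVars : Primrec symVars :=
  primrec_sumElim (f := id) .id (.const []) (primrec_singleton (snd.comp snd))

lemma primrec_exprVars : Primrec exprVars := primrec_flatMap .id (primrec_symVars.comp snd)

lemma primrec_letterVars : Primrec letterVars :=
  primrec_sumElim (f := id) .id (.const []) (primrec_exprVars.comp (snd.comp snd))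

lemma primrec_wordVars : Primrec wordVars := primrec_flatMap .id (primrec_letterVars.comp snd)

lemma primrec_exprAt : Primrec fun x : GWord × (ℕ × ℕ) => exprAt x.1 x.2.1 x.2.2 :=
  primrec_bind (list_getElem?.comp fst (fst.comp snd))
    (primrec_sumElim snd (.const none)
      (ite (Primrec.eq.comp (fst.comp snd) (snd.comp (snd.comp (fst.comp fst))))
        (option_some.comp (snd.comp snd)) (.const none)))

lemma primrec_splitAt :
    Primrec fun x : (GWord × (ℕ × ℕ)) × (ℕ × ℕ) => splitAt x.1.1 x.1.2 x.2.1 x.2.2 := by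
  refine ite (nat_lt.comp (fst.comp snd) (snd.comp snd)) (primrec_bind (primrec_exprAt.comp
    (.pair (fst.comp fst) (.pair (fst.comp snd) (fst.comp (snd.comp fst)))))
    (primrec_optionMap (primrec_exprAt.comp (.pair (fst.comp (fst.comp fst))
      (.pair (snd.comp (snd.comp fst)) (fst.comp (snd.comp (fst.comp fst)))))) ?_)) (.const none)
  -- the context is `((((W, p), (i, j)), u), v)`
  let Γ := ((((GWord × (ℕ × ℕ)) × (ℕ × ℕ)) × List Sym) × List Sym)
  have hx : Primrec fun y : Γ => y.1.1 := fst.comp fst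
  have hW : Primrec fun y : Γ => y.1.1.1.1 := fst.comp (fst.comp hx)
  have hp : Primrec fun y : Γ => y.1.1.1.2 := snd.comp (fst.comp hx)
  have hi : Primrec fun y : Γ => y.1.1.2.1 := fst.comp (snd.comp hx)
  have hj : Primrec fun y : Γ => y.1.1.2.2 := snd.comp (snd.comp hx)
  have hu : Primrec fun y : Γ => y.1.2 := snd.comp fst
  have hv : Primrec fun y : Γ => y.2 := snd
  refine .pair (primrec_cons ?_ (primrec_singleton ?_)) (.const [])
  · exact primrec_append (list_drop.comp (succ.comp hi) (list_take.comp hj hW))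
      (primrec_singleton (primrec_inr (.pair (fst.comp hp)
        (primrec_singleton (primrec_inl (.pair (snd.comp hp) (.const true)))))))
  · exact primrec_append (list_take.comp hi hW)
      (primrec_cons (primrec_inr (.pair (fst.comp hp) (primrec_append hu
        (primrec_cons (primrec_inl (.pair (snd.comp hp) (.const false))) hv))))
          (list_drop.comp (succ.comp hj) hW))

lemma primrec_substAt :
    Primrec fun x : (GWord × (ℕ × ℕ)) × ℕ => substAt x.1.1 x.1.2 x.2 := by
  refine primrec_optionMap (primrec_exprAt.comp
    (.pair (fst.comp fst) (.pair snd (fst.comp (snd.comp fst))))) ?_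
  let Γ := ((GWord × (ℕ × ℕ)) × ℕ) × List Sym
  have hW : Primrec fun y : Γ => y.1.1.1 := fst.comp (fst.comp fst)
  have hp : Primrec fun y : Γ => y.1.1.2 := snd.comp (fst.comp fst)
  have hi : Primrec fun y : Γ => y.1.2 := snd.comp fst
  have hu : Primrec fun y : Γ => y.2 := snd
  refine .pair (primrec_singleton ?_) (primrec_singleton (primrec_singleton ?_))
  · exact primrec_append (list_take.comp hi hW)
      (primrec_cons (primrec_inr (.pair (fst.comp hp)
        (primrec_singleton (primrec_inl (.pair (snd.comp hp) (.const true))))))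
          (list_drop.comp (succ.comp hi) hW))
  · exact primrec_inr (.pair (fst.comp hp) (primrec_append hu
        (primrec_singleton (primrec_inl (.pair (snd.comp hp) (.const false))))))

lemma primrec_branches : Primrec fun x : List (ℕ × ℕ) × GWord => branches x.1 x.2 := by
  refine primrec_flatMap fst (primrec_flatMap (list_range.comp (list_length.comp (snd.comp fst)))
    (primrec_append (optionToList.comp (primrec_substAt.comp (.pair (.pair (snd.comp (fst.comp fst))
      (snd.comp fst)) snd))) (primrec_filterMap (list_range.comp (list_length.comp
        (snd.comp (fst.comp fst)))) (primrec_splitAt.comp (.pair (.pair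
          (snd.comp (fst.comp (fst.comp fst))) (snd.comp (fst.comp fst)))
            (.pair (snd.comp fst) snd))))))

lemma primrecPred_done : PrimrecPred GWord.Done :=
  (Primrec.eq.comp primrec_wordVars (.const [])).or
    (nat_le.comp (f := fun W : GWord => W.length) (g := fun _ => 1) list_length (.const 1))

lemma primrec_sysStep : Primrec fun x : List (ℕ × ℕ) × SysState => sysStep x.1 x.2 := by
  let Γ := (List (ℕ × ℕ) × SysState) × (GWord × List GWord)
  have hW : Primrec fun y : Γ => y.2.1 := fst.comp snd
  have hWs : Primrec fun y : Γ => y.2.2 := snd.comp snd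
  have hF : Primrec fun y : Γ => y.1.2.2 := snd.comp (snd.comp fst)
  have hT : Primrec fun y : Γ => y.1.1 := fst.comp fst
  have h : Primrec fun y : Γ => if GWord.Done y.2.1 then [((y.2.2, y.2.1 :: y.1.2.2) : SysState)]
      else (branches y.1.1 y.2.1).map fun d => (d.1 ++ y.2.2, d.2 ++ y.1.2.2) :=
    ite (primrecPred_done.comp hW) (primrec_singleton (.pair hWs (primrec_cons hW hF)))
      (primrec_map (primrec_branches.comp (.pair hT hW))
        (.pair (primrec_append (fst.comp snd) (hWs.comp fst))
          (primrec_append (snd.comp snd) (hF.comp fst))))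
  exact list_casesOn (f := fun x : List (ℕ × ℕ) × SysState => x.2.1) (fst.comp snd)
    (primrec_singleton snd) h.to₂

lemma primrec_len : Primrec EquationName.len := by
  refine nat_add.comp list_length ?_
  exact (list_foldr (f := fun E : EquationName => E) (g := fun _ => 0)
    (h := fun _ p => p.1.1.length + p.2) .id (.const 0) (Primrec.to₂ (nat_add.comp
      (list_length.comp (fst.comp (fst.comp snd))) (snd.comp snd)))).of_eq fun E => by
    induction E with
    | nil => rfl
    | cons t E ih => simp [ih]

lemma primrec_toGLetter : Primrec toGLetter :=
  primrec_sumElim (f := id) .id (primrec_inl snd) (primrec_inr (.pair (fst.comp snd)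
    (primrec_singleton (primrec_inl (.pair (snd.comp snd) (.const true))))))

lemma primrec_initWord : Primrec initWord := by
  refine primrec_flatMap (list_range.comp list_length) ?_
  have ht : Primrec fun y : EquationName × ℕ => y.1.getD y.2 ([], (0, 0)) :=
    (list_getD ([], (0, 0))).comp fst snd
  exact primrec_append (primrec_map (fst.comp ht) (primrec_toGLetter.comp snd))
    (primrec_singleton (primrec_inr (.pair (fst.comp (snd.comp ht)) (primrec_singleton
      (primrec_inr (.pair (snd.comp (snd.comp ht)) snd))))))

lemma primrec_constLetters : Primrec constLetters :=
  primrec_sumElim (f := id) .id (primrec_singleton (.pair (primrec_inl snd) (.const true)))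
    (primrec_flatMap (snd.comp snd) (primrec_sumElim snd (primrec_singleton (.pair
      (primrec_inr (.pair (fst.comp (snd.comp (fst.comp fst))) (fst.comp snd)))
        (snd.comp snd))) (.const [])))

lemma primrec_collect : Primrec collect := by
  let Γ := List Sym × ((List TermName × List (ℕ × Bool)) × Sym)
  have h1 : Primrec fun y : Γ => y.2.1.1 := fst.comp (fst.comp snd)
  have h2 : Primrec fun y : Γ => y.2.1.2 := snd.comp (fst.comp snd)
  have h3 : Primrec fun y : Γ => y.2.2 := snd.comp snd
  have h : Primrec fun y : Γ => Sum.elim (fun q => (y.2.1.1, y.2.1.2 ++ [q]))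
      (fun q => (y.2.1.1 ++ [(y.2.1.2, q)], [])) y.2.2 :=
    primrec_sumElim (g := fun (y : Γ) q => (y.2.1.1, y.2.1.2 ++ [q]))
      (h := fun (y : Γ) q => (y.2.1.1 ++ [(y.2.1.2, q)], ([] : List (ℕ × Bool)))) h3
      (.pair (h1.comp fst) (primrec_append (h2.comp fst) (primrec_singleton snd)))
      (.pair (primrec_append (h1.comp fst) (primrec_singleton (.pair (h2.comp fst) snd)))
        (.const []))
  exact list_foldl (f := fun e : List Sym => e) .id (.const ([], [])) h.to₂

lemma primrec_rotateTerms : Primrec rotateTerms :=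
  list_casesOn fst (.const []) (Primrec.to₂ (primrec_cons (.pair (primrec_append
    (snd.comp fst) (fst.comp (fst.comp snd))) (snd.comp (fst.comp snd))) (snd.comp snd)))

lemma primrec_emit : Primrec emit := by
  have h : Primrec fun y : GWord × (GLetter × GWord) => (Sum.elim (fun _ => .inr [])
      (fun q : ℕ × List Sym => .inl (q.1, rotateTerms (collect q.2))) y.2.1 : PeriphEqName) :=
    primrec_sumElim (g := fun _ _ => (.inr [] : PeriphEqName))
      (h := fun _ (q : ℕ × List Sym) => .inl (q.1, rotateTerms (collect q.2))) (fst.comp snd) (.const _)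
      (primrec_inl (.pair (fst.comp snd)
        (primrec_rotateTerms.comp (primrec_collect.comp (snd.comp snd)))))
  exact ite (Primrec.eq.comp primrec_wordVars (.const []))
    (primrec_inr (primrec_flatMap .id (primrec_constLetters.comp snd)))
    (list_casesOn (f := fun W : GWord => W) .id (.const _) h.to₂)

lemma primrec_writeDisjunction :
    Primrec fun x : List (ℕ × ℕ) × EquationName => writeDisjunction x.1 x.2 := by
  have hL : Primrec fun x : List (ℕ × ℕ) × EquationName => x.2.len := primrec_len.comp snd
  have hn : Primrec fun x : List (ℕ × ℕ) × EquationName => 2 * (x.2.len * x.2.len) + x.2.len + 1 :=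
    nat_add.comp (nat_add.comp (nat_mul.comp (.const 2) (nat_mul.comp hL hL)) hL) (.const 1)
  have hs : Primrec fun y : (List (ℕ × ℕ) × EquationName) × List SysState =>
      y.2.flatMap (sysStep y.1.1) :=
    primrec_flatMap snd (primrec_sysStep.comp (.pair (fst.comp (fst.comp fst)) snd))
  have hi : Primrec fun x : List (ℕ × ℕ) × EquationName =>
      [(([initWord x.2], []) : SysState)] :=
    primrec_singleton (.pair (primrec_singleton (primrec_initWord.comp snd)) (.const []))
  refine primrec_map (primrec_filterMap (nat_iterate hn hi hs.to₂) ?_)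
    (primrec_map snd (primrec_emit.comp snd))
  exact ite (Primrec.eq.comp (fst.comp snd) (.const [])) (option_some.comp (snd.comp snd))
    (.const none)

/-! ### The table -/

open Nat.Partrec (Code)

/-- The list found by `c` in `k` steps on the input `(l, L)`. -/
def ballAt (k : ℕ) (c : Code) (L l : ℕ) : Option (List ℕ) :=
  (c.evaln k (Encodable.encode (l, L))).bind fun m => Encodable.decode m

def tableStep (p : (ℕ × Code) × ℕ) (l : ℕ) (acc : Option (List (ℕ × ℕ))) :
    Option (List (ℕ × ℕ)) :=
  acc.bind fun T => (ballAt p.1.1 p.1.2 p.2 l).map fun s => s.map (fun j => (l, j)) ++ T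

/-- All lists for the subgroups in `E`, if they are found in `k` steps. -/
def tableAt (k : ℕ) (c : Code) (L : ℕ) (E : EquationName) : Option (List (ℕ × ℕ)) :=
  E.foldr (fun t => tableStep ((k, c), L) t.2.1) (some [])

/-- The program is run with more and more steps until it has answered for every subgroup in the
equation. It receives only the name of the subgroup and `L`; the constant `C(1,1)` is implicit in
its answers and is never computed. -/
def writeAlgorithm (p : Code × EquationName) : Part DisjunctionName :=
  Nat.rfindOpt fun k => (tableAt k p.1 p.2.len p.2).map fun T => writeDisjunction T p.2

lemma primrec_ballAt : Primrec fun x : (ℕ × Code) × (ℕ × ℕ) => ballAt x.1.1 x.1.2 x.2.1 x.2.2 :=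
  primrec_bind (Code.primrec_evaln.comp (.pair fst (Primrec.encode.comp
    (.pair (snd.comp snd) (fst.comp snd))))) (Primrec.decode.comp snd)

lemma primrec_tableStep :
    Primrec fun y : (((ℕ × Code) × ℕ) × ℕ) × Option (List (ℕ × ℕ)) =>
      tableStep y.1.1 y.1.2 y.2 := by
  unfold tableStep
  have hb : Primrec fun y : (((ℕ × Code) × ℕ) × ℕ) × Option (List (ℕ × ℕ)) =>
      ballAt y.1.1.1.1 y.1.1.1.2 y.1.1.2 y.1.2 :=
    primrec_ballAt.comp (.pair (fst.comp (fst.comp fst))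
      (.pair (snd.comp (fst.comp fst)) (snd.comp fst)))
  exact primrec_bind snd (primrec_optionMap (hb.comp fst) (primrec_append (primrec_map snd
    (.pair (snd.comp (fst.comp (fst.comp (fst.comp fst)))) snd)) (snd.comp fst)))

lemma primrec_tableAt : Primrec fun x : ((ℕ × Code) × ℕ) × EquationName =>
    tableAt x.1.1.1 x.1.1.2 x.1.2 x.2 := by
  have h : Primrec fun y : (((ℕ × Code) × ℕ) × EquationName) ×
      ((List LetterName × (ℕ × ℕ)) × Option (List (ℕ × ℕ))) =>
        tableStep y.1.1 y.2.1.2.1 y.2.2 :=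
    primrec_tableStep.comp (.pair (.pair (fst.comp fst) (fst.comp (snd.comp (fst.comp snd))))
      (snd.comp snd))
  exact list_foldr snd (.const (some [])) h.to₂

/-- Only the search for the number of steps is unbounded; all that is done with a given number is
primitive recursive. -/
lemma partrec_writeAlgorithm : Partrec writeAlgorithm := by
  refine Partrec.rfindOpt (Primrec.to_comp ?_)
  exact primrec_optionMap (primrec_tableAt.comp (.pair (.pair (.pair snd (fst.comp fst))
    (primrec_len.comp (snd.comp fst))) (snd.comp fst)))
      (primrec_writeDisjunction.comp (.pair snd (snd.comp (fst.comp fst))))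

lemma ballAt_mono {k k' : ℕ} (h : k ≤ k') {c : Code} {L l : ℕ} {s : List ℕ}
    (hs : ballAt k c L l = some s) : ballAt k' c L l = some s := by
  obtain ⟨m, hm, hs⟩ := Option.bind_eq_some_iff.1 hs
  exact Option.bind_eq_some_iff.2 ⟨m, Code.evaln_mono h hm, hs⟩

lemma exists_ballAt {c : Code} {L l : ℕ} {s : List ℕ}
    (h : Encodable.encode s ∈ c.eval (Encodable.encode (l, L))) :
    ∃ k, ballAt k c L l = some s := by
  obtain ⟨k, hk⟩ := Code.evaln_complete.1 h
  exact ⟨k, Option.bind_eq_some_iff.2 ⟨_, hk, Encodable.encodek s⟩⟩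

lemma ballAt_sound {k : ℕ} {c : Code} {L l : ℕ} {s s' : List ℕ} (hs' : ballAt k c L l = some s')
    (h : Encodable.encode s ∈ c.eval (Encodable.encode (l, L))) : s' = s := by
  obtain ⟨m, hm, hs⟩ := Option.bind_eq_some_iff.1 hs'
  obtain rfl := Part.mem_unique (Code.evaln_sound hm) h
  rw [Encodable.encodek] at hs
  exact (Option.some.inj hs).symm

lemma tableAt_cons_eq_some {k : ℕ} {c : Code} {L : ℕ} {t : List LetterName × (ℕ × ℕ)}
    {E : EquationName} {T : List (ℕ × ℕ)} :
    tableAt k c L (t :: E) = some T ↔ ∃ T' s, tableAt k c L E = some T' ∧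
      ballAt k c L t.2.1 = some s ∧ s.map (fun j => (t.2.1, j)) ++ T' = T := by
  rw [tableAt, List.foldr_cons, tableStep, Option.bind_eq_some_iff]
  simp only [Option.map_eq_some_iff, ← exists_and_left]
  rfl

lemma mem_tableAt {k : ℕ} {c : Code} {L : ℕ} {E : EquationName} {T : List (ℕ × ℕ)}
    (h : tableAt k c L E = some T) {p : ℕ × ℕ} :
    p ∈ T ↔ ∃ t ∈ E, t.2.1 = p.1 ∧ ∃ s, ballAt k c L p.1 = some s ∧ p.2 ∈ s := by
  induction E generalizing T with
  | nil =>
    obtain rfl : [] = T := Option.some.inj h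
    simp
  | cons t E ih =>
    obtain ⟨T', s, h1, h2, rfl⟩ := tableAt_cons_eq_some.1 h
    rw [List.mem_append, ih h1, List.mem_map]
    constructor
    · rintro (⟨j, hj, rfl⟩ | ⟨t', ht', h'⟩)
      · exact ⟨t, by simp, rfl, s, h2, hj⟩
      · exact ⟨t', by simp [ht'], h'⟩
    · rintro ⟨t', ht', h3, s', h4, h5⟩
      rcases List.mem_cons.1 ht' with rfl | ht'
      · rw [h3] at h2
        obtain rfl := Option.some.inj (h2.symm.trans h4)
        exact .inl ⟨p.2, h5, by rw [h3]⟩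
      · exact .inr ⟨t', ht', h3, s', h4, h5⟩

lemma exists_tableAt {c : Code} {L : ℕ} {E : EquationName}
    (h : ∀ t ∈ E, ∃ k s, ballAt k c L t.2.1 = some s) :
    ∃ k₀, ∀ k, k₀ ≤ k → ∃ T, tableAt k c L E = some T := by
  induction E with
  | nil => exact ⟨0, fun k _ => ⟨[], rfl⟩⟩
  | cons t E ih =>
    obtain ⟨k₀, hk₀⟩ := ih fun t ht => h t (by simp [ht])
    obtain ⟨k₁, s, hs⟩ := h t (by simp)
    refine ⟨max k₀ k₁, fun k hk => ?_⟩
    obtain ⟨T, hT⟩ := hk₀ k (le_trans (le_max_left _ _) hk)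
    exact ⟨_, tableAt_cons_eq_some.2 ⟨T, s, hT, ballAt_mono (le_trans (le_max_right _ _) hk) hs,
      rfl⟩⟩

theorem writeAlgorithm_spec {G : Type*} [Group G] {Λ : Type*} {H : Λ → Subgroup G} {X : Set G}
    {C : ℝ} (hC : IsPolygonConstant H X 1 1 C) (N : Naming H X) (E : EquationName)
    (A : Fin E.length → List (Letter H X)) (g : Fin E.length → Σ lam, H lam)
    (hE : N.NamesEquation E A g) (c : Code)
    (hc : ∀ i, N.Computes c (E.get i).2.1 E.len (relBall H X (g i).1 1 (C * E.len))) :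
    ∃ D ∈ writeAlgorithm (c, E), ∃ Φ : Disjunction H E.length,
      N.NamesDisjunction D Φ ∧ Φ.DisjointVars ∧ ∀ k : Fin E.length → ℤ,
        (expEquation (fun i => wordVal (A i)) fun i => ((g i).2 : G)).IsSolution k ↔
          Φ.IsSolution k := by
  have hdom : (writeAlgorithm (c, E)).Dom := by
    rw [writeAlgorithm, Nat.rfindOpt_dom]
    obtain ⟨k, hk⟩ := exists_tableAt (c := c) (L := E.len) (E := E) (by
      intro t ht
      obtain ⟨i, rfl⟩ := List.get_of_mem ht
      obtain ⟨s, hs, -⟩ := hc i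
      obtain ⟨k, hk⟩ := exists_ballAt hs
      exact ⟨k, s, hk⟩)
    obtain ⟨T, hT⟩ := hk k le_rfl
    exact ⟨k, _, Option.mem_def.2 (by rw [hT]; rfl)⟩
  obtain ⟨D, hD⟩ := Part.dom_iff_mem.1 hdom
  refine ⟨D, hD, ?_⟩
  obtain ⟨k, hk⟩ := Nat.rfindOpt_spec hD
  obtain ⟨T, hT, rfl⟩ := Option.map_eq_some_iff.1 (Option.mem_def.1 hk)
  refine Naming.writeDisjunction_spec hC hE ?_ ?_
  · rintro p hp
    obtain ⟨t, ht, htp, s', hs', hps⟩ := (mem_tableAt hT).1 hp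
    obtain ⟨i, rfl⟩ := List.get_of_mem ht
    obtain ⟨s, hs, h1, -⟩ := hc i
    rw [htp] at hs
    obtain rfl := ballAt_sound hs' hs
    obtain ⟨h, -, hh⟩ := h1 _ hps
    exact ⟨(g i).1, by rw [← htp]; exact (hE i).2.1, by rw [hh]; rfl⟩
  · rintro l ⟨i, rfl⟩ lam hlam h hh
    obtain rfl := Option.some.inj ((hE i).2.1.symm.trans hlam)
    obtain ⟨s, hs, -, h2⟩ := hc i
    obtain ⟨j, hj, hj'⟩ := h2 h hh
    obtain ⟨k', hk'⟩ := exists_ballAt hs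
    -- The output belongs to the stage `k` at which the search stopped. That the table existed at
    -- this stage means that every ball had been found by then.
    have hsome : ∃ s', ballAt k c E.len (E.get i).2.1 = some s' := by
      have : ∀ E' : EquationName, ∀ T', tableAt k c E.len E' = some T' →
          ∀ t ∈ E', ∃ s', ballAt k c E.len t.2.1 = some s' := by
        intro E'
        induction E' with
        | nil => simp
        | cons t E' ih =>
          intro T' hT' t' ht'
          obtain ⟨T'', s'', h3, h4, -⟩ := tableAt_cons_eq_some.1 hT'
          rcases List.mem_cons.1 ht' with rfl | ht'
          · exact ⟨s'', h4⟩
          · exact ih T'' h3 t' ht'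
      exact this E T hT _ (List.get_mem _ _)
    obtain ⟨s', hs'⟩ := hsome
    obtain rfl := ballAt_sound hs' hs
    exact ⟨j, (mem_tableAt hT).2 ⟨_, List.get_mem E i, rfl, s', hs', hj⟩, hj'⟩

end ExpEqs

namespace ExpEqs

/-! ### Names for countably many letters -/

lemma exists_enumeration {α : Type*} {S : Set α} (hS : S.Countable) :
    ∃ e : ℕ → Option α, ∀ x ∈ S, ∃ j, e j = some x := by
  obtain ⟨e, he⟩ := ((hS.image some).insert none).exists_eq_range (Set.insert_nonempty _ _)
  exact ⟨e, fun x hx => he.subset (.inr ⟨x, hx, rfl⟩)⟩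

/-- Only the first occurrence of each element in an enumeration is kept. -/
lemma exists_injective_enumeration {α : Type*} {S : Set α} (hS : S.Countable) :
    ∃ e : ℕ → Option α, (∀ x ∈ S, ∃ j, e j = some x) ∧
      ∀ j j' x, e j = some x → e j' = some x → j = j' := by
  classical
  obtain ⟨e, he⟩ := exists_enumeration hS
  refine ⟨fun j => if ∀ i < j, e i ≠ e j then e j else none, fun x hx => ?_,
    fun j j' x hj hj' => ?_⟩
  · refine ⟨Nat.find (he x hx), ?_⟩
    refine (if_pos ?_).trans (Nat.find_spec (he x hx))
    intro i hi
    rw [Nat.find_spec (he x hx)]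
    exact Nat.find_min (he x hx) hi
  · simp only [Option.ite_none_right_eq_some] at hj hj'
    rcases lt_trichotomy j j' with h | h | h
    · exact absurd (hj.2.trans hj'.2.symm) (hj'.1 j h)
    · exact h
    · exact absurd (hj'.2.trans hj.2.symm) (hj.1 j' h)

variable {G : Type*} [Group G] {Λ : Type*} {H : Λ → Subgroup G} {X : Set G}

/-- Names are natural numbers, so only countably many letters can be named. This lets the symbolic
procedure serve for arbitrary groups, with no effectiveness assumed. -/
lemma exists_naming {S : Set (Letter H X)} (hS : S.Countable) :
    ∃ N : Naming H X, ∀ x ∈ S, ∃ p, N.NamesLetter p x := by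
  obtain ⟨gen, hgen⟩ := exists_enumeration (hS.preimage Sum.inl_injective)
  obtain ⟨idx, hidx, hinj⟩ := exists_injective_enumeration (S := {lam | ∃ h : H lam, Sum.inr ⟨lam, h⟩ ∈ S})
    (((hS.preimage Sum.inr_injective).image Sigma.fst).mono
      (by rintro lam ⟨h, hh⟩; exact ⟨⟨lam, h⟩, hh, rfl⟩))
  choose elt helt using fun lam => exists_enumeration (hS.preimage (Sum.inr_injective.comp
    (sigma_mk_injective (i := lam))))
  refine ⟨⟨gen, idx, elt, hinj⟩, ?_⟩
  rintro (x | ⟨lam, h⟩) hx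
  · obtain ⟨i, hi⟩ := hgen x hx
    exact ⟨.inl i, hi⟩
  · obtain ⟨l, hl⟩ := hidx lam ⟨h, hx⟩
    obtain ⟨j, hj⟩ := helt lam h hx
    exact ⟨.inr (l, j), hl, hj⟩

lemma Naming.exists_namesElt {N : Naming H X} {h : Σ lam, H lam}
    (hN : ∃ p, N.NamesLetter p (.inr h)) : ∃ p, N.NamesElt p h := by
  obtain ⟨i | p, hp⟩ := hN
  · exact hp.elim
  · exact ⟨p, hp⟩

lemma Naming.exists_forall₂_namesLetter {N : Naming H X} {w : List (Letter H X)}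
    (hN : ∀ x ∈ w, ∃ p, N.NamesLetter p x) : ∃ v, List.Forall₂ N.NamesLetter v w := by
  induction w with
  | nil => exact ⟨[], .nil⟩
  | cons x w ih =>
    obtain ⟨p, hp⟩ := hN x (by simp)
    obtain ⟨v, hv⟩ := ih fun y hy => hN y (by simp [hy])
    exact ⟨p :: v, .cons hp hv⟩

/-- Lists of names of the elements of finitely many finite subsets of subgroups. -/
lemma Naming.exists_table {N : Naming H X} {ι : Type*} (s : Finset ι) (lam : ι → Λ)
    (B : ∀ i, Set (H (lam i))) (hB : ∀ i, (B i).Finite)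
    (hN : ∀ i, ∀ h ∈ B i, ∃ p, N.NamesElt p ⟨lam i, h⟩) :
    ∃ T : List (ℕ × ℕ), N.TableValid T ∧ ∀ i ∈ s, ∀ h ∈ B i, ∃ p ∈ T, N.NamesElt p ⟨lam i, h⟩ := by
  classical
  choose f hf using hN
  let F : Finset (ℕ × ℕ) := s.biUnion fun i => (hB i).toFinset.attach.image fun h =>
    f i h.1 ((hB i).mem_toFinset.1 h.2)
  refine ⟨F.toList, fun p hp => ?_, fun i hi h hh => ⟨f i h hh, ?_, hf i h hh⟩⟩
  · simp only [F, Finset.mem_toList, Finset.mem_biUnion, Finset.mem_image] at hp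
    obtain ⟨i, -, h, -, rfl⟩ := hp
    obtain ⟨h1, h2⟩ := hf i h.1 ((hB i).mem_toFinset.1 h.2)
    exact ⟨_, h1, by rw [h2]; rfl⟩
  · simp only [F, Finset.mem_toList, Finset.mem_biUnion, Finset.mem_image]
    exact ⟨i, hi, ⟨h, (hB i).mem_toFinset.2 hh⟩, Finset.mem_attach _ _, rfl⟩

/-- Every exponential equation is equivalent to a finite disjunction of finite systems. -/
theorem IsHyperbolicallyEmbedded.exists_disjunction (hHX : IsHyperbolicallyEmbedded H X) {n : ℕ}
    (a : Fin n → G) (g : Fin n → Σ lam, H lam) :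
    ∃ Φ : Disjunction H n, Φ.DisjointVars ∧ ∀ k : Fin n → ℤ,
      (expEquation a fun i => ((g i).2 : G)).IsSolution k ↔ Φ.IsSolution k := by
  obtain ⟨C, hC⟩ := hHX.exists_polygonConstant
  choose A hA using fun i => hHX.toGenerates.exists_word (a i)
  obtain rfl : a = fun i => wordVal (A i) := funext fun i => (hA i).symm
  -- The names must be fixed before the named equation and its length exist, so the balls for all
  -- radii `C * m` are included; their union is countable by properness.
  let S : Set (Letter H X) := (⋃ i, {x | x ∈ A i}) ∪ ((Set.range fun i => .inr (g i)) ∪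
    ⋃ (i : Fin n) (m : ℕ), (fun h => .inr ⟨(g i).1, h⟩) '' relBall H X (g i).1 1 (C * m))
  have hS : S.Countable := by
    refine .union (Set.countable_iUnion fun i => (List.finite_toSet _).countable)
      (.union (Set.countable_range _) (Set.countable_iUnion fun i => Set.countable_iUnion fun m =>
        ((hHX.proper _ _ _).image _).countable))
  obtain ⟨N, hN⟩ := exists_naming hS
  choose W hW using fun i => Naming.exists_forall₂_namesLetter (N := N) (w := A i) fun x hx =>
    hN x (.inl (Set.mem_iUnion.2 ⟨i, hx⟩))
  choose p hp using fun i => Naming.exists_namesElt (hN (.inr (g i)) (.inr (.inl ⟨i, rfl⟩)))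
  obtain ⟨E, hlen, hE⟩ : ∃ (E : EquationName) (h : E.length = n),
      ∀ i : Fin E.length, E.get i = (W (Fin.cast h i), p (Fin.cast h i)) :=
    ⟨List.ofFn fun i => (W i, p i), by simp, fun i => by simp [Fin.cast]⟩
  subst hlen
  simp only [Fin.cast_eq_self] at hE
  obtain ⟨T, hTV, hT⟩ := Naming.exists_table (N := N) Finset.univ (fun i => (g i).1)
    (fun i => relBall H X (g i).1 1 (C * E.len)) (fun i => hHX.proper _ _ _) fun i h hh =>
      Naming.exists_namesElt (hN _ (.inr (.inr (Set.mem_iUnion.2 ⟨i, Set.mem_iUnion.2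
        ⟨E.len, h, hh, rfl⟩⟩))))
  obtain ⟨Φ, -, h1, h2⟩ := Naming.writeDisjunction_spec hC (N := N) (E := E) (A := A) (g := g)
    (fun i => by rw [hE]; exact ⟨hW i, hp i⟩) hTV (by
      rintro l ⟨i, rfl⟩ lam hlam h hh
      rw [hE] at hlam ⊢
      obtain rfl := Option.some.inj ((hp i).1.symm.trans hlam)
      obtain ⟨⟨l', j⟩, hj, h3, h4⟩ := hT i (Finset.mem_univ i) h hh
      obtain rfl := N.idx_inj _ _ _ h3 (hp i).1
      exact ⟨j, hj, h4⟩)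
  exact ⟨Φ, h1, h2⟩

end ExpEqs

theorem theoremB {G : Type*} [Group G] {Λ : Type*} (H : Λ → Subgroup G) (X : Set G)
    (hHX : ExpEqs.IsHyperbolicallyEmbedded H X) :
    -- every exponential equation with bases in the subgroups is equivalent to a finite disjunction
    -- of finite systems of the required form
    (∀ (n : ℕ) (a : Fin n → G) (g : Fin n → Σ lam, H lam),
      ∃ Φ : ExpEqs.Disjunction H n, Φ.DisjointVars ∧
        ∀ k : Fin n → ℤ,
          (ExpEqs.expEquation a fun i => ((g i).2 : G)).IsSolution k ↔ Φ.IsSolution k) ∧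
    -- the constant `C(1,1)` exists
    (∃ C : ℝ, ExpEqs.IsPolygonConstant H X 1 1 C) ∧
    -- an algorithm writes such a disjunction, given the equation and an algorithm that
    -- computes the finite sets `{h ∈ H_λ | d̂_λ(1, h) ≤ C(1,1) L}` for the `λ` with some `gᵢ ∈ H_λ`
    ∃ write : Nat.Partrec.Code × ExpEqs.EquationName →. ExpEqs.DisjunctionName,
      Partrec write ∧
      ∀ (C : ℝ), ExpEqs.IsPolygonConstant H X 1 1 C →
      ∀ (N : ExpEqs.Naming H X) (E : ExpEqs.EquationName)
        (A : Fin E.length → List (ExpEqs.Letter H X)) (g : Fin E.length → Σ lam, H lam),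
        N.NamesEquation E A g →
      ∀ c : Nat.Partrec.Code,
        (∀ i, N.Computes c (E.get i).2.1 E.len
          (ExpEqs.relBall H X (g i).1 1 (C * E.len))) →
        ∃ D ∈ write (c, E), ∃ Φ : ExpEqs.Disjunction H E.length,
          N.NamesDisjunction D Φ ∧ Φ.DisjointVars ∧
          ∀ k : Fin E.length → ℤ,
            (ExpEqs.expEquation (fun i => ExpEqs.wordVal (A i))
              fun i => ((g i).2 : G)).IsSolution k ↔ Φ.IsSolution k := by
  exact ⟨fun n a g => hHX.exists_disjunction a g, hHX.exists_polygonConstant,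
    ExpEqs.writeAlgorithm, ExpEqs.partrec_writeAlgorithm, fun C hC N E A g hE c hc =>
      ExpEqs.writeAlgorithm_spec hC N E A g hE c hc⟩
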